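/- Notation. Let $d\in\mathbb N$, let $k=(k_1,\dots,k_d)\in\mathbb N^d$ be a multi-index (entries $0,1,2,\dots$), $|k|=\sum_j k_j$, $k!=\prod_j k_j!$, and let $1\le p<\infty$. For vectors, $x\cdot z=\sum_j x_jz_j$ is bilinear, $z^2=z\cdot z$, $|z|^2=\sum_j|z_j|^2$ and $z^k=\prod_j z_j^{k_j}$. *Modulation spaces.* With $\varphi_0(t)=2^{d/4}e^{-\pi t^2}$, for $1\le q\le\infty$, $M^q=M^q(\mathbb R^d)$ is the space of tempered distributions $f$ whose short-time Fourier transform $V_{\varphi_0}f(x,\omega)=\langle f,e^{2\pi i\omega\cdot(\cdot)}\varphi_0(\cdot-x)\rangle$ belongs to $L^q(\mathbb R^{2d})$, with norm $\|V_{\varphi_0}f\|_{L^q}$. $M_c(M^p)$ is the set of tempered distributions $u$ for which there is a bounded linear operator $A$ on $M^p$ commuting with all translations $T_yf=f(\cdot-y)$, $y\in\mathbb R^d$, and satisfying $Af=u*f$ for all Schwartz functions $f$. *Bargmann transforms.* For a tempered distribution $f$ put $$Bf(z)=2^{d/4}\int_{\mathbb R^d}f(x)e^{2\pi x\cdot z-\pi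 x^2-\pi z^2/2}\,dx,\qquad B^kf(z)=\frac{1}{\sqrt{\pi^{|k|}k!}}\,e^{\pi|z|^2}\partial_z^k\big(e^{-\pi|z|^2}Bf(z)\big),\qquad z\in\mathbb C^d,$$ where integrals against a distribution denote its pairing with the Schwartz function that it multiplies. For $1\le q\le\infty$, the polyanalytic Sobolev–Fock space is $\mathcal F^q_k=B^k(M^q)$, with norm $\|F(z)e^{-\pi|z|^2/2}\|_{L^q(\mathbb C^d)}$. For $F\in\mathcal F_k^1$, $(B^k)^*F$ is the tempered distribution determined by $\langle (B^k)^*F,g\rangle=\int_{\mathbb C^d}F(z)\overline{B^kg(z)}e^{-\pi|z|^2}\,dz$ for all Schwartz functions $g$, and $\widetilde F=B(B^k)^*F$. For $y\in\mathbb R^d$ let $\beta_yF(z)=e^{\pi y\cdot z-\pi y^2/2}F(z-y)$; an operator $S$ on $\mathcal F^p_k$ is called translation invariant if $S\beta_y=\beta_yS$ on $\mathcal F_k^p$ for all $y\in\mathbb R^d$. For a tempered distribution $u$ and $z,w\in\mathbb C^d$ put $$\psi(z,w)=\int_{\mathbb R^d}\prod_{j=1}^dL_{k_j}(\pi|z_j-y_j|^2)\,u(y)\,e^{-\pi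 y^2/2+\pi y\cdot w}\,dy,\qquad \phi(z,w)=\sqrt{\frac{\pi^{|k|}}{k!}}\int_{\mathbb R^d}(y-\overline z)^k\,u(y)\,e^{-\pi y^2/2+\pi y\cdot w}\,dy,$$ where $L_n(x)=\sum_{j=0}^n\binom nj\frac{(-x)^j}{j!}$ is the $n$-th Laguerre polynomial. **Theorem.** (i) Let $u\in M_c(M^p)$. For every $F\in\mathcal F^1_k$ and every $z\in\mathbb C^d$ the following two integrals converge absolutely and are equal, and the function $SF$ that they define belongs to $\mathcal F^\infty_k$: $$SF(z)=\int_{\mathbb C^d}F(w)e^{\pi\overline w\cdot z}\psi(z-w,z-\overline w)e^{-\pi|w|^2}\,dw=\int_{\mathbb C^d}\widetilde F(w)e^{\pi\overline w\cdot z}\phi(z-w,z-\overline w)e^{-\pi|w|^2}\,dw .$$ The operator $S:\mathcal F^1_k\to\mathcal F^\infty_k$ extends uniquely to a bounded linear operator on $\mathcal F^p_k$, and this extension is translation invariant. (ii) Conversely, if $S$ is a bounded, translation invariant linear operator on $\mathcal F^p_k$, then there is $u\in M_c(M^p)$ such that $SF$ is given by both of these formulas for every $F\in\mathcal F_k^1$.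 -/

import Mathlib

open MeasureTheory
open scoped ENNReal NNReal SchwartzMap

noncomputable section

namespace PolyFock

/-- `ℝ^d` with its Euclidean norm. -/
abbrev RSpace (d : ℕ) : Type := EuclideanSpace ℝ (Fin d)

/-- `ℂ^d`, with the product Lebesgue measure (that is, Lebesgue measure on `ℝ^{2d}`).
The Euclidean length is `sqNorm` below; the sup norm of the type is not used. -/
abbrev CSpace (d : ℕ) : Type := Fin d → ℂ

/-! ### Schwartz functions used as test functions -/

/-- The exponent `-a |t|² + t · w`, where `t · w = ∑ t_j w_j` is bilinear. -/
def gaussExponent {d : ℕ} (a : ℝ) (w : CSpace d) (t : RSpace d) : ℂ :=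
  -((a * ‖t‖ ^ 2 : ℝ) : ℂ) + ∑ j, (t j : ℂ) * w j

theorem coord_hasTemperateGrowth {d : ℕ} (j : Fin d) :
    Function.HasTemperateGrowth (fun t : RSpace d => ((t j : ℝ) : ℂ)) :=
  (Complex.ofRealCLM.comp (EuclideanSpace.proj (𝕜 := ℝ) j)).hasTemperateGrowth

theorem gaussExponent_hasTemperateGrowth {d : ℕ} (a : ℝ) (w : CSpace d) :
    Function.HasTemperateGrowth (gaussExponent a w) := by
  have h1 : Function.HasTemperateGrowth (fun t : RSpace d => ((a * ‖t‖ ^ 2 : ℝ) : ℂ)) :=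
    Function.Complex.hasTemperateGrowth_ofReal.comp
      ((Function.HasTemperateGrowth.const a).mul (Function.hasTemperateGrowth_norm_sq (RSpace d)))
  have h2 : Function.HasTemperateGrowth (fun t : RSpace d => ∑ j, (t j : ℂ) * w j) :=
    Function.HasTemperateGrowth.sum fun j _ =>
      (coord_hasTemperateGrowth j).mul (Function.HasTemperateGrowth.const (w j))
  exact h1.neg.add h2

theorem norm_iteratedFDeriv_cexp_le {d : ℕ} {Q : RSpace d → ℂ}
    (hQ : Function.HasTemperateGrowth Q) (n : ℕ) :
    ∃ (k : ℕ) (C : ℝ), 0 ≤ C ∧ ∀ m ≤ n, ∀ x, ‖iteratedFDeriv ℝ m (fun t => Complex.exp (Q t)) x‖ ≤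
      C * (1 + ‖x‖) ^ k * ‖Complex.exp (Q x)‖ := by
  have hs : ContDiff ℝ (⊤ : ℕ∞) (fun t => Complex.exp (Q t)) := hQ.1.cexp
  have hd : fderiv ℝ (fun t => Complex.exp (Q t)) =
      fun x => Complex.exp (Q x) • fderiv ℝ Q x := by
    funext x
    exact ((hQ.1.differentiable (by simp)) x).hasFDerivAt.cexp.fderiv
  have hs' : ContDiff ℝ (⊤ : ℕ∞) (fderiv ℝ Q) := hQ.1.fderiv_right (by simp)
  induction n with
  | zero =>
    refine ⟨0, 1, zero_le_one, fun m hm x => ?_⟩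
    obtain rfl : m = 0 := by omega
    simp
  | succ n ih =>
    obtain ⟨k, C, hC, h⟩ := ih
    obtain ⟨k', C', hC', h'⟩ := hQ.norm_iteratedFDeriv_le_uniform (n + 1)
    refine ⟨k + k', C + 2 ^ n * (C * C'), by positivity, fun m hm x => ?_⟩
    have h1 : (1 : ℝ) ≤ 1 + ‖x‖ := by simp
    rcases Nat.lt_or_ge m (n + 1) with hmn | hmn
    · refine (h m (by omega) x).trans ?_
      gcongr
      · have : 0 ≤ 2 ^ n * (C * C') := by positivity
        linarith
      · omega
    · obtain rfl : m = n + 1 := by omega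
      rw [← norm_iteratedFDeriv_fderiv, hd]
      refine (norm_iteratedFDeriv_smul_le hs hs' x (n := n) (by exact_mod_cast le_top)).trans ?_
      have key : ∀ i ∈ Finset.range (n + 1),
          (n.choose i : ℝ) * ‖iteratedFDeriv ℝ i (fun t => Complex.exp (Q t)) x‖ *
            ‖iteratedFDeriv ℝ (n - i) (fderiv ℝ Q) x‖ ≤
          (n.choose i : ℝ) * (C * (1 + ‖x‖) ^ k * ‖Complex.exp (Q x)‖) *
            (C' * (1 + ‖x‖) ^ k') := by
        intro i hi
        have hi' : i ≤ n := by simpa [Nat.lt_succ_iff] using hi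
        rw [norm_iteratedFDeriv_fderiv]
        gcongr
        · exact h i hi' x
        · exact h' _ (by omega) x
      refine (Finset.sum_le_sum key).trans ?_
      rw [← Finset.sum_mul, ← Finset.sum_mul]
      have : ∑ i ∈ Finset.range (n + 1), (n.choose i : ℝ) = 2 ^ n := by
        exact_mod_cast Nat.sum_range_choose n
      rw [this]
      have h2 : 0 ≤ C * (1 + ‖x‖) ^ (k + k') * ‖Complex.exp (Q x)‖ := by positivity
      calc _ = 2 ^ n * (C * C') * (1 + ‖x‖) ^ (k + k') * ‖Complex.exp (Q x)‖ := by
            rw [pow_add]; ring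
        _ ≤ _ := by
            rw [add_mul, add_mul]; linarith

theorem gaussExponent_re_le {d : ℕ} (a : ℝ) (w : CSpace d) (t : RSpace d) :
    (gaussExponent a w t).re ≤ -(a * ‖t‖ ^ 2) + (∑ j, ‖w j‖) * ‖t‖ := by
  have h : (∑ j, (t j : ℂ) * w j).re ≤ (∑ j, ‖w j‖) * ‖t‖ := by
    refine (Complex.re_le_norm _).trans ((norm_sum_le _ _).trans ?_)
    rw [Finset.sum_mul]
    refine Finset.sum_le_sum fun j _ => ?_
    rw [norm_mul, Complex.norm_real, mul_comm]
    gcongr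
    exact EuclideanSpace.norm_eq t ▸ PiLp.norm_apply_le t j
  simp only [gaussExponent, Complex.add_re, Complex.neg_re, Complex.ofReal_re]
  linarith

/-- The Schwartz function `t ↦ exp (-a |t|² + t · w)` on `ℝ^d`, for `a > 0` and `w ∈ ℂ^d`. -/
def gaussExp {d : ℕ} (a : ℝ) (ha : 0 < a) (w : CSpace d) : 𝓢(RSpace d, ℂ) where
  toFun t := Complex.exp (gaussExponent a w t)
  smooth' := (gaussExponent_hasTemperateGrowth a w).1.cexp
  decay' := by
    intro l n
    obtain ⟨k, C, hC, h⟩ := norm_iteratedFDeriv_cexp_le (gaussExponent_hasTemperateGrowth a w) n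
    set b : ℝ := ∑ j, ‖w j‖
    refine ⟨C * ((l + k).factorial * Real.exp (1 + (1 + b) ^ 2 / (4 * a))), fun x => ?_⟩
    have h0 : 0 ≤ ‖x‖ := norm_nonneg x
    have h1 : (1 + ‖x‖) ^ (l + k) ≤ (l + k).factorial * Real.exp (1 + ‖x‖) := by
      have := Real.pow_div_factorial_le_exp (1 + ‖x‖) (by positivity) (l + k)
      rwa [div_le_iff₀' (by positivity)] at this
    have h2 : 1 + ‖x‖ + (gaussExponent a w x).re ≤ 1 + (1 + b) ^ 2 / (4 * a) := by
      have := gaussExponent_re_le a w x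
      have h3 : (1 + b) * ‖x‖ - a * ‖x‖ ^ 2 ≤ (1 + b) ^ 2 / (4 * a) := by
        rw [le_div_iff₀ (by positivity)]
        nlinarith [sq_nonneg (2 * a * ‖x‖ - (1 + b))]
      change (gaussExponent a w x).re ≤ -(a * ‖x‖ ^ 2) + b * ‖x‖ at this
      linarith
    calc ‖x‖ ^ l * ‖iteratedFDeriv ℝ n (fun t => Complex.exp (gaussExponent a w t)) x‖
        ≤ (1 + ‖x‖) ^ l * (C * (1 + ‖x‖) ^ k * ‖Complex.exp (gaussExponent a w x)‖) := by
          gcongr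
          · linarith
          · exact h n le_rfl x
      _ = C * ((1 + ‖x‖) ^ (l + k) * Real.exp (gaussExponent a w x).re) := by
          rw [Complex.norm_exp, pow_add]; ring
      _ ≤ C * ((l + k).factorial * Real.exp (1 + ‖x‖) * Real.exp (gaussExponent a w x).re) := by
          gcongr
      _ = C * ((l + k).factorial * Real.exp (1 + ‖x‖ + (gaussExponent a w x).re)) := by
          rw [Real.exp_add (1 + ‖x‖)]; ring
      _ ≤ _ := by gcongr

theorem gaussExp_apply {d : ℕ} (a : ℝ) (ha : 0 < a) (w : CSpace d) (t : RSpace d) :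
    gaussExp a ha w t = Complex.exp (-((a * ‖t‖ ^ 2 : ℝ) : ℂ) + ∑ j, (t j : ℂ) * w j) := rfl

/-- The complex conjugate of a Schwartz function. -/
def conjSchwartz {d : ℕ} (g : 𝓢(RSpace d, ℂ)) : 𝓢(RSpace d, ℂ) :=
  g.postcompCLM (Complex.conjCLE : ℂ →L[ℝ] ℂ)

theorem conjSchwartz_apply {d : ℕ} (g : 𝓢(RSpace d, ℂ)) (t : RSpace d) :
    conjSchwartz g t = (starRingEnd ℂ) (g t) := rfl

/-- The Schwartz function `t ↦ f (x - t)`. -/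
def reflectShift {d : ℕ} (f : 𝓢(RSpace d, ℂ)) (x : RSpace d) : 𝓢(RSpace d, ℂ) :=
  (f.compCLMOfContinuousLinearEquiv ℂ (ContinuousLinearEquiv.neg ℝ)).compSubConstCLM ℂ x

theorem reflectShift_apply {d : ℕ} (f : 𝓢(RSpace d, ℂ)) (x t : RSpace d) :
    reflectShift f x t = f (x - t) := by
  simp [reflectShift]

/-! ### Short-time Fourier transform and modulation spaces -/

/-- The `L²`-normalised Gaussian `φ₀(t) = 2^{d/4} exp (-π |t|²)`. -/
def gaussWindow (d : ℕ) : 𝓢(RSpace d, ℂ) :=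
  (((2 : ℝ) ^ ((d : ℝ) / 4) : ℝ) : ℂ) • gaussExp Real.pi Real.pi_pos 0

theorem gaussWindow_apply {d : ℕ} (t : RSpace d) :
    gaussWindow d t = (((2 : ℝ) ^ ((d : ℝ) / 4) * Real.exp (-(Real.pi * ‖t‖ ^ 2)) : ℝ) : ℂ) := by
  simp [gaussWindow, gaussExp_apply]

/-- The character `t ↦ exp (-2πi ω · t)`. -/
def character {d : ℕ} (ω t : RSpace d) : ℂ :=
  Complex.exp (((-(2 * Real.pi * inner ℝ ω t) : ℝ) : ℂ) * Complex.I)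

theorem character_hasTemperateGrowth {d : ℕ} (ω : RSpace d) :
    Function.HasTemperateGrowth (character ω) := by
  have hQ : Function.HasTemperateGrowth
      (fun t : RSpace d => ((-(2 * Real.pi * inner ℝ ω t) : ℝ) : ℂ) * Complex.I) := by
    have h1 : Function.HasTemperateGrowth (fun t : RSpace d => -(2 * Real.pi * inner ℝ ω t)) :=
      ((Function.HasTemperateGrowth.const (2 * Real.pi)).mul
        (Function.hasTemperateGrowth_inner_right ω)).neg
    exact (Function.Complex.hasTemperateGrowth_ofReal.comp h1).mul
      (Function.HasTemperateGrowth.const Complex.I)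
  refine ⟨hQ.1.cexp, fun n => ?_⟩
  obtain ⟨k, C, -, h⟩ := norm_iteratedFDeriv_cexp_le hQ n
  refine ⟨k, C, fun x => (h n le_rfl x).trans (le_of_eq ?_)⟩
  rw [Complex.norm_exp_ofReal_mul_I, mul_one]

/-- The complex conjugate of the time-frequency shifted Gaussian `M_ω T_x φ₀`. -/
def shiftedWindow {d : ℕ} (x ω : RSpace d) : 𝓢(RSpace d, ℂ) :=
  SchwartzMap.smulLeftCLM ℂ (character ω) ((conjSchwartz (gaussWindow d)).compSubConstCLM ℂ x)

theorem shiftedWindow_apply {d : ℕ} (x ω t : RSpace d) :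
    shiftedWindow x ω t = (starRingEnd ℂ)
      (Complex.exp (((2 * Real.pi * inner ℝ ω t : ℝ) : ℂ) * Complex.I) * gaussWindow d (t - x)) := by
  rw [shiftedWindow, SchwartzMap.smulLeftCLM_apply_apply (character_hasTemperateGrowth ω), map_mul,
    ← Complex.exp_conj]
  have h2 : (starRingEnd ℂ) (2 : ℂ) = 2 := Complex.conj_ofNat 2
  simp [character, conjSchwartz_apply, h2]

/-- The short-time Fourier transform `V_{φ₀} f (x, ω) = ⟨f, M_ω T_x φ₀⟩` of a tempered distribution,
the bracket being antilinear in the second argument. -/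
def stft {d : ℕ} (f : 𝓢'(RSpace d, ℂ)) (z : RSpace d × RSpace d) : ℂ :=
  f (shiftedWindow z.1 z.2)

/-- The modulation space `M^p(ℝ^d)`. -/
def modulationSpace (d : ℕ) (p : ℝ≥0∞) : Set 𝓢'(RSpace d, ℂ) :=
  {f | MemLp (stft f) p volume}

/-- The norm of `M^p(ℝ^d)`. -/
def modulationNorm {d : ℕ} (p : ℝ≥0∞) (f : 𝓢'(RSpace d, ℂ)) : ℝ≥0∞ :=
  eLpNorm (stft f) p volume

/-! ### Bounded operators, translations, convolution operators -/

/-- `T`, restricted to the linear subspace `X`, is a bounded linear operator on `X` with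
respect to the norm `N`. Values of `T` outside `X` are irrelevant. -/
structure IsBoundedOperatorOn {V : Type*} [AddCommGroup V] [Module ℂ V] (X : Set V)
    (N : V → ℝ≥0∞) (T : V → V) : Prop where
  mapsTo : ∀ f ∈ X, T f ∈ X
  map_add : ∀ f ∈ X, ∀ g ∈ X, T (f + g) = T f + T g
  map_smul : ∀ (c : ℂ), ∀ f ∈ X, T (c • f) = c • T f
  bound : ∃ C : ℝ≥0, ∀ f ∈ X, N (T f) ≤ C * N f

/-- The translation `T_y f (t) = f (t - y)` of a tempered distribution,
`⟨T_y f, g⟩ = ⟨f, g (· + y)⟩`. -/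
def translate {d : ℕ} (y : RSpace d) (f : 𝓢'(RSpace d, ℂ)) : 𝓢'(RSpace d, ℂ) :=
  PointwiseConvergenceCLM.precomp ℂ (SchwartzMap.compSubConstCLM ℂ (-y)) f

/-- `v = u * f` for a tempered distribution `u` and a Schwartz function `f`: the distribution `v` is
the function `x ↦ ⟨u, f (x - ·)⟩`, the bracket being bilinear. -/
def IsConvolution {d : ℕ} (u : 𝓢'(RSpace d, ℂ)) (f : 𝓢(RSpace d, ℂ)) (v : 𝓢'(RSpace d, ℂ)) : Prop :=
  ∀ g : 𝓢(RSpace d, ℂ), v g = ∫ x, u (reflectShift f x) * g x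

/-- `M_c(M^p)`: the tempered distributions `u` for which convolution by `u` is (on Schwartz
functions, which are dense for `p < ∞`) a bounded operator on `M^p` commuting with
translations. -/
def convolutors (d : ℕ) (p : ℝ≥0∞) : Set 𝓢'(RSpace d, ℂ) :=
  {u | ∃ A : 𝓢'(RSpace d, ℂ) → 𝓢'(RSpace d, ℂ),
    IsBoundedOperatorOn (modulationSpace d p) (modulationNorm p) A ∧
    (∀ y : RSpace d, ∀ f ∈ modulationSpace d p, A (translate y f) = translate y (A f)) ∧
    ∀ f : 𝓢(RSpace d, ℂ), IsConvolution u f (A (f : 𝓢'(RSpace d, ℂ)))}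

/-! ### Bargmann transforms and polyanalytic Sobolev-Fock spaces -/

/-- `|z|² = ∑ |z_j|²`. -/
def sqNorm {d : ℕ} (z : CSpace d) : ℝ := ∑ j, ‖z j‖ ^ 2

/-- The Bargmann transform `B f (z) = 2^{d/4} ∫ f(x) exp (2π x·z - π x² - π z²/2) dx` of a tempered
distribution, where `z² = ∑ z_j²`. -/
def bargmann {d : ℕ} (f : 𝓢'(RSpace d, ℂ)) (z : CSpace d) : ℂ :=
  (((2 : ℝ) ^ ((d : ℝ) / 4) : ℝ) : ℂ) * Complex.exp (-(Real.pi / 2 : ℂ) * ∑ j, z j ^ 2) *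
    f (gaussExp Real.pi Real.pi_pos (fun j => 2 * Real.pi * z j))

/-- The Wirtinger derivative `∂/∂z_j = (∂/∂x_j - i ∂/∂y_j) / 2`. -/
def wirtinger {d : ℕ} (j : Fin d) (G : CSpace d → ℂ) (z : CSpace d) : ℂ :=
  (1 / 2 : ℂ) * (fderiv ℝ G z (Pi.single j 1) - Complex.I * fderiv ℝ G z (Pi.single j Complex.I))

/-- `∂^k/∂z^k` for a multi-index `k`. -/
def wirtingerPow {d : ℕ} (k : Fin d → ℕ) (G : CSpace d → ℂ) : CSpace d → ℂ :=
  (List.finRange d).foldr (fun j H => (wirtinger j)^[k j] H) G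

/-- The polyanalytic Bargmann transform
`B^k f (z) = (π^{|k|} k!)^{-1/2} exp (π |z|²) ∂^k/∂z^k (exp (-π |z|²) B f (z))`. -/
def polyBargmann {d : ℕ} (k : Fin d → ℕ) (f : 𝓢'(RSpace d, ℂ)) (z : CSpace d) : ℂ :=
  ((1 / Real.sqrt (∏ j, (Real.pi ^ k j * (k j).factorial)) : ℝ) : ℂ) *
    (Real.exp (Real.pi * sqNorm z) : ℂ) *
    wirtingerPow k (fun w => (Real.exp (-(Real.pi * sqNorm w)) : ℂ) * bargmann f w) z

/-- The polyanalytic Sobolev-Fock space `F^p_k(ℂ^d) = B^k(M^p(ℝ^d))`. -/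
def fockSpace {d : ℕ} (k : Fin d → ℕ) (p : ℝ≥0∞) : Set (CSpace d → ℂ) :=
  polyBargmann k '' modulationSpace d p

/-- The norm of `F^p_k`: the `L^p` norm of `F(z) exp (-π |z|²/2)`. -/
def fockNorm {d : ℕ} (p : ℝ≥0∞) (F : CSpace d → ℂ) : ℝ≥0∞ :=
  eLpNorm (fun z => F z * (Real.exp (-(Real.pi * sqNorm z / 2)) : ℂ)) p volume

/-- `f = (B^k)^* F`, in the sense that `⟨f, g⟩ = ∫ F(z) conj(B^k g (z)) exp (-π |z|²) dz` for all
Schwartz functions `g`; here the bracket is antilinear in the second argument. -/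
def IsPolyBargmannAdjoint {d : ℕ} (k : Fin d → ℕ) (F : CSpace d → ℂ) (f : 𝓢'(RSpace d, ℂ)) : Prop :=
  ∀ g : 𝓢(RSpace d, ℂ), f (conjSchwartz g) =
    ∫ z, F z * (starRingEnd ℂ) (polyBargmann k (g : 𝓢'(RSpace d, ℂ)) z) *
      (Real.exp (-(Real.pi * sqNorm z)) : ℂ)

open Classical in
/-- The adjoint `(B^k)^* F` as a tempered distribution (`0` if there is none). -/
def polyBargmannAdjoint {d : ℕ} (k : Fin d → ℕ) (F : CSpace d → ℂ) : 𝓢'(RSpace d, ℂ) :=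
  if h : ∃ f, IsPolyBargmannAdjoint k F f then h.choose else 0

theorem IsPolyBargmannAdjoint.unique {d : ℕ} {k : Fin d → ℕ} {F : CSpace d → ℂ}
    {f₁ f₂ : 𝓢'(RSpace d, ℂ)} (h₁ : IsPolyBargmannAdjoint k F f₁)
    (h₂ : IsPolyBargmannAdjoint k F f₂) : f₁ = f₂ := by
  ext g
  have hg : conjSchwartz (conjSchwartz g) = g := by
    ext t
    simp [conjSchwartz_apply]
  rw [← hg, h₁ (conjSchwartz g), h₂ (conjSchwartz g)]

theorem IsPolyBargmannAdjoint.eq_polyBargmannAdjoint {d : ℕ} {k : Fin d → ℕ} {F : CSpace d → ℂ}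
    {f : 𝓢'(RSpace d, ℂ)} (h : IsPolyBargmannAdjoint k F f) : polyBargmannAdjoint k F = f := by
  have hex : ∃ f, IsPolyBargmannAdjoint k F f := ⟨f, h⟩
  rw [polyBargmannAdjoint, dif_pos hex]
  exact hex.choose_spec.unique h

/-- The real shift `β_y F (z) = exp (π y·z - π |y|²/2) F (z - y)`, `y ∈ ℝ^d`. -/
def realShift {d : ℕ} (y : RSpace d) (F : CSpace d → ℂ) (z : CSpace d) : ℂ :=
  Complex.exp (Real.pi * ∑ j, (y j : ℂ) * z j - ((Real.pi * ‖y‖ ^ 2 / 2 : ℝ) : ℂ)) *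
    F (fun j => z j - (y j : ℂ))

/-- Translation invariant operators on `F^p_k`: those commuting with all real shifts. -/
def IsTranslationInvariant {d : ℕ} (k : Fin d → ℕ) (p : ℝ≥0∞)
    (S : (CSpace d → ℂ) → (CSpace d → ℂ)) : Prop :=
  ∀ y : RSpace d, ∀ F ∈ fockSpace k p, S (realShift y F) = realShift y (S F)

/-! ### The integral operators -/

/-- The Laguerre polynomial `L_n(x) = ∑_{j ≤ n} (-1)^j binom(n,j) x^j / j!`. -/
def laguerre (n : ℕ) (x : ℝ) : ℝ :=
  ∑ j ∈ Finset.range (n + 1), (-1 : ℝ) ^ j * (n.choose j : ℝ) / (j.factorial : ℝ) * x ^ j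

/-- `y ↦ ∏_j L_{k_j}(π |z_j - y_j|²)`. -/
def laguerreFactor {d : ℕ} (k : Fin d → ℕ) (z : CSpace d) (y : RSpace d) : ℂ :=
  ∏ j, ((laguerre (k j) (Real.pi * ‖z j - (y j : ℂ)‖ ^ 2) : ℝ) : ℂ)

/-- `y ↦ (y - conj z)^k`. -/
def monomialFactor {d : ℕ} (k : Fin d → ℕ) (z : CSpace d) (y : RSpace d) : ℂ :=
  ∏ j, ((y j : ℂ) - (starRingEnd ℂ) (z j)) ^ k j

theorem hasTemperateGrowth_finset_prod {d : ℕ} {ι : Type*} (s : Finset ι)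
    {f : ι → RSpace d → ℂ} (hf : ∀ i ∈ s, (f i).HasTemperateGrowth) :
    Function.HasTemperateGrowth (fun t => ∏ i ∈ s, f i t) := by
  classical
  induction s using Finset.induction_on with
  | empty => simp
  | insert a s has ih =>
    simp only [Finset.prod_insert has]
    exact (hf a (by simp)).mul (ih fun i hi => hf i (by simp [hi]))

theorem monomialFactor_hasTemperateGrowth {d : ℕ} (k : Fin d → ℕ) (z : CSpace d) :
    Function.HasTemperateGrowth (monomialFactor k z) :=
  hasTemperateGrowth_finset_prod _ fun j _ =>
    ((coord_hasTemperateGrowth j).sub (Function.HasTemperateGrowth.const _)).pow (k j)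

theorem laguerreFactor_hasTemperateGrowth {d : ℕ} (k : Fin d → ℕ) (z : CSpace d) :
    Function.HasTemperateGrowth (laguerreFactor k z) := by
  refine hasTemperateGrowth_finset_prod _ fun j _ => ?_
  have h1 : Function.HasTemperateGrowth
      (fun t : RSpace d => ((‖z j - (t j : ℂ)‖ ^ 2 : ℝ) : ℂ)) := by
    have h2 := ((Function.HasTemperateGrowth.const (E := RSpace d) (z j)).sub
      (coord_hasTemperateGrowth j)).mul ((Function.HasTemperateGrowth.const (E := RSpace d)
        ((starRingEnd ℂ) (z j))).sub (coord_hasTemperateGrowth j))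
    convert! h2 using 1
    funext t
    simp only [Pi.mul_apply, Pi.sub_apply]
    rw [Complex.ofReal_pow, ← Complex.mul_conj', map_sub, Complex.conj_ofReal]
  simp only [laguerre, Complex.ofReal_sum, Complex.ofReal_mul, Complex.ofReal_pow]
  refine Function.HasTemperateGrowth.sum fun i _ => ?_
  refine (Function.HasTemperateGrowth.const _).mul (Function.HasTemperateGrowth.pow ?_ i)
  simpa using! (Function.HasTemperateGrowth.const (E := RSpace d) (Real.pi : ℂ)).mul h1

/-- The Schwartz function `y ↦ exp (-π |y|²/2 + π y·w)`. -/
def heatFactor {d : ℕ} (w : CSpace d) : 𝓢(RSpace d, ℂ) :=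
  gaussExp (Real.pi / 2) (by positivity) (fun j => Real.pi * w j)

/-- `ψ(z,w) = ∫ ∏_j L_{k_j}(π |z_j - y_j|²) u(y) exp (-π |y|²/2 + π y·w) dy`. -/
def psiKernel {d : ℕ} (k : Fin d → ℕ) (u : 𝓢'(RSpace d, ℂ)) (z w : CSpace d) : ℂ :=
  u (SchwartzMap.smulLeftCLM ℂ (laguerreFactor k z) (heatFactor w))

/-- `φ(z,w) = (π^{|k|} / k!)^{1/2} ∫ (y - conj z)^k u(y) exp (-π |y|²/2 + π y·w) dy`. -/
def phiKernel {d : ℕ} (k : Fin d → ℕ) (u : 𝓢'(RSpace d, ℂ)) (z w : CSpace d) : ℂ :=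
  (Real.sqrt (∏ j, (Real.pi ^ k j / (k j).factorial)) : ℂ) *
    u (SchwartzMap.smulLeftCLM ℂ (monomialFactor k z) (heatFactor w))

theorem psiKernel_testFunction_apply {d : ℕ} (k : Fin d → ℕ) (z w : CSpace d) (y : RSpace d) :
    SchwartzMap.smulLeftCLM ℂ (laguerreFactor k z) (heatFactor w) y =
      (∏ j, ((laguerre (k j) (Real.pi * ‖z j - (y j : ℂ)‖ ^ 2) : ℝ) : ℂ)) *
        Complex.exp (-((Real.pi / 2 * ‖y‖ ^ 2 : ℝ) : ℂ) + ∑ j, (y j : ℂ) * (Real.pi * w j)) := by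
  rw [SchwartzMap.smulLeftCLM_apply_apply (laguerreFactor_hasTemperateGrowth k z), smul_eq_mul]
  rfl

theorem phiKernel_testFunction_apply {d : ℕ} (k : Fin d → ℕ) (z w : CSpace d) (y : RSpace d) :
    SchwartzMap.smulLeftCLM ℂ (monomialFactor k z) (heatFactor w) y =
      (∏ j, ((y j : ℂ) - (starRingEnd ℂ) (z j)) ^ k j) *
        Complex.exp (-((Real.pi / 2 * ‖y‖ ^ 2 : ℝ) : ℂ) + ∑ j, (y j : ℂ) * (Real.pi * w j)) := by
  rw [SchwartzMap.smulLeftCLM_apply_apply (monomialFactor_hasTemperateGrowth k z), smul_eq_mul]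
  rfl

/-- The integrand `w ↦ G(w) exp (π conj(w)·z) K(z - w, z - conj w) exp (-π |w|²)`. -/
def kernelIntegrand {d : ℕ} (K : CSpace d → CSpace d → ℂ) (G : CSpace d → ℂ) (z w : CSpace d) : ℂ :=
  G w * Complex.exp (Real.pi * ∑ j, (starRingEnd ℂ) (w j) * z j) *
    K (fun j => z j - w j) (fun j => z j - (starRingEnd ℂ) (w j)) *
    (Real.exp (-(Real.pi * sqNorm w)) : ℂ)

/-- The operator `G ↦ ∫ G(w) exp (π conj(w)·z) K(z - w, z - conj w) exp (-π |w|²) dw`. -/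
def kernelOperator {d : ℕ} (K : CSpace d → CSpace d → ℂ) (G : CSpace d → ℂ) (z : CSpace d) : ℂ :=
  ∫ w, kernelIntegrand K G z w

/-- `F̃ = B (B^k)^* F`. -/
def tildeTransform {d : ℕ} (k : Fin d → ℕ) (F : CSpace d → ℂ) : CSpace d → ℂ :=
  bargmann (polyBargmannAdjoint k F)

end PolyFock

end

/-! Everything is written in terms of the symmetric time-frequency shifts ρ(z), z = a + ib, and the
functions z ↦ f(ρ(z)h) for a Schwartz window h (bilinear pairing). Completing the square gives Bf(z)
= exp(π|z|²/2) f(ρ(z)φ₀). In exp(-π|z|²/2) f(ρ(z)g) the Gaussian factor cancels the conj(z_j) terms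
produced by ∂/∂z_j, so that ∂/∂z_j acts on g as the raising operator πx_j - ∂_j/2. Hence B^k f(z) =
exp(π|z|²/2) f(ρ(z)h_k) with h_k the normalised Hermite function (`polyBargmann_eq`): up to a
weight, B^k is a short-time Fourier transform with another window.

For a window of norm one, f = ∫ f(ρ(w)h) conj(ρ(w)h) dw (`distribution_eq_integral`). For h = h_k
this says that (B^k)^* inverts B^k. Matrix coefficients of Schwartz functions decay rapidly, so
Young's inequality makes all such windows equivalent for M^p, and B^k is an isomorphism of M^p onto
F^p_k. It carries translations to the shifts β_y (`realShift_polyBargmann`). The theorem thereby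
becomes one about a translation invariant operator A on M^p.

If Af = u * f on Schwartz functions, apply A under the integral in the inversion formula and pair
with ρ(z)h_k. The number obtained from conj(ρ(w)h) is u applied to t ↦ ∫ ρ(z)h_k(x) conj(ρ(w)h(x -
t)) dx, which up to a phase is the matrix coefficient ⟨h_k, ρ(w + t - z)h⟩. One-dimensional Gaussian
integrals of Hermite polynomials evaluate it: Laguerre polynomials times a Gaussian for h = h_k, and
a conjugate monomial times a Gaussian for h = φ₀. The first window yields ψ acting on F, the second
φ acting on F̃ (`psiKernel_eq`, `phiKernel_eq`). The exchange of A with the integral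
(`operator_apply_eq_integral`) uses f in M¹ for dominated convergence and p < ∞ for the density of
Schwartz functions; the density also gives uniqueness of the extension.

Conversely, a bounded translation invariant A on M^p is a convolution operator
(`exists_isConvolution`). Since φ₀ is a convolution of two Gaussians, each A(ρ(z)φ₀) is a continuous
function of polynomial growth. Expanding the reflection of g in the ρ(z)φ₀ and evaluating its image
under A at the origin defines u(g).

The analytic tool behind all exchanges is `exists_schwartz_integral`: a continuous family of
Schwartz functions with integrable seminorms has a Schwartz integral, and every tempered
distribution passes under it. -/

noncomputable section

namespace PolyFock


/-! ### Norms on the Schwartz space -/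

section SchwartzNorm

variable {E : Type*} [NormedAddCommGroup E] [NormedSpace ℝ E]

/-- The maximum of the Schwartz seminorms with both indices at most `N`. -/
def schwartzNorm (N : ℕ) : Seminorm ℝ 𝓢(E, ℂ) :=
  (Finset.Iic (N, N)).sup (schwartzSeminormFamily ℝ E ℂ)

theorem seminorm_le_schwartzNorm {N l n : ℕ} (hl : l ≤ N) (hn : n ≤ N) (g : 𝓢(E, ℂ)) :
    SchwartzMap.seminorm ℝ l n g ≤ schwartzNorm N g := by
  have : SchwartzMap.seminorm ℝ l n ≤ schwartzNorm (E := E) N :=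
    Finset.le_sup (f := schwartzSeminormFamily ℝ E ℂ) (b := (l, n)) (by simp [hl, hn])
  exact this g

theorem one_add_pow_mul_le_schwartzNorm {N l n : ℕ} (hl : l ≤ N) (hn : n ≤ N) (g : 𝓢(E, ℂ))
    (t : E) : (1 + ‖t‖) ^ l * ‖iteratedFDeriv ℝ n g t‖ ≤ 2 ^ N * schwartzNorm N g :=
  SchwartzMap.one_add_le_sup_seminorm_apply (𝕜 := ℝ) (m := (N, N)) hl hn g t

theorem one_add_pow_mul_norm_le_schwartzNorm (N : ℕ) (g : 𝓢(E, ℂ)) (t : E) :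
    (1 + ‖t‖) ^ N * ‖g t‖ ≤ 2 ^ N * schwartzNorm N g := by
  simpa using one_add_pow_mul_le_schwartzNorm (n := 0) le_rfl (Nat.zero_le N) g t

theorem schwartzNorm_le {N : ℕ} {g : 𝓢(E, ℂ)} {M : ℝ} (hM : 0 ≤ M)
    (h : ∀ l ≤ N, ∀ n ≤ N, ∀ t, ‖t‖ ^ l * ‖iteratedFDeriv ℝ n g t‖ ≤ M) :
    schwartzNorm N g ≤ M := by
  refine Seminorm.finset_sup_apply_le hM fun i hi => ?_
  rw [Finset.mem_Iic, Prod.le_def] at hi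
  exact SchwartzMap.seminorm_le_bound ℝ _ _ g hM (h _ hi.1 _ hi.2)

theorem schwartzNorm_mono {N N' : ℕ} (h : N ≤ N') (g : 𝓢(E, ℂ)) :
    schwartzNorm N g ≤ schwartzNorm N' g := by
  refine Seminorm.finset_sup_apply_le (apply_nonneg _ _) fun i hi => ?_
  rw [Finset.mem_Iic, Prod.le_def] at hi
  exact seminorm_le_schwartzNorm (hi.1.trans h) (hi.2.trans h) g

theorem continuous_schwartzNorm (N : ℕ) : Continuous (schwartzNorm (E := E) N) := by
  have h := schwartz_withSeminorms ℝ E ℂ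
  refine Finset.sup_induction (p := fun q : Seminorm ℝ 𝓢(E, ℂ) => Continuous q) continuous_const
    (fun p hp q hq => ?_) fun i _ => h.continuous_seminorm i
  rw [Seminorm.coe_sup]
  exact hp.sup hq

/-- Continuity bounds `q` by finitely many Schwartz seminorms, and the largest index occurring
absorbs them all. Bounds by a single indexed norm compose easily along chains of continuous maps. -/
theorem exists_le_schwartzNorm {q : Seminorm ℝ 𝓢(E, ℂ)} (hq : Continuous q) :
    ∃ (N : ℕ) (C : ℝ), 0 ≤ C ∧ ∀ g, q g ≤ C * schwartzNorm N g := by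
  obtain ⟨s, C, -, h⟩ := Seminorm.bound_of_continuous (schwartz_withSeminorms ℝ E ℂ) q hq
  refine ⟨s.sup fun i => max i.1 i.2, C, C.2, fun g => (h g).trans ?_⟩
  change (C : ℝ) * _ ≤ _
  gcongr
  refine Seminorm.finset_sup_apply_le (apply_nonneg _ _) fun i hi => ?_
  have := Finset.le_sup (f := fun i : ℕ × ℕ => max i.1 i.2) hi
  exact seminorm_le_schwartzNorm ((le_max_left _ _).trans this) ((le_max_right _ _).trans this) g

/-- A tempered distribution as a continuous linear functional for the real structure. -/
theorem exists_distribution_le_schwartzNorm (f : 𝓢'(E, ℂ)) :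
    ∃ (N : ℕ) (C : ℝ), 0 ≤ C ∧ ∀ g, ‖f g‖ ≤ C * schwartzNorm N g :=
  exists_le_schwartzNorm
    (q := (normSeminorm ℝ ℂ).comp ((f : 𝓢(E, ℂ) →ₗ[ℂ] ℂ).restrictScalars ℝ)) (by
    change Continuous fun g => ‖f g‖
    exact (map_continuous f).norm)

theorem exists_schwartzNorm_map_le {E' : Type*} [NormedAddCommGroup E'] [NormedSpace ℝ E']
    (T : 𝓢(E, ℂ) →L[ℝ] 𝓢(E', ℂ)) (N : ℕ) :
    ∃ (N' : ℕ) (C : ℝ), 0 ≤ C ∧ ∀ g, schwartzNorm N (T g) ≤ C * schwartzNorm N' g :=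
  exists_le_schwartzNorm (q := (schwartzNorm N).comp T.toLinearMap)
    ((continuous_schwartzNorm N).comp T.continuous)

theorem continuous_of_schwartzNorm {X : Type*} [TopologicalSpace X] {g : X → 𝓢(E, ℂ)}
    (h : ∀ N x₀, Filter.Tendsto (fun x => schwartzNorm N (g x - g x₀)) (nhds x₀) (nhds 0)) :
    Continuous g := by
  rw [continuous_iff_continuousAt]
  intro x₀
  refine ((schwartz_withSeminorms ℝ E ℂ).tendsto_nhds g (g x₀)).mpr fun i ε hε => ?_
  have := (h (max i.1 i.2) x₀).eventually (gt_mem_nhds hε)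
  filter_upwards [this] with x hx
  exact (seminorm_le_schwartzNorm (le_max_left _ _) (le_max_right _ _) _).trans_lt hx

/-- A linear functional bounded by a Schwartz norm, as a tempered distribution. -/
theorem exists_distribution {L : 𝓢(E, ℂ) → ℂ} (hadd : ∀ f g, L (f + g) = L f + L g)
    (hsmul : ∀ (c : ℂ) f, L (c • f) = c * L f) {N : ℕ} {C : ℝ} (hC : 0 ≤ C)
    (hb : ∀ f, ‖L f‖ ≤ C * schwartzNorm N f) : ∃ u : 𝓢'(E, ℂ), ∀ f, u f = L f := by
  let u : 𝓢(E, ℂ) →L[ℂ] ℂ := SchwartzMap.mkCLMtoNormedSpace (𝕜 := ℂ) (𝕜' := ℂ) (σ := RingHom.id ℂ)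
    L hadd (fun c f => by simpa using hsmul c f)
    ⟨Finset.Iic (N, N), C, hC, fun f => (hb f).trans (by
      gcongr
      refine Seminorm.finset_sup_apply_le (apply_nonneg _ _) fun i hi => ?_
      have := Finset.le_sup (f := schwartzSeminormFamily ℂ E ℂ) hi
      exact this f)⟩
  exact ⟨ContinuousLinearMap.toPointwiseConvergenceCLM ℂ (RingHom.id ℂ) 𝓢(E, ℂ) ℂ u,
    fun f => rfl⟩

end SchwartzNorm

/-! ### Integrals with values in the Schwartz space -/

section SchwartzIntegral

variable {E : Type*} [NormedAddCommGroup E] [NormedSpace ℝ E]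

variable (E) in
/-- Bounded continuous functions with values in the `n`-linear forms. -/
def BddForms (n : ℕ) : Type _ := BoundedContinuousFunction E (E [×n]→L[ℝ] ℂ)

instance (n : ℕ) : NormedAddCommGroup (BddForms E n) :=
  inferInstanceAs (NormedAddCommGroup (BoundedContinuousFunction E (E [×n]→L[ℝ] ℂ)))

instance (n : ℕ) : NormedSpace ℂ (BddForms E n) :=
  inferInstanceAs (NormedSpace ℂ (BoundedContinuousFunction E (E [×n]→L[ℝ] ℂ)))

instance (n : ℕ) : CompleteSpace (BddForms E n) :=
  inferInstanceAs (CompleteSpace (BoundedContinuousFunction E (E [×n]→L[ℝ] ℂ)))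

/-- Evaluation at a point. -/
def BddForms.eval (n : ℕ) (t : E) : BddForms E n →L[ℂ] (E [×n]→L[ℝ] ℂ) :=
  BoundedContinuousFunction.evalCLM ℂ t

theorem BddForms.ext {n : ℕ} {f g : BddForms E n} (h : ∀ t, eval n t f = eval n t g) : f = g :=
  BoundedContinuousFunction.ext h

/-- The function `t ↦ ‖t‖^l • D^n g(t)`. -/
def weightedDerivFun (l n : ℕ) (g : 𝓢(E, ℂ)) : BddForms E n :=
  BoundedContinuousFunction.ofNormedAddCommGroup
    (fun t => ‖t‖ ^ l • iteratedFDeriv ℝ n g t)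
    ((continuous_norm.pow l).smul ((g.smooth ⊤).continuous_iteratedFDeriv (by exact_mod_cast le_top)))
    (SchwartzMap.seminorm ℝ l n g)
    fun t => by
      rw [norm_smul, norm_pow, norm_norm]
      exact SchwartzMap.le_seminorm ℝ l n g t

theorem eval_weightedDerivFun (l n : ℕ) (g : 𝓢(E, ℂ)) (t : E) :
    BddForms.eval n t (weightedDerivFun l n g) = ‖t‖ ^ l • iteratedFDeriv ℝ n g t := rfl

theorem norm_weightedDerivFun_le (l n : ℕ) (g : 𝓢(E, ℂ)) :
    ‖weightedDerivFun l n g‖ ≤ SchwartzMap.seminorm ℝ l n g :=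
  BoundedContinuousFunction.norm_ofNormedAddCommGroup_le _ (apply_nonneg _ _) _

/-- The map `g ↦ (t ↦ ‖t‖^l • D^n g(t))` into bounded continuous functions. -/
def weightedDeriv (l n : ℕ) : 𝓢(E, ℂ) →L[ℂ] BddForms E n :=
  SchwartzMap.mkCLMtoNormedSpace (𝕜 := ℂ) (𝕜' := ℂ) (σ := RingHom.id ℂ) (weightedDerivFun l n)
    (fun f g => BddForms.ext fun t => by
      have := iteratedFDeriv_add_apply (i := n) (x := t) (𝕜 := ℝ) (f := f) (g := g)
        ((f.smooth n).contDiffAt) ((g.smooth n).contDiffAt)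
      rw [map_add, eval_weightedDerivFun, eval_weightedDerivFun, eval_weightedDerivFun]
      change ‖t‖ ^ l • iteratedFDeriv ℝ n (⇑f + ⇑g) t = _
      rw [this, smul_add])
    (fun c f => BddForms.ext fun t => by
      have := iteratedFDeriv_const_smul_apply (𝕜 := ℝ) (a := c) (i := n) (x := t) (f := f)
        ((f.smooth n).contDiffAt)
      rw [RingHom.id_apply, map_smul, eval_weightedDerivFun, eval_weightedDerivFun, smul_comm,
        ← this]
      rfl)
    ⟨{(l, n)}, 1, zero_le_one, fun g => by
      rw [one_mul, Finset.sup_singleton]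
      exact norm_weightedDerivFun_le l n g⟩

theorem eval_weightedDeriv (l n : ℕ) (g : 𝓢(E, ℂ)) (t : E) :
    BddForms.eval n t (weightedDeriv l n g) = ‖t‖ ^ l • iteratedFDeriv ℝ n g t := rfl

theorem norm_weightedDeriv_le (l n : ℕ) (g : 𝓢(E, ℂ)) :
    ‖weightedDeriv l n g‖ ≤ SchwartzMap.seminorm ℝ l n g := norm_weightedDerivFun_le l n g

/-- All weighted derivatives up to order `N`. -/
def weightedDerivs (N : ℕ) :
    𝓢(E, ℂ) →L[ℂ] ((i : Fin (N + 1) × Fin (N + 1)) → BddForms E i.2) :=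
  ContinuousLinearMap.pi fun i => weightedDeriv i.1 i.2

/-- This lower bound lets a functional controlled by `schwartzNorm N` factor through the image of
`weightedDerivs N` in a Banach space. -/
theorem schwartzNorm_le_norm_weightedDerivs (N : ℕ) (g : 𝓢(E, ℂ)) :
    schwartzNorm N g ≤ ‖weightedDerivs N g‖ := by
  refine schwartzNorm_le (norm_nonneg _) fun l hl n hn t => ?_
  have h1 := norm_le_pi_norm (weightedDerivs N g) (⟨l, by omega⟩, ⟨n, by omega⟩)
  refine le_trans ?_ h1
  have h2 := BoundedContinuousFunction.norm_coe_le_norm (weightedDeriv l n g) t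
  have h3 : ‖BddForms.eval n t (weightedDeriv l n g)‖ ≤ ‖weightedDeriv l n g‖ := h2
  rwa [eval_weightedDeriv, norm_smul, norm_pow, norm_norm] at h3

/-- A tempered distribution factors through finitely many weighted derivatives. -/
theorem exists_dual_weightedDerivs (f : 𝓢'(E, ℂ)) : ∃ (N : ℕ) (φ : StrongDual ℂ
    ((i : Fin (N + 1) × Fin (N + 1)) → BddForms E i.2)),
    ∀ g, f g = φ (weightedDerivs N g) := by
  obtain ⟨N, C, hC, hf⟩ := exists_distribution_le_schwartzNorm f
  let J : 𝓢(E, ℂ) →ₗ[ℂ] ((i : Fin (N + 1) × Fin (N + 1)) → BddForms E i.2) := (weightedDerivs N).toLinearMap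
  have hb : ∀ g, ‖f g‖ ≤ C * ‖J g‖ := fun g => (hf g).trans (by
    gcongr
    exact schwartzNorm_le_norm_weightedDerivs N g)
  let f₀ : 𝓢(E, ℂ) →ₗ[ℂ] ℂ := f
  -- The bound `hb` makes `f` vanish where `J` does, so `f` descends to the range of `J`;
  -- Hahn–Banach then extends it to the whole Banach space.
  have hker : LinearMap.ker J ≤ LinearMap.ker f₀ := by
    intro g hg
    rw [LinearMap.mem_ker] at hg ⊢
    have := hb g
    rw [hg, norm_zero, mul_zero] at this
    exact norm_le_zero_iff.mp this
  let f₁ : LinearMap.range J →ₗ[ℂ] ℂ :=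
    ((LinearMap.ker J).liftQ f₀ hker).comp (J.quotKerEquivRange.symm : _ →ₗ[ℂ] _)
  have hf₁ : ∀ g, f₁ ⟨J g, LinearMap.mem_range_self J g⟩ = f g := by
    intro g
    have : J.quotKerEquivRange.symm ⟨J g, LinearMap.mem_range_self J g⟩ =
        (LinearMap.ker J).mkQ g := by
      rw [LinearEquiv.symm_apply_eq]
      rfl
    change (LinearMap.ker J).liftQ f₀ hker (J.quotKerEquivRange.symm _) = _
    rw [this]
    rfl
  obtain ⟨φ, hφ, -⟩ := exists_extension_norm_eq (LinearMap.range J)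
    (f₁.mkContinuous C (by
      rintro ⟨_, g, rfl⟩
      rw [hf₁]
      exact hb g))
  exact ⟨N, φ, fun g => (hf₁ g).symm.trans (hφ ⟨J g, _⟩).symm⟩

variable {X : Type*} [TopologicalSpace X] [SecondCountableTopology X] [MeasurableSpace X]
  [OpensMeasurableSpace X] {μ : Measure X}

/-- The integral of a weighted continuous family of Schwartz functions, all of whose seminorms are
integrable, is a Schwartz function, and tempered distributions commute with it. -/
theorem exists_schwartz_integral {c : X → ℂ} (hc : AEStronglyMeasurable c μ) {g : X → 𝓢(E, ℂ)}
    (hg : Continuous g) (hint : ∀ N, Integrable (fun x => ‖c x‖ * schwartzNorm N (g x)) μ) :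
    ∃ G : 𝓢(E, ℂ), (∀ t, G t = ∫ x, c x * g x t ∂μ) ∧
      ∀ f : 𝓢'(E, ℂ), Integrable (fun x => c x * f (g x)) μ ∧ f G = ∫ x, c x * f (g x) ∂μ := by
  have hmeas : ∀ n t, AEStronglyMeasurable (fun x => c x • iteratedFDeriv ℝ n (g x) t) μ := by
    intro n t
    have h1 : Continuous fun x => BddForms.eval n t (weightedDeriv 0 n (g x)) :=
      ((BddForms.eval n t).continuous.comp (weightedDeriv 0 n).continuous).comp hg
    simp only [eval_weightedDeriv, pow_zero, one_smul] at h1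
    exact hc.smul h1.aestronglyMeasurable
  have hbd : ∀ l n x t, ‖t‖ ^ l * ‖c x • iteratedFDeriv ℝ n (g x) t‖ ≤
      ‖c x‖ * schwartzNorm (max l n) (g x) := by
    intro l n x t
    rw [norm_smul, mul_left_comm]
    gcongr
    exact (SchwartzMap.le_seminorm ℝ l n (g x) t).trans
      (seminorm_le_schwartzNorm (le_max_left _ _) (le_max_right _ _) _)
  have hbd0 : ∀ n x t, ‖c x • iteratedFDeriv ℝ n (g x) t‖ ≤ ‖c x‖ * schwartzNorm n (g x) := by
    intro n x t
    simpa using hbd 0 n x t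
  have hI : ∀ n t, Integrable (fun x => c x • iteratedFDeriv ℝ n (g x) t) μ := fun n t =>
    (hint n).mono' (hmeas n t) (Filter.Eventually.of_forall fun x => hbd0 n x t)
  let D : (n : ℕ) → E → E [×n]→L[ℝ] ℂ := fun n t => ∫ x, c x • iteratedFDeriv ℝ n (g x) t ∂μ
  let cur : (n : ℕ) → (E [×(n + 1)]→L[ℝ] ℂ) ≃ₗᵢ[ℝ] (E →L[ℝ] (E [×n]→L[ℝ] ℂ)) := fun n =>
    continuousMultilinearCurryLeftEquiv ℝ (fun _ : Fin (n + 1) => E) ℂ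
  -- Differentiation under the integral sign: `D n` integrates the derivatives of order `n`, and the
  -- seminorm of order `n + 1` dominates uniformly in `t`.
  have hD : ∀ n t, HasFDerivAt (D n) (cur n (D (n + 1) t)) t := by
    intro n t
    have e1 : cur n (D (n + 1) t) = ∫ x, c x • fderiv ℝ (iteratedFDeriv ℝ n (g x)) t ∂μ := by
      have h2 := ContinuousLinearEquiv.integral_comp_comm (𝕜 := ℝ)
        (E := E [×(n + 1)]→L[ℝ] ℂ) (F := E →L[ℝ] (E [×n]→L[ℝ] ℂ)) (cur n).toContinuousLinearEquiv
        (fun x => c x • iteratedFDeriv ℝ (n + 1) (g x) t) (μ := μ)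
      refine h2.symm.trans (integral_congr_ae (Filter.Eventually.of_forall fun x => ?_))
      have h3 : cur n (iteratedFDeriv ℝ (n + 1) (g x) t) =
          fderiv ℝ (iteratedFDeriv ℝ n (g x)) t := by
        rw [iteratedFDeriv_succ_eq_comp_left]
        exact (cur n).apply_symm_apply _
      change cur n (c x • iteratedFDeriv ℝ (n + 1) (g x) t) =
        c x • fderiv ℝ (iteratedFDeriv ℝ n (g x)) t
      rw [← h3]
      ext v w
      rfl
    rw [e1]
    have hmeas' : AEStronglyMeasurable
        (fun x => c x • fderiv ℝ (iteratedFDeriv ℝ n (g x)) t) μ := by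
      refine ((cur n).continuous.comp_aestronglyMeasurable (hmeas (n + 1) t)).congr
        (Filter.Eventually.of_forall fun x => ?_)
      change cur n (c x • iteratedFDeriv ℝ (n + 1) (g x) t) = _
      rw [iteratedFDeriv_succ_eq_comp_left]
      ext v w
      rfl
    refine hasFDerivAt_integral_of_dominated_of_fderiv_le
      (F' := fun t x => c x • fderiv ℝ (iteratedFDeriv ℝ n (g x)) t) (s := Set.univ)
      (bound := fun x => ‖c x‖ * schwartzNorm (n + 1) (g x)) Filter.univ_mem
      (Filter.Eventually.of_forall fun s => hmeas n s) (hI n t) hmeas'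
      (Filter.Eventually.of_forall fun x s _ => ?_) (hint (n + 1))
      (Filter.Eventually.of_forall fun x s _ => ?_)
    · rw [norm_smul, norm_fderiv_iteratedFDeriv, ← norm_smul]
      exact hbd0 (n + 1) x s
    · have : DifferentiableAt ℝ (iteratedFDeriv ℝ n (g x)) s :=
        (((g x).smooth (n + 1)).differentiable_iteratedFDeriv (by exact_mod_cast Nat.lt_succ_self n)) s
      exact this.hasFDerivAt.const_smul (c x)
  let G₀ : E → ℂ := fun t => ∫ x, c x * g x t ∂μ
  have hG : ∀ n, iteratedFDeriv ℝ n G₀ = D n := by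
    intro n
    induction n with
    | zero =>
      funext t
      rw [iteratedFDeriv_zero_eq_comp]
      change (continuousMultilinearCurryFin0 ℝ E ℂ).symm (∫ x, c x * g x t ∂μ) = _
      have h0 : Integrable (fun x => c x * g x t) μ := by
        refine ((continuousMultilinearCurryFin0 ℝ E ℂ).toContinuousLinearEquiv.integrable_comp_iff.mpr
          (hI 0 t)).congr (Filter.Eventually.of_forall fun x => ?_)
        rfl
      exact ((continuousMultilinearCurryFin0 ℝ E ℂ).symm.toContinuousLinearEquiv.integral_comp_comm
        (fun x => c x * g x t) (μ := μ)).symm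
    | succ n ih =>
      funext t
      rw [iteratedFDeriv_succ_eq_comp_left, ih]
      change (cur n).symm (fderiv ℝ (D n) t) = _
      rw [(hD n t).fderiv]
      exact (cur n).symm_apply_apply _
  have hsmooth : ContDiff ℝ (⊤ : ℕ∞) G₀ := by
    refine contDiff_of_differentiable_iteratedFDeriv fun n _ => ?_
    rw [hG n]
    exact fun t => (hD n t).differentiableAt
  let G : 𝓢(E, ℂ) :=
    { toFun := G₀
      smooth' := hsmooth
      decay' := fun l n => ⟨∫ x, ‖c x‖ * schwartzNorm (max l n) (g x) ∂μ, fun t => by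
        rw [hG n]
        calc ‖t‖ ^ l * ‖D n t‖ ≤ ‖t‖ ^ l * ∫ x, ‖c x • iteratedFDeriv ℝ n (g x) t‖ ∂μ := by
              gcongr
              exact norm_integral_le_integral_norm _
          _ = ∫ x, ‖t‖ ^ l * ‖c x • iteratedFDeriv ℝ n (g x) t‖ ∂μ := by
              rw [integral_const_mul]
          _ ≤ _ := integral_mono ((hI n t).norm.const_mul _) (hint _) fun x => hbd l n x t⟩ }
  refine ⟨G, fun t => rfl, fun f => ?_⟩
  -- For a fixed `f` the integral becomes a Bochner integral in the Banach space of weighted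
  -- derivatives, where `φ` commutes with it. Evaluation at points then identifies this integral
  -- with the image of `G`.
  obtain ⟨N, φ, hφ⟩ := exists_dual_weightedDerivs f
  have hJ : Integrable (fun x => c x • weightedDerivs N (g x)) μ := by
    refine (hint N).mono' (hc.smul ((weightedDerivs N).continuous.comp hg).aestronglyMeasurable)
      (Filter.Eventually.of_forall fun x => ?_)
    rw [norm_smul]
    gcongr
    refine (pi_norm_le_iff_of_nonneg (apply_nonneg _ _)).mpr fun i => ?_
    exact (norm_weightedDeriv_le _ _ _).trans
      (seminorm_le_schwartzNorm (Nat.lt_succ_iff.mp i.1.2) (Nat.lt_succ_iff.mp i.2.2) _)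
  have hφ' : ∀ x, c x * f (g x) = φ (c x • weightedDerivs N (g x)) := by
    intro x
    rw [map_smul, ← hφ, smul_eq_mul]
  simp only [hφ']
  refine ⟨φ.integrable_comp hJ, ?_⟩
  rw [φ.integral_comp_comm hJ, hφ]
  congr 1
  funext i
  refine BddForms.ext fun t => ?_
  let ev := (BddForms.eval (E := E) i.2 t).comp
    (ContinuousLinearMap.proj (R := ℂ) (φ := fun i : Fin (N + 1) × Fin (N + 1) => BddForms E i.2) i)
  have h5 := ev.integral_comp_comm hJ
  refine Eq.trans ?_ h5
  have h6 : ∀ x, ev (c x • weightedDerivs N (g x)) =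
      ‖t‖ ^ (i.1 : ℕ) • (c x • iteratedFDeriv ℝ i.2 (g x) t) := by
    intro x
    change c x • ‖t‖ ^ (i.1 : ℕ) • iteratedFDeriv ℝ i.2 (g x) t = _
    rw [smul_comm]
  simp only [h6]
  rw [integral_smul]
  change ‖t‖ ^ (i.1 : ℕ) • iteratedFDeriv ℝ i.2 G₀ t = _
  rw [hG]

end SchwartzIntegral


/-! ### Translations and modulations of Schwartz functions -/

section Translation

variable {E : Type*} [NormedAddCommGroup E] [NormedSpace ℝ E]

theorem iteratedFDeriv_compSubConst (g : 𝓢(E, ℂ)) (a : E) (n : ℕ) (t : E) :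
    iteratedFDeriv ℝ n (g.compSubConstCLM ℂ a) t = iteratedFDeriv ℝ n g (t - a) :=
  iteratedFDeriv_comp_sub (𝕜 := ℝ) (f := g) n a t

/-- The weight at `t` is at most the weight at `t - a` times a power of `1 + ‖a‖`, whence polynomial
growth in `a`. -/
theorem schwartzNorm_compSubConst_le (N : ℕ) (g : 𝓢(E, ℂ)) (a : E) :
    schwartzNorm N (g.compSubConstCLM ℂ a) ≤ 2 ^ N * (1 + ‖a‖) ^ N * schwartzNorm N g := by
  refine schwartzNorm_le (mul_nonneg (by positivity) (apply_nonneg _ _)) fun l hl n hn t => ?_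
  rw [iteratedFDeriv_compSubConst]
  have h1 : ‖t‖ ≤ (1 + ‖t - a‖) * (1 + ‖a‖) := by
    have : ‖t‖ ≤ ‖t - a‖ + ‖a‖ := by simpa using norm_add_le (t - a) a
    nlinarith [norm_nonneg (t - a), norm_nonneg a]
  calc ‖t‖ ^ l * ‖iteratedFDeriv ℝ n g (t - a)‖
      ≤ ((1 + ‖t - a‖) * (1 + ‖a‖)) ^ l * ‖iteratedFDeriv ℝ n g (t - a)‖ := by gcongr
    _ = (1 + ‖a‖) ^ l * ((1 + ‖t - a‖) ^ l * ‖iteratedFDeriv ℝ n g (t - a)‖) := by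
        rw [mul_pow]; ring
    _ ≤ (1 + ‖a‖) ^ N * (2 ^ N * schwartzNorm N g) := by
        have := one_add_pow_mul_le_schwartzNorm hl hn g (t - a)
        gcongr
        simp
    _ = _ := by ring

/-- Mean value inequality on the segment from `t` to `t - a`, at the cost of one more derivative.
Since `‖a‖ ≤ 1`, the weights along the segment are comparable within a factor 2; this and the
passage to `schwartzNorm` contribute `2 ^ (N + 1)` each. -/
theorem schwartzNorm_compSubConst_sub_le (N : ℕ) (g : 𝓢(E, ℂ)) {a : E} (ha : ‖a‖ ≤ 1) :
    schwartzNorm N (g.compSubConstCLM ℂ a - g) ≤ ‖a‖ * (4 ^ (N + 1) * schwartzNorm (N + 1) g) := by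
  have hp : 0 ≤ 4 ^ (N + 1) * schwartzNorm (N + 1) g := mul_nonneg (by positivity) (apply_nonneg _ _)
  refine schwartzNorm_le (mul_nonneg (norm_nonneg a) hp) fun l hl n hn t => ?_
  have h1 : iteratedFDeriv ℝ n (g.compSubConstCLM ℂ a - g : 𝓢(E, ℂ)) t =
      iteratedFDeriv ℝ n g (t - a) - iteratedFDeriv ℝ n g t := by
    have := iteratedFDeriv_sub_apply (i := n) (x := t) (𝕜 := ℝ) (f := g.compSubConstCLM ℂ a) (g := g)
      (((g.compSubConstCLM ℂ a).smooth n).contDiffAt) ((g.smooth n).contDiffAt)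
    rw [← iteratedFDeriv_compSubConst]
    exact this
  rw [h1]
  have hseg : ∀ y ∈ segment ℝ t (t - a), ‖fderiv ℝ (iteratedFDeriv ℝ n g) y‖ * (1 + ‖t‖) ^ l ≤
      4 ^ (N + 1) * schwartzNorm (N + 1) g := by
    intro y hy
    have hty : ‖t - y‖ ≤ 1 := by
      obtain ⟨θ, hθ, rfl⟩ := (segment_eq_image' ℝ t (t - a)).subset hy
      have : t - (t + θ • (t - a - t)) = θ • a := by
        rw [show t - a - t = -a by abel, smul_neg]; abel
      rw [this, norm_smul, Real.norm_of_nonneg hθ.1]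
      nlinarith [hθ.1, hθ.2, norm_nonneg a]
    have h2 : 1 + ‖t‖ ≤ 2 * (1 + ‖y‖) := by
      have : ‖t‖ ≤ ‖t - y‖ + ‖y‖ := by simpa using norm_add_le (t - y) y
      linarith [norm_nonneg y]
    rw [norm_fderiv_iteratedFDeriv]
    calc ‖iteratedFDeriv ℝ (n + 1) g y‖ * (1 + ‖t‖) ^ l
        ≤ ‖iteratedFDeriv ℝ (n + 1) g y‖ * (2 * (1 + ‖y‖)) ^ l := by gcongr
      _ = 2 ^ l * ((1 + ‖y‖) ^ l * ‖iteratedFDeriv ℝ (n + 1) g y‖) := by rw [mul_pow]; ring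
      _ ≤ 2 ^ (N + 1) * (2 ^ (N + 1) * schwartzNorm (N + 1) g) := by
          have := one_add_pow_mul_le_schwartzNorm (show l ≤ N + 1 by omega)
            (show n + 1 ≤ N + 1 by omega) g y
          gcongr
          · norm_num
          · omega
      _ = _ := by rw [← mul_assoc, ← mul_pow]; norm_num
  have h2 : ‖iteratedFDeriv ℝ n g (t - a) - iteratedFDeriv ℝ n g t‖ ≤
      (4 ^ (N + 1) * schwartzNorm (N + 1) g / (1 + ‖t‖) ^ l) * ‖t - a - t‖ := by
    refine (convex_segment t (t - a)).norm_image_sub_le_of_norm_fderiv_le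
      (f := iteratedFDeriv ℝ n g) (𝕜 := ℝ)
      (fun y hy => ((g.smooth (n + 1)).differentiable_iteratedFDeriv
        (by exact_mod_cast Nat.lt_succ_self n)) y)
      (fun y hy => ?_) (left_mem_segment ℝ _ _) (right_mem_segment ℝ _ _)
    rw [le_div_iff₀ (by positivity)]
    exact hseg y hy
  rw [show t - a - t = -a by abel, norm_neg] at h2
  calc ‖t‖ ^ l * ‖iteratedFDeriv ℝ n g (t - a) - iteratedFDeriv ℝ n g t‖
      ≤ (1 + ‖t‖) ^ l * ((4 ^ (N + 1) * schwartzNorm (N + 1) g / (1 + ‖t‖) ^ l) * ‖a‖) := by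
        gcongr
        simp
    _ = _ := by field_simp

theorem continuous_compSubConst (g : 𝓢(E, ℂ)) :
    Continuous fun a : E => g.compSubConstCLM ℂ a := by
  refine continuous_of_schwartzNorm fun N a₀ => ?_
  have h1 : ∀ a, g.compSubConstCLM ℂ a - g.compSubConstCLM ℂ a₀ =
      (g.compSubConstCLM ℂ (a - a₀) - g).compSubConstCLM ℂ a₀ := by
    intro a
    rw [map_sub, SchwartzMap.compSubConstCLM_comp, sub_add_cancel]
  have hlim : Filter.Tendsto (fun a => 2 ^ N * (1 + ‖a₀‖) ^ N *
      (‖a - a₀‖ * (4 ^ (N + 1) * schwartzNorm (N + 1) g))) (nhds a₀) (nhds 0) := by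
    have : Continuous fun a : E => 2 ^ N * (1 + ‖a₀‖) ^ N *
      (‖a - a₀‖ * (4 ^ (N + 1) * schwartzNorm (N + 1) g)) := by fun_prop
    simpa using this.tendsto a₀
  refine squeeze_zero' (Filter.Eventually.of_forall fun a => apply_nonneg _ _) ?_ hlim
  filter_upwards [Metric.ball_mem_nhds a₀ one_pos] with a ha
  rw [h1]
  refine (schwartzNorm_compSubConst_le N _ a₀).trans ?_
  gcongr
  exact schwartzNorm_compSubConst_sub_le N g (by
    rw [mem_ball_iff_norm] at ha
    exact ha.le)

end Translation

section Modulation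

open scoped FourierTransform

variable {d : ℕ}

/-- The modulation `M_b g (t) = exp (2πi b · t) g(t)`. -/
def modulate (b : RSpace d) : 𝓢(RSpace d, ℂ) →L[ℂ] 𝓢(RSpace d, ℂ) :=
  SchwartzMap.smulLeftCLM ℂ (character (-b))

theorem modulate_apply (b : RSpace d) (g : 𝓢(RSpace d, ℂ)) (t : RSpace d) :
    modulate b g t = Complex.exp ((2 * Real.pi * inner ℝ b t : ℝ) * Complex.I) * g t := by
  rw [modulate, SchwartzMap.smulLeftCLM_apply_apply (character_hasTemperateGrowth _), smul_eq_mul]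
  simp [character, inner_neg_left]

theorem fourier_modulate (b : RSpace d) (g : 𝓢(RSpace d, ℂ)) :
    𝓕 (modulate b g) = (𝓕 g).compSubConstCLM ℂ b := by
  ext ξ
  rw [SchwartzMap.compSubConstCLM_apply, SchwartzMap.fourier_coe, SchwartzMap.fourier_coe,
    Real.fourier_eq', Real.fourier_eq']
  refine integral_congr_ae (Filter.Eventually.of_forall fun t => ?_)
  simp only [modulate_apply, smul_eq_mul]
  rw [← mul_assoc, ← Complex.exp_add, inner_sub_right, real_inner_comm b t]
  congr 2
  push_cast
  ring

/-- Conjugation by the Fourier transform, which is continuous on Schwartz space, reduces the bounds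
and the continuity of modulations to those of translations. -/
theorem modulate_eq (b : RSpace d) (g : 𝓢(RSpace d, ℂ)) :
    modulate b g = 𝓕⁻ ((𝓕 g).compSubConstCLM ℂ b) := by
  rw [← fourier_modulate, FourierTransform.fourierInv_fourier_eq]

theorem exists_schwartzNorm_modulate_le (N : ℕ) : ∃ (N' L : ℕ) (C : ℝ), 0 ≤ C ∧
    ∀ (b : RSpace d) (g : 𝓢(RSpace d, ℂ)),
      schwartzNorm N (modulate b g) ≤ C * (1 + ‖b‖) ^ L * schwartzNorm N' g := by
  obtain ⟨N₁, C₁, hC₁, h₁⟩ := exists_schwartzNorm_map_le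
    ((FourierTransform.fourierInvCLM ℂ 𝓢(RSpace d, ℂ)).restrictScalars ℝ) N
  obtain ⟨N₂, C₂, hC₂, h₂⟩ := exists_schwartzNorm_map_le
    ((FourierTransform.fourierCLM ℂ 𝓢(RSpace d, ℂ)).restrictScalars ℝ) N₁
  refine ⟨N₂, N₁, C₁ * (2 ^ N₁ * C₂), by positivity, fun b g => ?_⟩
  rw [modulate_eq]
  calc _ ≤ C₁ * schwartzNorm N₁ ((𝓕 g).compSubConstCLM ℂ b) := h₁ _
    _ ≤ C₁ * (2 ^ N₁ * (1 + ‖b‖) ^ N₁ * schwartzNorm N₁ (𝓕 g)) := by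
        gcongr
        exact schwartzNorm_compSubConst_le _ _ _
    _ ≤ C₁ * (2 ^ N₁ * (1 + ‖b‖) ^ N₁ * (C₂ * schwartzNorm N₂ g)) := by
        gcongr
        exact h₂ g
    _ = _ := by ring

theorem continuous_modulate (g : 𝓢(RSpace d, ℂ)) : Continuous fun b => modulate b g := by
  simp only [modulate_eq]
  exact (FourierTransform.fourierInvCLM ℂ 𝓢(RSpace d, ℂ)).continuous.comp
    (continuous_compSubConst _)

/-- Modulations act jointly continuously. -/
theorem continuous_modulate_comp {X : Type*} [TopologicalSpace X] {b : X → RSpace d}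
    (hb : Continuous b) {g : X → 𝓢(RSpace d, ℂ)} (hg : Continuous g) :
    Continuous fun x => modulate (b x) (g x) := by
  refine continuous_of_schwartzNorm fun N x₀ => ?_
  obtain ⟨N', L, C, hC, h⟩ := exists_schwartzNorm_modulate_le (d := d) N
  have h1 : Filter.Tendsto (fun x => C * (1 + ‖b x‖) ^ L * schwartzNorm N' (g x - g x₀))
      (nhds x₀) (nhds 0) := by
    have : Continuous fun x => C * (1 + ‖b x‖) ^ L * schwartzNorm N' (g x - g x₀) :=
      (continuous_const.mul ((continuous_const.add hb.norm).pow L)).mul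
        ((continuous_schwartzNorm N').comp (hg.sub continuous_const))
    simpa using this.tendsto x₀
  have h2 : Filter.Tendsto (fun x => schwartzNorm N (modulate (b x) (g x₀) - modulate (b x₀) (g x₀)))
      (nhds x₀) (nhds 0) := by
    have : Continuous fun x => schwartzNorm N (modulate (b x) (g x₀) - modulate (b x₀) (g x₀)) :=
      (continuous_schwartzNorm N).comp (((continuous_modulate (g x₀)).comp hb).sub continuous_const)
    simpa using this.tendsto x₀
  refine squeeze_zero (fun x => apply_nonneg _ _) (fun x => ?_) (by simpa using h1.add h2)
  have h3 : modulate (b x) (g x) - modulate (b x₀) (g x₀) =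
      modulate (b x) (g x - g x₀) + (modulate (b x) (g x₀) - modulate (b x₀) (g x₀)) := by
    rw [map_sub]; abel
  rw [h3]
  exact (map_add_le_add _ _ _).trans (add_le_add_left (h _ _) _)

end Modulation

/-! ### Time-frequency shifts -/

section TimeFrequency

variable {d : ℕ}

/-- The real part of a vector. -/
def reVec : CSpace d →L[ℝ] RSpace d :=
  LinearMap.toContinuousLinearMap
    { toFun := fun z => WithLp.toLp 2 fun j => (z j).re
      map_add' := fun z w => by ext; simp
      map_smul' := fun c z => by ext; simp }

/-- The imaginary part of a vector. -/
def imVec : CSpace d →L[ℝ] RSpace d :=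
  LinearMap.toContinuousLinearMap
    { toFun := fun z => WithLp.toLp 2 fun j => (z j).im
      map_add' := fun z w => by ext; simp
      map_smul' := fun c z => by ext; simp }

@[simp] theorem reVec_apply (z : CSpace d) (j : Fin d) : reVec z j = (z j).re := rfl
@[simp] theorem imVec_apply (z : CSpace d) (j : Fin d) : imVec z j = (z j).im := rfl

theorem norm_le_reVec_add_imVec (z : CSpace d) : ‖z‖ ≤ ‖reVec z‖ + ‖imVec z‖ := by
  refine (pi_norm_le_iff_of_nonneg (by positivity)).mpr fun j => ?_
  calc ‖z j‖ ≤ |(z j).re| + |(z j).im| := Complex.norm_le_abs_re_add_abs_im _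
    _ ≤ _ := add_le_add (PiLp.norm_apply_le (reVec z) j) (PiLp.norm_apply_le (imVec z) j)

/-- The phase of the symmetric time-frequency shift. -/
def shiftPhase (z : CSpace d) (t : RSpace d) : ℝ :=
  2 * Real.pi * inner ℝ (imVec z) t - Real.pi * inner ℝ (reVec z) (imVec z)

/-- The symmetric time-frequency shift
`ρ(a + ib) g (t) = exp (-πi a·b + 2πi b·t) g(t - a)`. -/
def tfShift (z : CSpace d) : 𝓢(RSpace d, ℂ) →L[ℂ] 𝓢(RSpace d, ℂ) :=
  Complex.exp (((-(Real.pi * inner ℝ (reVec z) (imVec z)) : ℝ) : ℂ) * Complex.I) •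
    (modulate (imVec z)).comp (SchwartzMap.compSubConstCLM ℂ (reVec z))

theorem tfShift_apply (z : CSpace d) (g : 𝓢(RSpace d, ℂ)) (t : RSpace d) :
    tfShift z g t = Complex.exp ((shiftPhase z t : ℝ) * Complex.I) * g (t - reVec z) := by
  change Complex.exp _ * (modulate (imVec z) (g.compSubConstCLM ℂ (reVec z)) t) = _
  rw [modulate_apply, SchwartzMap.compSubConstCLM_apply, ← mul_assoc, ← Complex.exp_add, shiftPhase]
  congr 2
  push_cast
  ring

theorem norm_tfShift_apply (z : CSpace d) (g : 𝓢(RSpace d, ℂ)) (t : RSpace d) :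
    ‖tfShift z g t‖ = ‖g (t - reVec z)‖ := by
  rw [tfShift_apply, norm_mul, Complex.norm_exp_ofReal_mul_I, one_mul]

theorem continuous_tfShift_comp {X : Type*} [TopologicalSpace X] {z : X → CSpace d}
    (hz : Continuous z) (g : 𝓢(RSpace d, ℂ)) : Continuous fun x => tfShift (z x) g := by
  have h1 : Continuous fun x => modulate (imVec (z x)) (g.compSubConstCLM ℂ (reVec (z x))) :=
    continuous_modulate_comp (imVec.continuous.comp hz)
      ((continuous_compSubConst g).comp (reVec.continuous.comp hz))
  have h2 : Continuous fun x =>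
      Complex.exp (((-(Real.pi * inner ℝ (reVec (z x)) (imVec (z x))) : ℝ) : ℂ) * Complex.I) := by
    have := reVec.continuous.comp hz
    have := imVec.continuous.comp hz
    fun_prop
  exact h2.smul h1

theorem continuous_tfShift (g : 𝓢(RSpace d, ℂ)) : Continuous fun z => tfShift z g :=
  continuous_tfShift_comp continuous_id g

/-- Polynomial growth in `z` is enough: the rapid decay of `coeff` absorbs it in the inversion
formula. -/
theorem exists_schwartzNorm_tfShift_le (N : ℕ) : ∃ (N' L : ℕ) (C : ℝ), 0 ≤ C ∧
    ∀ (z : CSpace d) (g : 𝓢(RSpace d, ℂ)),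
      schwartzNorm N (tfShift z g) ≤ C * (1 + ‖z‖) ^ L * schwartzNorm N' g := by
  obtain ⟨N₁, L, C, hC, h⟩ := exists_schwartzNorm_modulate_le (d := d) N
  -- `K` compares the Euclidean norms of both parts with the sup norm of `CSpace d`.
  set K := 1 + ‖(reVec : CSpace d →L[ℝ] RSpace d)‖ + ‖(imVec : CSpace d →L[ℝ] RSpace d)‖
  have hre : ∀ z : CSpace d, 1 + ‖reVec z‖ ≤ K * (1 + ‖z‖) := by
    intro z
    have h1 := (reVec (d := d)).le_opNorm z
    have h2 := norm_nonneg (reVec : CSpace d →L[ℝ] RSpace d)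
    have h3 := norm_nonneg (imVec : CSpace d →L[ℝ] RSpace d)
    simp only [K]
    nlinarith [norm_nonneg z, mul_nonneg h3 (norm_nonneg z)]
  have him : ∀ z : CSpace d, 1 + ‖imVec z‖ ≤ K * (1 + ‖z‖) := by
    intro z
    have h1 := (imVec (d := d)).le_opNorm z
    have h2 := norm_nonneg (reVec : CSpace d →L[ℝ] RSpace d)
    have h3 := norm_nonneg (imVec : CSpace d →L[ℝ] RSpace d)
    simp only [K]
    nlinarith [norm_nonneg z, mul_nonneg h2 (norm_nonneg z)]
  have hK : 0 ≤ K := by positivity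
  refine ⟨N₁, L + N₁, C * K ^ L * (2 ^ N₁ * K ^ N₁), by positivity, fun z g => ?_⟩
  change schwartzNorm N (Complex.exp _ • modulate (imVec z) (g.compSubConstCLM ℂ (reVec z))) ≤ _
  have hs : ∀ f : 𝓢(RSpace d, ℂ), schwartzNorm N (Complex.exp
      (((-(Real.pi * inner ℝ (reVec z) (imVec z)) : ℝ) : ℂ) * Complex.I) • f) ≤ schwartzNorm N f := by
    intro f
    refine schwartzNorm_le (apply_nonneg _ _) fun l hl n hn t => ?_
    have := iteratedFDeriv_const_smul_apply (𝕜 := ℝ) (a := Complex.exp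
      (((-(Real.pi * inner ℝ (reVec z) (imVec z)) : ℝ) : ℂ) * Complex.I)) (i := n) (x := t) (f := f)
        ((f.smooth n).contDiffAt)
    change ‖t‖ ^ l * ‖iteratedFDeriv ℝ n (Complex.exp _ • (f : RSpace d → ℂ)) t‖ ≤ _
    rw [this, norm_smul, Complex.norm_exp_ofReal_mul_I, one_mul]
    exact (SchwartzMap.le_seminorm ℝ l n f t).trans (seminorm_le_schwartzNorm hl hn f)
  calc _ ≤ schwartzNorm N (modulate (imVec z) (g.compSubConstCLM ℂ (reVec z))) := hs _
    _ ≤ C * (1 + ‖imVec z‖) ^ L * schwartzNorm N₁ (g.compSubConstCLM ℂ (reVec z)) := h _ _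
    _ ≤ C * (1 + ‖imVec z‖) ^ L * (2 ^ N₁ * (1 + ‖reVec z‖) ^ N₁ * schwartzNorm N₁ g) := by
        gcongr
        exact schwartzNorm_compSubConst_le _ _ _
    _ ≤ C * (K * (1 + ‖z‖)) ^ L * (2 ^ N₁ * (K * (1 + ‖z‖)) ^ N₁ * schwartzNorm N₁ g) := by
        gcongr
        · exact him z
        · exact hre z
    _ = _ := by rw [mul_pow, mul_pow, pow_add]; ring

end TimeFrequency


/-! ### Phase space -/

section PhaseSpace

variable {d : ℕ}

theorem measurePreserving_reVec_imVec :
    MeasurePreserving (fun z : CSpace d => (reVec z, imVec z)) volume (volume.prod volume) := by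
  have h1 : MeasurePreserving (fun z : CSpace d => fun j => Complex.measurableEquivRealProd (z j))
      volume volume :=
    volume_preserving_pi fun _ => Complex.volume_preserving_equiv_real_prod
  have h2 := volume_measurePreserving_arrowProdEquivProdArrow ℝ ℝ (Fin d)
  have h3 := (PiLp.volume_preserving_toLp (Fin d)).prod (PiLp.volume_preserving_toLp (Fin d))
  exact (h3.comp h2).comp h1

theorem measurableEmbedding_reVec_imVec :
    MeasurableEmbedding (fun z : CSpace d => (reVec z, imVec z)) := by
  have : Function.Injective (fun z : CSpace d => (reVec z, imVec z)) := by
    intro z w h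
    rw [Prod.mk.injEq] at h
    funext j
    exact Complex.ext (congrArg (fun v : RSpace d => v j) h.1) (congrArg (fun v : RSpace d => v j) h.2)
  exact Continuous.measurableEmbedding (reVec.continuous.prodMk imVec.continuous) this

/-- The threshold is one more than the real dimension `2 * d`. -/
theorem integrable_inv_one_add_norm_pow {m : ℕ} (hm : 2 * d + 1 ≤ m) :
    Integrable fun z : CSpace d => ((1 + ‖z‖) ^ m)⁻¹ := by
  have h1 : Module.finrank ℝ (CSpace d) = 2 * d := by
    simp [Module.finrank_pi_fintype, mul_comm]
  have := integrable_one_add_norm (E := CSpace d) (μ := volume) (r := (m : ℝ)) (by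
    rw [h1]
    exact_mod_cast hm)
  refine this.congr (Filter.Eventually.of_forall fun z => ?_)
  change (1 + ‖z‖) ^ (-(m : ℝ)) = _
  rw [Real.rpow_neg (by positivity), Real.rpow_natCast]

end PhaseSpace

/-! ### Coefficients of Schwartz functions -/

section Coefficients

open scoped FourierTransform

variable {d : ℕ}

theorem continuous_conjSchwartz : Continuous (conjSchwartz (d := d)) :=
  (SchwartzMap.postcompCLM (𝕜 := ℝ) (Complex.conjCLE : ℂ →L[ℝ] ℂ)).continuous

theorem exists_schwartzNorm_conj_le (N : ℕ) : ∃ (N' : ℕ) (C : ℝ), 0 ≤ C ∧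
    ∀ g : 𝓢(RSpace d, ℂ), schwartzNorm N (conjSchwartz g) ≤ C * schwartzNorm N' g :=
  exists_schwartzNorm_map_le (SchwartzMap.postcompCLM (𝕜 := ℝ) (Complex.conjCLE : ℂ →L[ℝ] ℂ)) N

/-- The coefficient `⟨g, ρ(z) h⟩`. -/
def coeff (h g : 𝓢(RSpace d, ℂ)) (z : CSpace d) : ℂ :=
  ∫ t, g t * (starRingEnd ℂ) (tfShift z h t)

theorem schwartz_coe_apply (g φ : 𝓢(RSpace d, ℂ)) :
    (g : 𝓢'(RSpace d, ℂ)) φ = ∫ t, φ t * g t :=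
  SchwartzMap.toTemperedDistributionCLM_apply_apply (F := ℂ) volume g φ

theorem coeff_eq (h g : 𝓢(RSpace d, ℂ)) (z : CSpace d) :
    coeff h g z = (g : 𝓢'(RSpace d, ℂ)) (conjSchwartz (tfShift z h)) := by
  rw [schwartz_coe_apply, coeff]
  refine integral_congr_ae (Filter.Eventually.of_forall fun t => ?_)
  simp [conjSchwartz_apply, mul_comm]

theorem continuous_coeff (h g : 𝓢(RSpace d, ℂ)) : Continuous (coeff h g) := by
  have : coeff h g = fun z => (g : 𝓢'(RSpace d, ℂ)) (conjSchwartz (tfShift z h)) :=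
    funext fun z => coeff_eq h g z
  rw [this]
  exact (map_continuous _).comp (continuous_conjSchwartz.comp (continuous_tfShift h))

/-- From 1 + ‖a‖ ≤ (1 + ‖t‖)(1 + ‖t - a‖), the weight in `a` is shared between `g` at `t` and `h` at
`t - a`. -/
theorem exists_integral_mul_translate_le (h : 𝓢(RSpace d, ℂ)) (M : ℕ) : ∃ C : ℝ, 0 ≤ C ∧
    ∀ (g : 𝓢(RSpace d, ℂ)) (a : RSpace d),
      (1 + ‖a‖) ^ M * ∫ t, ‖g t‖ * ‖h (t - a)‖ ≤ C * schwartzNorm M g := by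
  have hI : Integrable fun t : RSpace d => (1 + ‖t‖) ^ M * ‖h t‖ := by
    have : ∀ t : RSpace d, (1 + ‖t‖) ^ M * ‖h t‖ =
        ∑ m ∈ Finset.range (M + 1), (M.choose m : ℝ) * (‖t‖ ^ m * ‖h t‖) := by
      intro t
      rw [add_comm, add_pow, Finset.sum_mul]
      refine Finset.sum_congr rfl fun m _ => ?_
      rw [one_pow]; ring
    simp only [this]
    exact integrable_finsetSum _ fun m _ => (h.integrable_pow_mul volume m).const_mul _
  refine ⟨2 ^ M * ∫ t, (1 + ‖t‖) ^ M * ‖h t‖, mul_nonneg (by positivity)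
    (integral_nonneg fun t => by positivity), fun g a => ?_⟩
  have hIa : Integrable fun t : RSpace d => (1 + ‖t - a‖) ^ M * ‖h (t - a)‖ := hI.comp_sub_right a
  rw [← integral_const_mul]
  calc ∫ t, (1 + ‖a‖) ^ M * (‖g t‖ * ‖h (t - a)‖)
      ≤ ∫ t, 2 ^ M * schwartzNorm M g * ((1 + ‖t - a‖) ^ M * ‖h (t - a)‖) := by
        refine integral_mono_of_nonneg (Filter.Eventually.of_forall fun t => by positivity)
          (hIa.const_mul _) (Filter.Eventually.of_forall fun t => ?_)
        have h1 : 1 + ‖a‖ ≤ (1 + ‖t‖) * (1 + ‖t - a‖) := by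
          have : ‖a‖ ≤ ‖t‖ + ‖t - a‖ := by simpa using norm_sub_le t (t - a)
          nlinarith [norm_nonneg t, norm_nonneg (t - a)]
        calc (1 + ‖a‖) ^ M * (‖g t‖ * ‖h (t - a)‖)
            ≤ ((1 + ‖t‖) * (1 + ‖t - a‖)) ^ M * (‖g t‖ * ‖h (t - a)‖) := by gcongr
          _ = ((1 + ‖t‖) ^ M * ‖g t‖) * ((1 + ‖t - a‖) ^ M * ‖h (t - a)‖) := by
              rw [mul_pow]; ring
          _ ≤ _ := mul_le_mul_of_nonneg_right (one_add_pow_mul_norm_le_schwartzNorm M g t)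
              (by positivity)
    _ = 2 ^ M * schwartzNorm M g * ∫ t, (1 + ‖t‖) ^ M * ‖h t‖ := by
        rw [integral_const_mul, integral_sub_right_eq_self (fun t => (1 + ‖t‖) ^ M * ‖h t‖)]
    _ = _ := by ring

theorem norm_coeff_le (h g : 𝓢(RSpace d, ℂ)) (z : CSpace d) :
    ‖coeff h g z‖ ≤ ∫ t, ‖g t‖ * ‖h (t - reVec z)‖ := by
  refine (norm_integral_le_integral_norm _).trans (le_of_eq ?_)
  refine integral_congr_ae (Filter.Eventually.of_forall fun t => ?_)
  simp only [norm_mul, RCLike.norm_conj, norm_tfShift_apply]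

theorem norm_fourier_compSubConst (h : 𝓢(RSpace d, ℂ)) (a ξ : RSpace d) :
    ‖𝓕 (h.compSubConstCLM ℂ a) ξ‖ = ‖𝓕 h ξ‖ := by
  have h1 : 𝓕 (h.compSubConstCLM ℂ a) ξ =
      Complex.exp ((-(2 * Real.pi * inner ℝ a ξ) : ℝ) * Complex.I) * 𝓕 h ξ := by
    rw [SchwartzMap.fourier_coe, SchwartzMap.fourier_coe, Real.fourier_eq', Real.fourier_eq',
      ← integral_const_mul]
    refine Eq.trans ?_ (integral_sub_right_eq_self (fun t : RSpace d =>
      Complex.exp ((-(2 * Real.pi * inner ℝ a ξ) : ℝ) * Complex.I) *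
        (Complex.exp ((-2 * Real.pi * inner ℝ t ξ : ℝ) * Complex.I) • h t)) a)
    refine integral_congr_ae (Filter.Eventually.of_forall fun t => ?_)
    simp only [SchwartzMap.compSubConstCLM_apply, smul_eq_mul]
    rw [← mul_assoc, ← Complex.exp_add, inner_sub_left]
    congr 2
    push_cast
    ring
  rw [h1, norm_mul, Complex.norm_exp_ofReal_mul_I, one_mul]

/-- By Parseval. On the Fourier side the modulation by `imVec z` is a translation and the
translation by `reVec z` only a phase, so this controls the decay in the imaginary part. -/
theorem norm_coeff_le_fourier (h g : 𝓢(RSpace d, ℂ)) (z : CSpace d) :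
    ‖coeff h g z‖ ≤ ∫ ξ, ‖𝓕 g ξ‖ * ‖𝓕 h (ξ - imVec z)‖ := by
  have h1 : coeff h g z = ∫ ξ, 𝓕 g ξ * (starRingEnd ℂ) (𝓕 (tfShift z h) ξ) := by
    have := SchwartzMap.integral_inner_fourier_fourier (tfShift z h) g
    simp only [RCLike.inner_apply] at this
    exact this.symm
  rw [h1]
  refine (norm_integral_le_integral_norm _).trans (le_of_eq ?_)
  refine integral_congr_ae (Filter.Eventually.of_forall fun ξ => ?_)
  simp only [norm_mul, RCLike.norm_conj]
  congr 1
  have h2 : 𝓕 (tfShift z h) = Complex.exp (((-(Real.pi * inner ℝ (reVec z) (imVec z)) : ℝ) : ℂ) *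
      Complex.I) • (𝓕 (h.compSubConstCLM ℂ (reVec z))).compSubConstCLM ℂ (imVec z) := by
    rw [← fourier_modulate, ← FourierTransform.fourier_smul]
    rfl
  rw [h2]
  change ‖Complex.exp _ * (𝓕 (h.compSubConstCLM ℂ (reVec z))) (ξ - imVec z)‖ = _
  rw [norm_mul, Complex.norm_exp_ofReal_mul_I, one_mul, norm_fourier_compSubConst]

/-- Coefficients of Schwartz functions decay rapidly. -/
theorem exists_coeff_decay (h : 𝓢(RSpace d, ℂ)) (M : ℕ) : ∃ (N : ℕ) (C : ℝ), 0 ≤ C ∧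
    ∀ (g : 𝓢(RSpace d, ℂ)) (z : CSpace d), (1 + ‖z‖) ^ M * ‖coeff h g z‖ ≤ C * schwartzNorm N g := by
  obtain ⟨C₁, hC₁, h₁⟩ := exists_integral_mul_translate_le h M
  obtain ⟨C₂, hC₂, h₂⟩ := exists_integral_mul_translate_le (𝓕 h) M
  obtain ⟨N₃, C₃, hC₃, h₃⟩ := exists_schwartzNorm_map_le
    ((FourierTransform.fourierCLM ℂ 𝓢(RSpace d, ℂ)).restrictScalars ℝ) M
  refine ⟨max M N₃, 2 ^ M * (C₁ + C₂ * C₃), by positivity, fun g z => ?_⟩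
  -- Decay in the real part is read off on the time side and decay in the imaginary part on the
  -- Fourier side; the larger of the two parts controls `‖z‖`.
  have e1 : (1 + ‖reVec z‖) ^ M * ‖coeff h g z‖ ≤ C₁ * schwartzNorm (max M N₃) g := by
    refine le_trans ?_ ((h₁ g (reVec z)).trans ?_)
    · gcongr
      exact norm_coeff_le h g z
    · gcongr
      exact schwartzNorm_mono (le_max_left _ _) g
  have e2 : (1 + ‖imVec z‖) ^ M * ‖coeff h g z‖ ≤ C₂ * (C₃ * schwartzNorm (max M N₃) g) := by
    refine le_trans ?_ ((h₂ (𝓕 g) (imVec z)).trans ?_)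
    · gcongr
      exact norm_coeff_le_fourier h g z
    · gcongr
      refine (h₃ g).trans ?_
      gcongr
      exact schwartzNorm_mono (le_max_right _ _) g
  have e3 : (1 + ‖z‖) ^ M ≤ 2 ^ M * ((1 + ‖reVec z‖) ^ M + (1 + ‖imVec z‖) ^ M) := by
    have hz := norm_le_reVec_add_imVec z
    have ha := norm_nonneg (reVec z)
    have hb := norm_nonneg (imVec z)
    rcases le_total ‖reVec z‖ ‖imVec z‖ with hab | hab
    · calc (1 + ‖z‖) ^ M ≤ (2 * (1 + ‖imVec z‖)) ^ M := by gcongr; linarith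
        _ ≤ _ := by
          rw [mul_pow]
          gcongr
          have : 0 ≤ (1 + ‖reVec z‖) ^ M := by positivity
          linarith
    · calc (1 + ‖z‖) ^ M ≤ (2 * (1 + ‖reVec z‖)) ^ M := by gcongr; linarith
        _ ≤ _ := by
          rw [mul_pow]
          gcongr
          have : 0 ≤ (1 + ‖imVec z‖) ^ M := by positivity
          linarith
  calc (1 + ‖z‖) ^ M * ‖coeff h g z‖
      ≤ 2 ^ M * ((1 + ‖reVec z‖) ^ M + (1 + ‖imVec z‖) ^ M) * ‖coeff h g z‖ := by gcongr
    _ = 2 ^ M * ((1 + ‖reVec z‖) ^ M * ‖coeff h g z‖ + (1 + ‖imVec z‖) ^ M * ‖coeff h g z‖) := by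
        ring
    _ ≤ 2 ^ M * (C₁ * schwartzNorm (max M N₃) g + C₂ * (C₃ * schwartzNorm (max M N₃) g)) := by
        gcongr
    _ = _ := by ring

/-- For a fixed real part the coefficient is, up to a phase, a Fourier transform in the imaginary
part, so that the inversion formula comes down to Fourier inversion. -/
theorem coeff_eq_fourier (h g : 𝓢(RSpace d, ℂ)) (z : CSpace d) :
    coeff h g z = Complex.exp ((Real.pi * inner ℝ (reVec z) (imVec z) : ℝ) * Complex.I) *
      𝓕 (SchwartzMap.pairing (ContinuousLinearMap.mul ℂ ℂ) g
        (conjSchwartz (h.compSubConstCLM ℂ (reVec z)))) (imVec z) := by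
  rw [SchwartzMap.fourier_coe, Real.fourier_eq', coeff, ← integral_const_mul]
  refine integral_congr_ae (Filter.Eventually.of_forall fun t => ?_)
  simp only [SchwartzMap.pairing_apply_apply, ContinuousLinearMap.mul_apply', conjSchwartz_apply,
    SchwartzMap.compSubConstCLM_apply, smul_eq_mul, tfShift_apply, map_mul, ← Complex.exp_conj,
    Complex.conj_I, Complex.conj_ofReal]
  have : Complex.exp (((shiftPhase z t : ℝ) : ℂ) * -Complex.I) =
      Complex.exp ((Real.pi * inner ℝ (reVec z) (imVec z) : ℝ) * Complex.I) *
        Complex.exp ((-2 * Real.pi * inner ℝ t (imVec z) : ℝ) * Complex.I) := by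
    rw [← Complex.exp_add, shiftPhase, real_inner_comm t (imVec z)]
    congr 1
    push_cast
    ring
  rw [this]
  ring

theorem integral_fourier_mul_exp (G : 𝓢(RSpace d, ℂ)) (t : RSpace d) :
    ∫ b, 𝓕 G b * Complex.exp ((2 * Real.pi * inner ℝ b t : ℝ) * Complex.I) = G t := by
  have h1 : (𝓕⁻ (𝓕 G)) t = G t := by rw [FourierTransform.fourierInv_fourier_eq]
  rw [← h1, SchwartzMap.fourierInv_coe, Real.fourierInv_eq']
  refine integral_congr_ae (Filter.Eventually.of_forall fun b => ?_)
  simp only [smul_eq_mul]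
  rw [mul_comm]

theorem integrable_coeff_mul (h g : 𝓢(RSpace d, ℂ)) {F : CSpace d → ℂ}
    (hF : AEStronglyMeasurable F) {L : ℕ} {C : ℝ} (hC : ∀ z, ‖F z‖ ≤ C * (1 + ‖z‖) ^ L) :
    Integrable fun z => coeff h g z * F z := by
  obtain ⟨N, C', hC', h'⟩ := exists_coeff_decay h (L + (2 * d + 1))
  refine ((integrable_inv_one_add_norm_pow (le_refl (2 * d + 1))).const_mul
    (C' * schwartzNorm N g * C)).mono'
    ((continuous_coeff h g).aestronglyMeasurable.mul hF) (Filter.Eventually.of_forall fun z => ?_)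
  have hp : 0 < (1 + ‖z‖) ^ (2 * d + 1) := by positivity
  rw [norm_mul, ← div_eq_mul_inv, le_div_iff₀ hp]
  have hC0 : 0 ≤ C * (1 + ‖z‖) ^ L := (norm_nonneg _).trans (hC z)
  have hC1 : 0 ≤ C := nonneg_of_mul_nonneg_left hC0 (by positivity)
  calc ‖coeff h g z‖ * ‖F z‖ * (1 + ‖z‖) ^ (2 * d + 1)
      ≤ ‖coeff h g z‖ * (C * (1 + ‖z‖) ^ L) * (1 + ‖z‖) ^ (2 * d + 1) := by
        gcongr
        exact hC z
    _ = ((1 + ‖z‖) ^ (L + (2 * d + 1)) * ‖coeff h g z‖) * C := by rw [pow_add]; ring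
    _ ≤ _ := mul_le_mul_of_nonneg_right (h' g z) hC1

/-- The inversion formula for the short-time Fourier transform. -/
theorem integral_coeff_mul_tfShift (h g : 𝓢(RSpace d, ℂ)) (t : RSpace d) :
    ∫ z, coeff h g z * tfShift z h t = g t * ((∫ s, ‖h s‖ ^ 2 : ℝ) : ℂ) := by
  let toC : RSpace d × RSpace d → CSpace d := fun p j => ⟨p.1 j, p.2 j⟩
  have htoC : ∀ z : CSpace d, toC (reVec z, imVec z) = z := fun z => rfl
  have hre : ∀ p, reVec (toC p) = p.1 := fun p => by ext j; rfl
  have him : ∀ p, imVec (toC p) = p.2 := fun p => by ext j; rfl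
  let F : RSpace d × RSpace d → ℂ := fun p => coeff h g (toC p) * tfShift (toC p) h t
  have hF : ∀ z, coeff h g z * tfShift z h t = F (reVec z, imVec z) := fun z => rfl
  have hmeas : Continuous fun z : CSpace d => tfShift z h t := by
    have h1 : Continuous fun z : CSpace d => TemperedDistribution.delta t (tfShift z h) :=
      (map_continuous (TemperedDistribution.delta t)).comp (continuous_tfShift h)
    exact h1
  have hint : Integrable F (volume.prod volume) := by
    rw [← measurePreserving_reVec_imVec.integrable_comp_emb measurableEmbedding_reVec_imVec]
    refine integrable_coeff_mul h g hmeas.aestronglyMeasurable (L := 0)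
      (C := SchwartzMap.seminorm ℝ 0 0 h) fun z => ?_
    rw [pow_zero, mul_one, norm_tfShift_apply]
    exact SchwartzMap.norm_le_seminorm ℝ h _
  simp only [hF]
  rw [measurePreserving_reVec_imVec.integral_comp measurableEmbedding_reVec_imVec F,
    integral_prod F hint]
  -- Integrating first over the frequency `b` is Fourier inversion for g · conj h(· - a) at `t`; the
  -- remaining integral over `a` is the squared norm of `h`.
  have hinner : ∀ a, ∫ b, F (a, b) = g t * ((‖h (t - a)‖ ^ 2 : ℝ) : ℂ) := by
    intro a
    have : ∀ b, F (a, b) = 𝓕 (SchwartzMap.pairing (ContinuousLinearMap.mul ℂ ℂ) g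
        (conjSchwartz (h.compSubConstCLM ℂ a))) b *
          Complex.exp ((2 * Real.pi * inner ℝ b t : ℝ) * Complex.I) * h (t - a) := by
      intro b
      simp only [F, coeff_eq_fourier, tfShift_apply, hre, him]
      have : Complex.exp ((2 * Real.pi * inner ℝ b t : ℝ) * Complex.I) =
          Complex.exp ((Real.pi * inner ℝ a b : ℝ) * Complex.I) *
            Complex.exp ((shiftPhase (toC (a, b)) t : ℝ) * Complex.I) := by
        rw [← Complex.exp_add, shiftPhase, hre, him]
        congr 1
        push_cast
        ring
      rw [this]
      ring
    simp only [this]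
    rw [integral_mul_const, integral_fourier_mul_exp]
    simp only [SchwartzMap.pairing_apply_apply, ContinuousLinearMap.mul_apply', conjSchwartz_apply,
      SchwartzMap.compSubConstCLM_apply]
    rw [mul_assoc, mul_comm ((starRingEnd ℂ) _), Complex.mul_conj']
    push_cast
    rfl
  simp only [hinner]
  rw [integral_const_mul, integral_complex_ofReal]
  congr 2
  exact integral_sub_left_eq_self (fun s => ‖h s‖ ^ 2) volume t

/-- Tempered distributions are reconstructed from their short-time Fourier transforms. -/
theorem distribution_eq_integral {h : 𝓢(RSpace d, ℂ)} (hh : ∫ s, ‖h s‖ ^ 2 = 1)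
    (f : 𝓢'(RSpace d, ℂ)) (g : 𝓢(RSpace d, ℂ)) :
    Integrable (fun z => coeff h g z * f (tfShift z h)) ∧
      f g = ∫ z, coeff h g z * f (tfShift z h) := by
  obtain ⟨G, hG, hfG⟩ := exists_schwartz_integral (μ := volume) (c := coeff h g)
    (continuous_coeff h g).aestronglyMeasurable (g := fun z => tfShift z h) (continuous_tfShift h)
    (fun N => by
      obtain ⟨N', L, C, hC, hb⟩ := exists_schwartzNorm_tfShift_le (d := d) N
      have hm : Continuous fun z : CSpace d => schwartzNorm N (tfShift z h) :=
        (continuous_schwartzNorm N).comp (continuous_tfShift h)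
      have := (integrable_coeff_mul h g (F := fun z => (schwartzNorm N (tfShift z h) : ℂ))
        (Complex.continuous_ofReal.comp hm).aestronglyMeasurable (L := L)
        (C := C * schwartzNorm N' h) (fun z => by
          rw [Complex.norm_real, Real.norm_of_nonneg (apply_nonneg _ _)]
          refine (hb z h).trans (le_of_eq ?_)
          ring)).norm
      refine this.congr (Filter.Eventually.of_forall fun z => ?_)
      simp only [norm_mul, Complex.norm_real, Real.norm_of_nonneg (apply_nonneg _ _)])
  have hGg : G = g := by
    ext t
    rw [hG t, integral_coeff_mul_tfShift, hh, Complex.ofReal_one, mul_one]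
  have := hfG f
  rwa [hGg] at this

end Coefficients


/-! ### Derivatives of time-frequency shifts -/

section Generator

open scoped LineDeriv

variable {d : ℕ}

theorem inner_hasTemperateGrowth (v : RSpace d) :
    Function.HasTemperateGrowth fun t : RSpace d => ((inner ℝ v t : ℝ) : ℂ) :=
  Function.Complex.hasTemperateGrowth_ofReal.comp (Function.hasTemperateGrowth_inner_right v)

/-- The derivative of `z ↦ ρ(z) g` at `z` in the direction `v`. -/
def tfShiftDeriv (g : 𝓢(RSpace d, ℂ)) (z v : CSpace d) : 𝓢(RSpace d, ℂ) :=
  (2 * Real.pi * Complex.I) •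
      tfShift z (SchwartzMap.smulLeftCLM ℂ (fun t => ((inner ℝ (imVec v) t : ℝ) : ℂ)) g) -
    tfShift z (∂_{reVec v} g) +
    (((Real.pi * (inner ℝ (reVec z) (imVec v) - inner ℝ (reVec v) (imVec z)) : ℝ) : ℂ) * Complex.I) •
      tfShift z g

theorem tfShiftDeriv_apply (g : 𝓢(RSpace d, ℂ)) (z v : CSpace d) (t : RSpace d) :
    tfShiftDeriv g z v t =
      Complex.exp ((shiftPhase z t : ℝ) * Complex.I) *
        (((2 * Real.pi * inner ℝ (imVec v) t - Real.pi * inner ℝ (reVec v) (imVec z) -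
          Real.pi * inner ℝ (reVec z) (imVec v) : ℝ) : ℂ) * Complex.I * g (t - reVec z) -
        fderiv ℝ g (t - reVec z) (reVec v)) := by
  change (2 * Real.pi * Complex.I) * _ - _ + _ * _ = _
  rw [tfShift_apply, tfShift_apply, tfShift_apply,
    SchwartzMap.smulLeftCLM_apply_apply (inner_hasTemperateGrowth _),
    SchwartzMap.lineDerivOp_apply_eq_fderiv, smul_eq_mul, inner_sub_right,
    real_inner_comm (reVec z) (imVec v)]
  push_cast
  ring

theorem hasDerivAt_tfShift_apply (g : 𝓢(RSpace d, ℂ)) (z v : CSpace d) (t : RSpace d) (s : ℝ) :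
    HasDerivAt (fun s : ℝ => tfShift (z + s • v) g t) (tfShiftDeriv g (z + s • v) v t) s := by
  have hb : HasDerivAt (fun s : ℝ => imVec (z + s • v)) (imVec v) s := by
    simp only [map_add, map_smul]
    simpa using ((hasDerivAt_id s).smul_const (imVec v)).const_add (imVec z)
  have ha : HasDerivAt (fun s : ℝ => reVec (z + s • v)) (reVec v) s := by
    simp only [map_add, map_smul]
    simpa using ((hasDerivAt_id s).smul_const (reVec v)).const_add (reVec z)
  have hp : HasDerivAt (fun s : ℝ => shiftPhase (z + s • v) t)
      (2 * Real.pi * inner ℝ (imVec v) t - Real.pi * inner ℝ (reVec v) (imVec (z + s • v)) -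
          Real.pi * inner ℝ (reVec (z + s • v)) (imVec v)) s := by
    have h1 := (hb.inner ℝ (hasDerivAt_const s t)).const_mul (2 * Real.pi)
    have h2 := (ha.inner ℝ hb).const_mul Real.pi
    refine (h1.sub h2).congr_deriv ?_
    simp only [inner_zero_right]
    ring
  have hg : HasDerivAt (fun s : ℝ => g (t - reVec (z + s • v)))
      (-(fderiv ℝ g (t - reVec (z + s • v)) (reVec v))) s := by
    have := (g.hasFDerivAt (t - reVec (z + s • v))).comp_hasDerivAt s (ha.const_sub t)
    simpa [Function.comp_def] using! this
  have he := (hp.ofReal_comp.mul_const Complex.I).cexp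
  simp only [tfShift_apply, tfShiftDeriv_apply]
  refine (he.mul hg).congr_deriv ?_
  ring

theorem continuous_tfShiftDeriv_comp {X : Type*} [TopologicalSpace X] (g : 𝓢(RSpace d, ℂ))
    {z : X → CSpace d} (hz : Continuous z) (v : CSpace d) :
    Continuous fun x => tfShiftDeriv g (z x) v := by
  have h1 := fun g => continuous_tfShift_comp hz g
  have h2 : Continuous fun x => ((Real.pi * (inner ℝ (reVec (z x)) (imVec v) -
      inner ℝ (reVec v) (imVec (z x))) : ℝ) : ℂ) * Complex.I := by
    have := reVec.continuous.comp hz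
    have := imVec.continuous.comp hz
    fun_prop
  exact (((h1 _).const_smul (2 * Real.pi * Complex.I)).sub (h1 _)).add (h2.smul (h1 g))

theorem tfShiftDeriv_add (g : 𝓢(RSpace d, ℂ)) (z v w : CSpace d) :
    tfShiftDeriv g z (v + w) = tfShiftDeriv g z v + tfShiftDeriv g z w := by
  ext t
  change _ = tfShiftDeriv g z v t + tfShiftDeriv g z w t
  simp only [tfShiftDeriv_apply, map_add, inner_add_left, inner_add_right]
  push_cast
  ring

theorem tfShiftDeriv_smul (g : 𝓢(RSpace d, ℂ)) (z v : CSpace d) (r : ℝ) :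
    tfShiftDeriv g z (r • v) = (r : ℂ) • tfShiftDeriv g z v := by
  ext t
  change _ = (r : ℂ) * tfShiftDeriv g z v t
  simp only [tfShiftDeriv_apply, map_smul, real_inner_smul_left, real_inner_smul_right,
    Complex.real_smul]
  push_cast
  ring

/-- The derivative of `z ↦ f (ρ(z) g)` as a continuous linear map. -/
def applyTfShiftDeriv (f : 𝓢'(RSpace d, ℂ)) (g : 𝓢(RSpace d, ℂ)) (z : CSpace d) :
    CSpace d →L[ℝ] ℂ :=
  LinearMap.toContinuousLinearMap
    { toFun := fun v => f (tfShiftDeriv g z v)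
      map_add' := fun v w => by rw [tfShiftDeriv_add, map_add]
      map_smul' := fun r v => by
        rw [tfShiftDeriv_smul, map_smul, RingHom.id_apply, smul_eq_mul, Complex.real_smul] }

theorem applyTfShiftDeriv_apply (f : 𝓢'(RSpace d, ℂ)) (g : 𝓢(RSpace d, ℂ)) (z v : CSpace d) :
    applyTfShiftDeriv f g z v = f (tfShiftDeriv g z v) := rfl

/-- The fundamental theorem of calculus holds pointwise in `t`; since the integral of the derivative
exists in Schwartz space, `f` may be applied to it. No derivative in the Schwartz topology is
needed. -/
theorem apply_tfShift_sub (f : 𝓢'(RSpace d, ℂ)) (g : 𝓢(RSpace d, ℂ)) (z v : CSpace d) :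
    f (tfShift (z + v) g) - f (tfShift z g) =
      ∫ s in (0 : ℝ)..1, f (tfShiftDeriv g (z + s • v) v) := by
  have hcont : Continuous fun s : ℝ => tfShiftDeriv g (z + s • v) v :=
    continuous_tfShiftDeriv_comp g (by fun_prop) v
  obtain ⟨G, hG, hf⟩ := exists_schwartz_integral (X := ℝ) (μ := volume.restrict (Set.Ioc 0 1))
    (c := fun _ => (1 : ℂ)) aestronglyMeasurable_const hcont (fun N => by
      simp only [norm_one, one_mul]
      exact (((continuous_schwartzNorm N).comp hcont).continuousOn (s := Set.Icc 0 1)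
        |>.integrableOn_compact isCompact_Icc).mono_set Set.Ioc_subset_Icc_self)
  have h1 : G = tfShift (z + v) g - tfShift z g := by
    ext t
    rw [hG t]
    simp only [one_mul]
    rw [← intervalIntegral.integral_of_le zero_le_one,
      intervalIntegral.integral_eq_sub_of_hasDerivAt
        (fun s _ => hasDerivAt_tfShift_apply g z v t s)]
    · simp
    · have : Continuous fun s : ℝ => TemperedDistribution.delta t (tfShiftDeriv g (z + s • v) v) :=
        (map_continuous (TemperedDistribution.delta t)).comp hcont
      exact this.intervalIntegrable _ _
  have h2 := (hf f).2
  rw [h1, map_sub] at h2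
  rw [h2, intervalIntegral.integral_of_le zero_le_one]
  simp

/-- The directional derivatives depend continuously on the base point, so the integral remainder in
`apply_tfShift_sub` is o(‖v‖). -/
theorem hasFDerivAt_apply_tfShift (f : 𝓢'(RSpace d, ℂ)) (g : 𝓢(RSpace d, ℂ)) (z : CSpace d) :
    HasFDerivAt (fun z => f (tfShift z g)) (applyTfShiftDeriv f g z) z := by
  have hL : Continuous (applyTfShiftDeriv f g) := by
    rw [continuous_clm_apply]
    exact fun v => (map_continuous f).comp (continuous_tfShiftDeriv_comp g continuous_id v)
  rw [hasFDerivAt_iff_isLittleO_nhds_zero, Asymptotics.isLittleO_iff]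
  intro ε hε
  obtain ⟨δ, hδ, hb⟩ := Metric.continuousAt_iff.mp (hL.continuousAt (x := z)) ε hε
  filter_upwards [Metric.ball_mem_nhds (0 : CSpace d) hδ] with v hv
  rw [mem_ball_zero_iff] at hv
  have hcont : Continuous fun s : ℝ => f (tfShiftDeriv g (z + s • v) v) :=
    (map_continuous f).comp (continuous_tfShiftDeriv_comp g (by fun_prop) v)
  have h1 : f (tfShift (z + v) g) - f (tfShift z g) - applyTfShiftDeriv f g z v =
      ∫ s in (0 : ℝ)..1, (f (tfShiftDeriv g (z + s • v) v) - applyTfShiftDeriv f g z v) := by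
    rw [apply_tfShift_sub, intervalIntegral.integral_sub (hcont.intervalIntegrable _ _) (by simp)]
    simp
  rw [h1]
  refine (intervalIntegral.norm_integral_le_of_norm_le_const (C := ε * ‖v‖) fun s hs => ?_).trans
    (by simp)
  rw [Set.uIoc_of_le zero_le_one] at hs
  rw [← applyTfShiftDeriv_apply, ← sub_apply]
  refine (ContinuousLinearMap.le_opNorm _ _).trans ?_
  gcongr
  rw [← dist_eq_norm]
  refine (hb ?_).le
  rw [dist_eq_norm, add_sub_cancel_left, norm_smul, Real.norm_of_nonneg hs.1.le]
  nlinarith [hs.2, norm_nonneg v]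

end Generator

/-! ### Raising operators and the polyanalytic Bargmann transform -/

section Ladder

open scoped LineDeriv

variable {d : ℕ}

/-- The raising operator `π x_j - ∂_j / 2`. -/
def raising (j : Fin d) : 𝓢(RSpace d, ℂ) →L[ℂ] 𝓢(RSpace d, ℂ) :=
  (Real.pi : ℂ) • SchwartzMap.smulLeftCLM ℂ (fun t : RSpace d => ((t j : ℝ) : ℂ)) -
    (1 / 2 : ℂ) • LineDeriv.lineDerivOpCLM ℂ 𝓢(RSpace d, ℂ) (EuclideanSpace.single j (1 : ℝ))

theorem raising_apply (j : Fin d) (g : 𝓢(RSpace d, ℂ)) (t : RSpace d) :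
    raising j g t = Real.pi * (t j : ℂ) * g t -
      (1 / 2 : ℂ) * fderiv ℝ g t (EuclideanSpace.single j (1 : ℝ)) := by
  change (Real.pi : ℂ) * (SchwartzMap.smulLeftCLM ℂ (fun t : RSpace d => ((t j : ℝ) : ℂ)) g t) -
    (1 / 2 : ℂ) * (∂_{EuclideanSpace.single j (1 : ℝ)} g) t = _
  rw [SchwartzMap.smulLeftCLM_apply_apply (coord_hasTemperateGrowth j), smul_eq_mul,
    SchwartzMap.lineDerivOp_apply_eq_fderiv]
  ring

/-- The function `exp (-π |z|²/2) f (ρ(z) g)`. -/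
def gaussTransform (f : 𝓢'(RSpace d, ℂ)) (g : 𝓢(RSpace d, ℂ)) (z : CSpace d) : ℂ :=
  (Real.exp (-(Real.pi / 2 * sqNorm z)) : ℂ) * f (tfShift z g)

theorem hasFDerivAt_sqNorm (z : CSpace d) :
    HasFDerivAt sqNorm (∑ j, (2 * (z j).re) • (Complex.reCLM.comp (ContinuousLinearMap.proj j)) +
      ∑ j, (2 * (z j).im) • (Complex.imCLM.comp (ContinuousLinearMap.proj j)) :
        CSpace d →L[ℝ] ℝ) z := by
  have h : (sqNorm : CSpace d → ℝ) = fun z => ∑ j, ((z j).re ^ 2 + (z j).im ^ 2) := by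
    funext z
    simp only [sqNorm, Complex.sq_norm, Complex.normSq_apply]
    refine Finset.sum_congr rfl fun j _ => by ring
  rw [h, ← Finset.sum_add_distrib]
  refine HasFDerivAt.fun_sum fun j _ => ?_
  have h1 : HasFDerivAt (fun z : CSpace d => (z j).re)
      (Complex.reCLM.comp (ContinuousLinearMap.proj j)) z :=
    (Complex.reCLM.comp (ContinuousLinearMap.proj (R := ℝ) (φ := fun _ : Fin d => ℂ) j)).hasFDerivAt
  have h2 : HasFDerivAt (fun z : CSpace d => (z j).im)
      (Complex.imCLM.comp (ContinuousLinearMap.proj j)) z :=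
    (Complex.imCLM.comp (ContinuousLinearMap.proj (R := ℝ) (φ := fun _ : Fin d => ℂ) j)).hasFDerivAt
  refine ((h1.pow 2).add (h2.pow 2)).congr_fderiv ?_
  simp

/-- Combining the directions 1 and i, ∂/∂z_j of f(ρ(z)g) is f(ρ(z)(πx_j - ∂_j/2)g) plus (π/2)
conj(z_j) f(ρ(z)g). The derivative of the Gaussian factor contributes -(π/2) conj(z_j), which
cancels the second term. -/
theorem wirtinger_gaussTransform (f : 𝓢'(RSpace d, ℂ)) (g : 𝓢(RSpace d, ℂ)) (j : Fin d) :
    wirtinger j (gaussTransform f g) = gaussTransform f (raising j g) := by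
  funext z
  set e : ℝ := Real.exp (-(Real.pi / 2 * sqNorm z)) with he
  have h1 : HasFDerivAt (fun z : CSpace d => ((Real.exp (-(Real.pi / 2 * sqNorm z)) : ℝ) : ℂ))
      (Complex.ofRealCLM.comp (e • -((Real.pi / 2) •
        (∑ j, (2 * (z j).re) • (Complex.reCLM.comp (ContinuousLinearMap.proj j)) +
      ∑ j, (2 * (z j).im) • (Complex.imCLM.comp (ContinuousLinearMap.proj j)) :
        CSpace d →L[ℝ] ℝ)))) z :=
    Complex.ofRealCLM.hasFDerivAt.comp z
      ((((hasFDerivAt_sqNorm z).const_mul (Real.pi / 2)).neg).exp)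
  have h2 := h1.mul (hasFDerivAt_apply_tfShift f g z)
  rw [← he] at h2
  have h3 : HasFDerivAt (gaussTransform f g) _ z := h2
  have hre1 : reVec (Pi.single j (1 : ℂ) : CSpace d) = EuclideanSpace.single j (1 : ℝ) := by
    ext i
    by_cases hij : i = j <;> simp [hij]
  have him1 : imVec (Pi.single j (1 : ℂ) : CSpace d) = 0 := by
    ext i
    by_cases hij : i = j <;> simp [hij]
  have hre2 : reVec (Pi.single j Complex.I : CSpace d) = 0 := by
    ext i
    by_cases hij : i = j <;> simp [hij]
  have him2 : imVec (Pi.single j Complex.I : CSpace d) = EuclideanSpace.single j (1 : ℝ) := by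
    ext i
    by_cases hij : i = j <;> simp [hij]
  have e1 : f (tfShiftDeriv g z (Pi.single j 1)) =
      -f (tfShift z (∂_{EuclideanSpace.single j (1 : ℝ)} g)) -
        Real.pi * (z j).im * Complex.I * f (tfShift z g) := by
    have : tfShiftDeriv g z (Pi.single j 1) =
        -tfShift z (∂_{EuclideanSpace.single j (1 : ℝ)} g) -
          (Real.pi * (z j).im * Complex.I) • tfShift z g := by
      ext t
      change _ = -(tfShift z (∂_{EuclideanSpace.single j (1 : ℝ)} g) t) -
          (Real.pi * (z j).im * Complex.I) * tfShift z g t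
      rw [tfShiftDeriv_apply, tfShift_apply, tfShift_apply, hre1, him1,
        SchwartzMap.lineDerivOp_apply_eq_fderiv]
      simp [EuclideanSpace.inner_single_left]
      ring
    rw [this, map_sub, map_neg, map_smul, smul_eq_mul]
  have e2 : f (tfShiftDeriv g z (Pi.single j Complex.I)) =
      2 * Real.pi * Complex.I * f (tfShift z (SchwartzMap.smulLeftCLM ℂ
        (fun t : RSpace d => ((t j : ℝ) : ℂ)) g)) +
        Real.pi * (z j).re * Complex.I * f (tfShift z g) := by
    have : tfShiftDeriv g z (Pi.single j Complex.I) =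
        (2 * Real.pi * Complex.I) • tfShift z (SchwartzMap.smulLeftCLM ℂ
          (fun t : RSpace d => ((t j : ℝ) : ℂ)) g) +
          (Real.pi * (z j).re * Complex.I) • tfShift z g := by
      ext t
      change _ = (2 * Real.pi * Complex.I) * (tfShift z (SchwartzMap.smulLeftCLM ℂ
          (fun t : RSpace d => ((t j : ℝ) : ℂ)) g) t) +
          (Real.pi * (z j).re * Complex.I) * tfShift z g t
      rw [tfShiftDeriv_apply, tfShift_apply, tfShift_apply, hre2, him2,
        SchwartzMap.smulLeftCLM_apply_apply (coord_hasTemperateGrowth j)]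
      simp [EuclideanSpace.inner_single_left, EuclideanSpace.inner_single_right]
      ring
    rw [this, map_add, map_smul, map_smul, smul_eq_mul, smul_eq_mul]
  have e3 : f (tfShift z (raising j g)) =
      Real.pi * f (tfShift z (SchwartzMap.smulLeftCLM ℂ (fun t : RSpace d => ((t j : ℝ) : ℂ)) g)) -
        1 / 2 * f (tfShift z (∂_{EuclideanSpace.single j (1 : ℝ)} g)) := by
    have : raising j g = (Real.pi : ℂ) • SchwartzMap.smulLeftCLM ℂ
        (fun t : RSpace d => ((t j : ℝ) : ℂ)) g -
          (1 / 2 : ℂ) • ∂_{EuclideanSpace.single j (1 : ℝ)} g := rfl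
    rw [this]
    simp only [map_sub, map_smul, smul_eq_mul]
  have s1 : ∀ (w : Fin d → ℝ), ∑ x, w x * ((Pi.single j (1 : ℂ) : CSpace d) x).re = w j := by
    intro w
    rw [Finset.sum_eq_single j (fun i _ hi => by simp [hi]) (by simp)]
    simp
  have s2 : ∀ (w : Fin d → ℝ), ∑ x, w x * ((Pi.single j (1 : ℂ) : CSpace d) x).im = 0 := by
    intro w
    refine Finset.sum_eq_zero fun i _ => ?_
    by_cases hij : i = j <;> simp [hij]
  have s3 : ∀ (w : Fin d → ℝ), ∑ x, w x * ((Pi.single j Complex.I : CSpace d) x).re = 0 := by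
    intro w
    refine Finset.sum_eq_zero fun i _ => ?_
    by_cases hij : i = j <;> simp [hij]
  have s4 : ∀ (w : Fin d → ℝ), ∑ x, w x * ((Pi.single j Complex.I : CSpace d) x).im = w j := by
    intro w
    rw [Finset.sum_eq_single j (fun i _ hi => by simp [hi]) (by simp)]
    simp
  rw [wirtinger, h3.fderiv, gaussTransform, e3, ← he]
  simp only [add_apply, smul_apply, applyTfShiftDeriv_apply,
    e1, e2, ContinuousLinearMap.comp_apply, neg_apply, smul_eq_mul, sum_apply, Complex.ofRealCLM_apply, Complex.reCLM_apply,
    ContinuousLinearMap.proj_apply, Complex.imCLM_apply, s1, s2, s3, s4]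
  push_cast
  ring_nf
  simp only [Complex.I_sq]
  ring

/-- The `k`-fold raising operator. -/
def raisingPow (k : Fin d → ℕ) (g : 𝓢(RSpace d, ℂ)) : 𝓢(RSpace d, ℂ) :=
  (List.finRange d).foldr (fun j H => (raising j)^[k j] H) g

theorem wirtingerPow_gaussTransform (f : 𝓢'(RSpace d, ℂ)) (g : 𝓢(RSpace d, ℂ)) (k : Fin d → ℕ) :
    wirtingerPow k (gaussTransform f g) = gaussTransform f (raisingPow k g) := by
  rw [wirtingerPow, raisingPow]
  have h1 : ∀ (j : Fin d) (n : ℕ) (g : 𝓢(RSpace d, ℂ)),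
      (wirtinger j)^[n] (gaussTransform f g) = gaussTransform f ((raising j)^[n] g) := by
    intro j n
    induction n with
    | zero => exact fun g => rfl
    | succ n ih =>
      intro g
      rw [Function.iterate_succ_apply, Function.iterate_succ_apply, wirtinger_gaussTransform, ih]
  induction List.finRange d with
  | nil => rfl
  | cons j l ih => rw [List.foldr_cons, List.foldr_cons, ih, h1]

theorem sq_norm_eq_sum (t : RSpace d) : ‖t‖ ^ 2 = ∑ j, t j ^ 2 := by
  rw [EuclideanSpace.norm_sq_eq]
  simp

theorem inner_eq_sum (s t : RSpace d) : inner ℝ s t = ∑ j, s j * t j := by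
  simp [PiLp.inner_apply, mul_comm]

/-- With z = a + ib, the exponent -π|t - a|² + 2πi b·t - πi a·b equals -π|t|² + 2π t·z - πz²/2 -
π|z|²/2. This identifies the Bargmann kernel with a shifted Gaussian. -/
theorem tfShift_gaussWindow (z : CSpace d) :
    tfShift z (gaussWindow d) = ((((2 : ℝ) ^ ((d : ℝ) / 4) : ℝ) : ℂ) *
      Complex.exp (-(Real.pi / 2 : ℂ) * ∑ j, z j ^ 2) *
        (Real.exp (-(Real.pi / 2 * sqNorm z)) : ℂ)) •
      gaussExp Real.pi Real.pi_pos (fun j => 2 * Real.pi * z j) := by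
  ext t
  change _ = (_ * _ * _) * gaussExp Real.pi Real.pi_pos (fun j => 2 * Real.pi * z j) t
  rw [tfShift_apply, gaussWindow_apply, gaussExp_apply, shiftPhase]
  push_cast
  have key : ∀ a b c e₁ e₂ e₃ : ℂ, a * b = e₁ * (e₂ * e₃) → a * (c * b) = c * e₁ * e₂ * e₃ := by
    intro a b c e₁ e₂ e₃ h
    linear_combination c * h
  apply key
  rw [← Complex.exp_add, ← Complex.exp_add, ← Complex.exp_add]
  congr 1
  have h1 : (‖t - reVec z‖ : ℂ) ^ 2 = ∑ j, ((t j : ℂ) - (z j).re) ^ 2 := by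
    exact_mod_cast sq_norm_eq_sum (t - reVec z)
  have h2 : (‖t‖ : ℂ) ^ 2 = ∑ j, (t j : ℂ) ^ 2 := by exact_mod_cast sq_norm_eq_sum t
  have h3 : (sqNorm z : ℂ) = ∑ j, (((z j).re : ℂ) ^ 2 + ((z j).im : ℂ) ^ 2) := by
    simp only [sqNorm, Complex.sq_norm, Complex.normSq_apply]
    push_cast
    exact Finset.sum_congr rfl fun j _ => by ring
  have h4 : ∑ j, z j ^ 2 = ∑ j, (((z j).re : ℂ) + (z j).im * Complex.I) ^ 2 :=
    Finset.sum_congr rfl fun j _ => by rw [Complex.re_add_im]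
  have h5 : ∑ j, (t j : ℂ) * (2 * Real.pi * z j) =
      ∑ j, (t j : ℂ) * (2 * Real.pi * (((z j).re : ℂ) + (z j).im * Complex.I)) :=
    Finset.sum_congr rfl fun j _ => by rw [Complex.re_add_im]
  rw [h1, h2, h3, h4, h5, inner_eq_sum, inner_eq_sum]
  push_cast
  simp only [Finset.mul_sum, Finset.sum_mul, ← Finset.sum_add_distrib, ← Finset.sum_sub_distrib,
    ← Finset.sum_neg_distrib]
  refine Finset.sum_congr rfl fun j _ => ?_
  simp only [imVec_apply, reVec_apply]
  ring_nf
  simp only [Complex.I_sq]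
  ring

theorem exp_mul_bargmann (f : 𝓢'(RSpace d, ℂ)) (z : CSpace d) :
    (Real.exp (-(Real.pi * sqNorm z)) : ℂ) * bargmann f z = gaussTransform f (gaussWindow d) z := by
  rw [gaussTransform, tfShift_gaussWindow, map_smul, bargmann, smul_eq_mul]
  have : (Real.exp (-(Real.pi * sqNorm z)) : ℂ) =
      (Real.exp (-(Real.pi / 2 * sqNorm z)) : ℂ) * (Real.exp (-(Real.pi / 2 * sqNorm z)) : ℂ) := by
    rw [← Complex.ofReal_mul, ← Real.exp_add]
    ring_nf
  rw [this]
  ring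

/-- The Hermite function `h_k`. -/
def hermiteFun (k : Fin d → ℕ) : 𝓢(RSpace d, ℂ) :=
  ((1 / Real.sqrt (∏ j, (Real.pi ^ k j * (k j).factorial)) : ℝ) : ℂ) • raisingPow k (gaussWindow d)

theorem bargmann_eq (f : 𝓢'(RSpace d, ℂ)) (z : CSpace d) :
    bargmann f z = (Real.exp (Real.pi / 2 * sqNorm z) : ℂ) * f (tfShift z (gaussWindow d)) := by
  have h1 := exp_mul_bargmann f z
  rw [gaussTransform] at h1
  have h2 : (Real.exp (-(Real.pi * sqNorm z)) : ℂ) ≠ 0 := by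
    exact_mod_cast (Real.exp_pos _).ne'
  refine mul_left_cancel₀ h2 (h1.trans ?_)
  rw [← mul_assoc, ← Complex.ofReal_mul, ← Real.exp_add]
  congr 3
  ring

/-- Each Wirtinger derivative raises the window, and the Gaussian weights combine to exp(π|z|²/2).
All later facts about B^k are facts about the short-time Fourier transform with window `hermiteFun
k`. -/
theorem polyBargmann_eq (k : Fin d → ℕ) (f : 𝓢'(RSpace d, ℂ)) (z : CSpace d) :
    polyBargmann k f z =
      (Real.exp (Real.pi / 2 * sqNorm z) : ℂ) * f (tfShift z (hermiteFun k)) := by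
  have h1 : (fun w => (Real.exp (-(Real.pi * sqNorm w)) : ℂ) * bargmann f w) =
      gaussTransform f (gaussWindow d) := funext fun w => exp_mul_bargmann f w
  rw [polyBargmann, h1, wirtingerPow_gaussTransform, hermiteFun, map_smul, map_smul, gaussTransform,
    smul_eq_mul]
  have : (Real.exp (Real.pi / 2 * sqNorm z) : ℂ) =
      (Real.exp (Real.pi * sqNorm z) : ℂ) * (Real.exp (-(Real.pi / 2 * sqNorm z)) : ℂ) := by
    rw [← Complex.ofReal_mul, ← Real.exp_add]
    ring_nf
  rw [this]
  ring

end Ladder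


/-! ### Hermite polynomials and Gaussian integrals on the line -/

section Hermite

open Polynomial

/-- Hermite polynomials, normalised by `H_{n+1} = π X H_n - H_n'`. -/
def hermitePoly : ℕ → ℂ[X]
  | 0 => 1
  | n + 1 => C (Real.pi : ℂ) * X * hermitePoly n - derivative (hermitePoly n)

/-- The lowering relation in this normalisation, obtained by differentiating the recursion and using
induction. -/
theorem derivative_hermitePoly_succ (n : ℕ) :
    derivative (hermitePoly (n + 1)) = C ((n + 1 : ℂ) * Real.pi) * hermitePoly n := by
  induction n with
  | zero => simp [hermitePoly]
  | succ n ih =>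
    rw [hermitePoly, derivative_sub, derivative_mul, ih, derivative_mul, derivative_C,
      derivative_mul, derivative_C, derivative_X]
    conv_rhs => rw [hermitePoly]
    simp only [map_mul, map_add, map_natCast, map_one, Nat.cast_add, Nat.cast_one]
    have e : hermitePoly (n + 1) = C (Real.pi : ℂ) * X * hermitePoly n -
      derivative (hermitePoly n) := rfl
    rw [e]
    ring

/-- The integral of a polynomial against `exp (-2π x² + 2π c x)`. -/
def gaussIntegral (c : ℂ) (p : ℂ[X]) : ℂ :=
  ∫ x : ℝ, p.eval (x : ℂ) * Complex.exp (-(2 * Real.pi : ℂ) * (x : ℂ) ^ 2 + 2 * Real.pi * c * x)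

theorem integrable_gaussIntegral (c : ℂ) (p : ℂ[X]) : Integrable fun x : ℝ =>
    p.eval (x : ℂ) * Complex.exp (-(2 * Real.pi : ℂ) * (x : ℂ) ^ 2 + 2 * Real.pi * c * x) := by
  have hmon : ∀ n : ℕ, Integrable fun x : ℝ =>
      (x : ℂ) ^ n * Complex.exp (-(2 * Real.pi : ℂ) * (x : ℂ) ^ 2 + 2 * Real.pi * c * x) := by
    intro n
    have h1 : Integrable fun x : ℝ => x ^ (n : ℝ) * Real.exp (-Real.pi * x ^ 2) :=
      integrable_rpow_mul_exp_neg_mul_sq Real.pi_pos (by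
        have : (0 : ℝ) ≤ n := n.cast_nonneg
        linarith)
    refine (h1.norm.mul_const (Real.exp (Real.pi * c.re ^ 2))).mono' (by fun_prop)
      (Filter.Eventually.of_forall fun x => ?_)
    have : (-(2 * Real.pi : ℂ) * (x : ℂ) ^ 2 + 2 * Real.pi * c * x).re =
        -(2 * Real.pi) * x ^ 2 + 2 * Real.pi * c.re * x := by
      simp [← Complex.ofReal_pow]
    rw [norm_mul, norm_pow, Complex.norm_real, Complex.norm_exp, norm_mul, Real.rpow_natCast,
      norm_pow, Real.norm_of_nonneg (Real.exp_pos _).le, this, mul_assoc (‖x‖ ^ n),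
      ← Real.exp_add]
    refine mul_le_mul_of_nonneg_left (Real.exp_le_exp.2 ?_) (by positivity)
    nlinarith [mul_nonneg Real.pi_pos.le (sq_nonneg (x - c.re))]
  simp only [Polynomial.eval_eq_sum_range, Finset.sum_mul]
  refine integrable_finsetSum _ fun n _ => ?_
  simpa only [mul_assoc] using (hmon n).const_mul (p.coeff n)

theorem gaussIntegral_add (c : ℂ) (p q : ℂ[X]) :
    gaussIntegral c (p + q) = gaussIntegral c p + gaussIntegral c q := by
  rw [gaussIntegral, gaussIntegral, gaussIntegral,
    ← integral_add (integrable_gaussIntegral c p) (integrable_gaussIntegral c q)]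
  simp only [eval_add, add_mul]

theorem gaussIntegral_C_mul (c r : ℂ) (p : ℂ[X]) :
    gaussIntegral c (C r * p) = r * gaussIntegral c p := by
  rw [gaussIntegral, gaussIntegral, ← integral_const_mul]
  simp only [eval_mul, eval_C, mul_assoc]

theorem gaussIntegral_sub (c : ℂ) (p q : ℂ[X]) :
    gaussIntegral c (p - q) = gaussIntegral c p - gaussIntegral c q := by
  have : p - q = p + C (-1) * q := by simp [sub_eq_add_neg]
  rw [this, gaussIntegral_add, gaussIntegral_C_mul]
  ring

/-- Integration by parts: the integral of the derivative of `p` times the exponential vanishes. -/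
theorem gaussIntegral_derivative (c : ℂ) (p : ℂ[X]) :
    gaussIntegral c (derivative p) =
      gaussIntegral c (C (4 * Real.pi : ℂ) * (X * p)) - 2 * Real.pi * c * gaussIntegral c p := by
  have h1 : gaussIntegral c (derivative p - (C (4 * Real.pi : ℂ) * (X * p) -
      C (2 * Real.pi * c) * p)) = 0 := by
    refine integral_eq_zero_of_hasDerivAt_of_integrable (f := fun x : ℝ =>
      p.eval (x : ℂ) * Complex.exp (-(2 * Real.pi : ℂ) * (x : ℂ) ^ 2 + 2 * Real.pi * c * x))
      (fun x => ?_) (integrable_gaussIntegral c _) (integrable_gaussIntegral c p)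
    have hp : HasDerivAt (fun x : ℝ => p.eval (x : ℂ)) ((derivative p).eval (x : ℂ)) x :=
      (p.hasDerivAt (x : ℂ)).comp_ofReal
    have he : HasDerivAt (fun x : ℝ => Complex.exp (-(2 * Real.pi : ℂ) * (x : ℂ) ^ 2 +
        2 * Real.pi * c * x)) (Complex.exp (-(2 * Real.pi : ℂ) * (x : ℂ) ^ 2 + 2 * Real.pi * c * x) *
          (-(2 * Real.pi : ℂ) * (2 * x) + 2 * Real.pi * c)) x := by
      have h2 : HasDerivAt (fun y : ℂ => -(2 * Real.pi : ℂ) * y ^ 2 + 2 * Real.pi * c * y)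
          (-(2 * Real.pi : ℂ) * (2 * x) + 2 * Real.pi * c) (x : ℂ) := by
        have := ((hasDerivAt_pow 2 (x : ℂ)).const_mul (-(2 * Real.pi : ℂ))).add
          ((hasDerivAt_id (x : ℂ)).const_mul (2 * Real.pi * c))
        simpa using! this
      exact h2.cexp.comp_ofReal
    refine (hp.mul he).congr_deriv ?_
    simp only [eval_sub, eval_mul, eval_C, eval_X]
    ring
  rw [gaussIntegral_sub, gaussIntegral_sub, gaussIntegral_C_mul c (2 * Real.pi * c)] at h1
  linear_combination h1

theorem gaussIntegral_one (c : ℂ) : gaussIntegral c 1 =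
    (((2 : ℝ) ^ (-(1 / 2) : ℝ) : ℝ) : ℂ) * Complex.exp (Real.pi / 2 * c ^ 2) := by
  have h := integral_cexp_quadratic (b := -(2 * Real.pi : ℂ)) (by simp [Real.pi_pos])
    (2 * Real.pi * c) 0
  have hpi : (Real.pi : ℂ) ≠ 0 := by exact_mod_cast Real.pi_ne_zero
  have h1 : (Real.pi / - -(2 * Real.pi) : ℂ) = ((2⁻¹ : ℝ) : ℂ) := by
    push_cast
    field_simp
  rw [gaussIntegral]
  simp only [eval_one, one_mul, add_zero] at h ⊢
  rw [h, h1]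
  congr 1
  · rw [show (1 / 2 : ℂ) = ((1 / 2 : ℝ) : ℂ) by push_cast; rfl, ← Complex.ofReal_cpow (by norm_num),
      Real.inv_rpow (by norm_num), Real.rpow_neg (by norm_num)]
  · congr 1
    field_simp
    ring

/-- The polynomial `H_n(2x)`. -/
def hermiteLeft (n : ℕ) : ℂ[X] := (hermitePoly n).comp (C 2 * X)

/-- The polynomial `H_n(2(x - a))`. -/
def hermiteRight (a : ℂ) (n : ℕ) : ℂ[X] := (hermitePoly n).comp (C 2 * X - C (2 * a))

theorem hermiteLeft_succ (n : ℕ) : hermiteLeft (n + 1) =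
    C (2 * Real.pi : ℂ) * (X * hermiteLeft n) - C (1 / 2) * derivative (hermiteLeft n) := by
  have h2 : (C (1 / 2 : ℂ)) * C 2 = 1 := by rw [← C_mul]; norm_num
  simp only [hermiteLeft, hermitePoly, sub_comp, mul_comp, C_comp, X_comp, derivative_comp,
    derivative_mul, derivative_C, derivative_X, zero_mul, zero_add, mul_one, C_mul]
  linear_combination (derivative (hermitePoly n)).comp (C 2 * X) * h2

theorem hermiteRight_succ (a : ℂ) (n : ℕ) : hermiteRight a (n + 1) =
    C (2 * Real.pi : ℂ) * (X * hermiteRight a n) - C (2 * Real.pi * a) * hermiteRight a n -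
      C (1 / 2) * derivative (hermiteRight a n) := by
  have h2 : (C (1 / 2 : ℂ)) * C 2 = 1 := by rw [← C_mul]; norm_num
  simp only [hermiteRight, hermitePoly, sub_comp, mul_comp, C_comp, X_comp, derivative_comp,
    derivative_mul, derivative_sub, derivative_C, derivative_X, zero_mul, zero_add, mul_one, C_mul]
  linear_combination (derivative (hermitePoly n)).comp (C 2 * X - C 2 * C a) * h2

/-- For `n = 0` the truncated index `n - 1` is harmless, because its coefficient vanishes. -/
theorem derivative_hermiteRight (a : ℂ) (n : ℕ) : derivative (hermiteRight a n) =
    C (2 * n * Real.pi : ℂ) * hermiteRight a (n - 1) := by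
  cases n with
  | zero => simp [hermiteRight, hermitePoly]
  | succ n =>
    rw [hermiteRight, derivative_comp, derivative_hermitePoly_succ]
    simp only [derivative_sub, derivative_mul, derivative_C, derivative_X, zero_mul, zero_add,
      mul_one, sub_zero, mul_comp, C_comp, Nat.add_sub_cancel, hermiteRight]
    rw [← mul_assoc, ← C_mul]
    congr 2
    push_cast
    ring

/-- The raising operator on the left factor is moved by parts: it lowers the right factor, and the
linear term of the exponent gives the summand with `c`. -/
theorem gaussIntegral_left_succ (a c : ℂ) (m n : ℕ) :
    gaussIntegral c (hermiteLeft (m + 1) * hermiteRight a n) =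
      n * Real.pi * gaussIntegral c (hermiteLeft m * hermiteRight a (n - 1)) +
        Real.pi * c * gaussIntegral c (hermiteLeft m * hermiteRight a n) := by
  have h1 := gaussIntegral_derivative c (hermiteLeft m * hermiteRight a n)
  rw [derivative_mul, gaussIntegral_add, derivative_hermiteRight,
    show hermiteLeft m * (C (2 * n * Real.pi : ℂ) * hermiteRight a (n - 1)) =
      C (2 * n * Real.pi : ℂ) * (hermiteLeft m * hermiteRight a (n - 1)) by ring,
    gaussIntegral_C_mul, gaussIntegral_C_mul] at h1
  have h2 : hermiteLeft (m + 1) * hermiteRight a n =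
      C (2 * Real.pi : ℂ) * (X * (hermiteLeft m * hermiteRight a n)) -
        C (1 / 2) * (derivative (hermiteLeft m) * hermiteRight a n) := by
    rw [hermiteLeft_succ]; ring
  rw [h2, gaussIntegral_sub, gaussIntegral_C_mul, gaussIntegral_C_mul]
  linear_combination (-1 / 2 : ℂ) * h1

theorem gaussIntegral_right (a c : ℂ) (n : ℕ) :
    gaussIntegral c (hermiteRight a n) = (Real.pi * (c - 2 * a)) ^ n * gaussIntegral c 1 := by
  induction n with
  | zero => simp [hermiteRight, hermitePoly]
  | succ n ih =>
    have h1 := gaussIntegral_derivative c (hermiteRight a n)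
    rw [gaussIntegral_C_mul] at h1
    rw [hermiteRight_succ, gaussIntegral_sub, gaussIntegral_sub, gaussIntegral_C_mul,
      gaussIntegral_C_mul, gaussIntegral_C_mul, h1, pow_succ']
    linear_combination (Real.pi * (c - 2 * a)) * ih

/-- The polynomial factor of the Gaussian integral of two Hermite polynomials. -/
def hermiteSum (c e : ℂ) (m n : ℕ) : ℂ :=
  ∑ j ∈ Finset.range (m + 1), (m.choose j : ℂ) * (n.descFactorial j : ℂ) * (Real.pi : ℂ) ^ j *
    (Real.pi * c) ^ (m - j) * (Real.pi * e) ^ (n - j)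

/-- Pascal's rule, with n^{\underline{j+1}} = n (n-1)^{\underline{j}} for the falling factorials. It
is the same recursion as in `gaussIntegral_left_succ`, hence the closed form. -/
theorem hermiteSum_succ (c e : ℂ) (m n : ℕ) : hermiteSum c e (m + 1) n =
    n * Real.pi * hermiteSum c e m (n - 1) + Real.pi * c * hermiteSum c e m n := by
  rw [hermiteSum, Finset.sum_range_succ']
  have h1 : ∀ j ∈ Finset.range (m + 1), ((m + 1).choose (j + 1) : ℂ) *
      (n.descFactorial (j + 1) : ℂ) * (Real.pi : ℂ) ^ (j + 1) *
      (Real.pi * c) ^ (m + 1 - (j + 1)) * (Real.pi * e) ^ (n - (j + 1)) =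
      n * Real.pi * ((m.choose j : ℂ) * ((n - 1).descFactorial j : ℂ) * (Real.pi : ℂ) ^ j *
        (Real.pi * c) ^ (m - j) * (Real.pi * e) ^ (n - 1 - j)) +
      (m.choose (j + 1) : ℂ) * (n.descFactorial (j + 1) : ℂ) * (Real.pi : ℂ) ^ (j + 1) *
        (Real.pi * c) ^ (m - j) * (Real.pi * e) ^ (n - (j + 1)) := by
    intro j _
    have e1 : (n.descFactorial (j + 1) : ℂ) = n * ((n - 1).descFactorial j : ℂ) := by
      cases n with
      | zero => simp
      | succ n => rw [Nat.succ_descFactorial_succ]; simp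
    have e2 : n - (j + 1) = n - 1 - j := by omega
    rw [Nat.choose_succ_succ, e1, e2, Nat.add_sub_add_right, pow_succ]
    push_cast
    ring
  rw [Finset.sum_congr rfl h1, Finset.sum_add_distrib, ← Finset.mul_sum, add_assoc]
  change n * Real.pi * hermiteSum c e m (n - 1) + _ = _
  congr 1
  conv_rhs => rw [hermiteSum, Finset.sum_range_succ' _ m, mul_add, Finset.mul_sum]
  rw [Finset.sum_range_succ]
  simp only [Nat.choose_succ_self, Nat.cast_zero, zero_mul, add_zero, Nat.choose_zero_right,
    Nat.cast_one, one_mul, Nat.descFactorial_zero, pow_zero, Nat.sub_zero]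
  congr 1
  · refine Finset.sum_congr rfl fun j hj => ?_
    rw [Finset.mem_range] at hj
    have : m - j = (m - (j + 1)) + 1 := by omega
    rw [this, pow_succ (Real.pi * c : ℂ)]
    ring
  · rw [pow_succ]
    ring

theorem gaussIntegral_hermite (a c : ℂ) (m n : ℕ) :
    gaussIntegral c (hermiteLeft m * hermiteRight a n) =
      hermiteSum c (c - 2 * a) m n * gaussIntegral c 1 := by
  induction m generalizing n with
  | zero =>
    have : hermiteLeft 0 = 1 := by simp [hermiteLeft, hermitePoly]
    rw [this, one_mul, gaussIntegral_right]
    simp [hermiteSum]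
  | succ m ih =>
    rw [gaussIntegral_left_succ, ih, ih, hermiteSum_succ]
    ring

theorem hermiteSum_zero_right (c e : ℂ) (m : ℕ) : hermiteSum c e m 0 = (Real.pi * c) ^ m := by
  rw [hermiteSum, Finset.sum_range_succ', Finset.sum_eq_zero fun j _ => by simp]
  simp

/-- Reversing the summation by j ↦ n - j matches the terms: n! = j! · `n.descFactorial (n - j)`, and
the powers of conj(s) and -s pair to (-|s|²)^j. -/
theorem hermiteSum_self (s : ℂ) (n : ℕ) :
    hermiteSum ((starRingEnd ℂ) s) (-s) n n =
      Real.pi ^ n * n.factorial * (laguerre n (Real.pi * ‖s‖ ^ 2) : ℝ) := by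
  rw [hermiteSum, laguerre, ← Finset.sum_range_reflect, Complex.ofReal_sum, Finset.mul_sum]
  refine Finset.sum_congr rfl fun j hj => ?_
  rw [Finset.mem_range] at hj
  have hj' : j ≤ n := by omega
  have e1 : n + 1 - 1 - j = n - j := by omega
  have e2 : n - (n - j) = j := by omega
  rw [e1, e2, Nat.choose_symm hj']
  have h1 : ((j.factorial : ℂ)) * (n.descFactorial (n - j) : ℂ) = n.factorial := by
    have := Nat.factorial_mul_descFactorial (Nat.sub_le n j)
    rw [e2] at this
    exact_mod_cast this
  have h2 : (j.factorial : ℂ) ≠ 0 := by exact_mod_cast j.factorial_ne_zero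
  have h3 : (Real.pi : ℂ) ^ n = Real.pi ^ (n - j) * Real.pi ^ j := by
    rw [← pow_add, Nat.sub_add_cancel hj']
  have h4 : (‖s‖ : ℂ) ^ 2 = (starRingEnd ℂ) s * s := by rw [mul_comm, Complex.mul_conj']
  push_cast
  rw [h4, ← h1, h3, mul_pow, mul_pow, mul_pow, mul_pow, neg_pow]
  field_simp

end Hermite


/-! ### Hermite functions -/

section HermiteFun

open Polynomial

variable {d : ℕ}

/-- The polynomial factor `∏ H_{m_i}(2 t_i)` of a Hermite function. -/
def hermiteProd (m : Fin d → ℕ) (t : RSpace d) : ℂ :=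
  ∏ i, (hermitePoly (m i)).eval (2 * (t i : ℂ))

theorem norm_add_smul_single_sq (t : RSpace d) (j : Fin d) (s : ℝ) :
    ‖t + s • EuclideanSpace.single j (1 : ℝ)‖ ^ 2 = ‖t‖ ^ 2 + (2 * s * t j + s ^ 2) := by
  rw [norm_add_sq_real, inner_smul_right, EuclideanSpace.inner_single_right, norm_smul]
  simp
  ring

theorem hermiteProd_add_smul_single (m : Fin d → ℕ) (t : RSpace d) (j : Fin d) (s : ℝ) :
    hermiteProd m (t + s • EuclideanSpace.single j (1 : ℝ)) =
      (hermitePoly (m j)).eval (2 * ((t j : ℂ) + s)) *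
        ∏ i ∈ Finset.univ.erase j, (hermitePoly (m i)).eval (2 * (t i : ℂ)) := by
  rw [hermiteProd, ← Finset.mul_prod_erase _ _ (Finset.mem_univ j)]
  congr 1
  · simp
  · refine Finset.prod_congr rfl fun i hi => ?_
    simp [(Finset.mem_erase.1 hi).1]

theorem raising_hermiteProd {g : 𝓢(RSpace d, ℂ)} {m : Fin d → ℕ}
    (hg : ∀ t, g t = hermiteProd m t * gaussWindow d t) (j : Fin d) (t : RSpace d) :
    raising j g t = hermiteProd (m + Pi.single j 1) t * gaussWindow d t := by
  have h1 : HasDerivAt (fun s : ℝ => g (t + s • EuclideanSpace.single j (1 : ℝ)))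
      (fderiv ℝ g t (EuclideanSpace.single j 1)) 0 := by
    have := (g.differentiableAt (x := t)).hasFDerivAt.hasLineDerivAt (EuclideanSpace.single j 1)
    exact this
  set P := hermitePoly (m j) with hP
  set R := ∏ i ∈ Finset.univ.erase j, (hermitePoly (m i)).eval (2 * (t i : ℂ)) with hR
  -- Along the line through `t` in direction `j` only the `j`th polynomial factor and a one-variable
  -- Gaussian vary; the rest is the constant `R * gaussWindow d t`.
  have h2 : (fun s : ℝ => g (t + s • EuclideanSpace.single j (1 : ℝ))) = fun s : ℝ =>
      R * gaussWindow d t * (P.eval (2 * ((t j : ℂ) + s)) *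
        Complex.exp (-(Real.pi : ℂ) * (2 * s * t j + (s : ℂ) ^ 2))) := by
    funext s
    rw [hg, hermiteProd_add_smul_single, gaussWindow_apply, gaussWindow_apply,
      norm_add_smul_single_sq, mul_add Real.pi, neg_add, Real.exp_add]
    push_cast
    rw [neg_mul]
    ring
  have h3 : HasDerivAt (fun s : ℝ => P.eval (2 * ((t j : ℂ) + s)) *
        Complex.exp (-(Real.pi : ℂ) * (2 * s * t j + (s : ℂ) ^ 2)))
      (2 * (derivative P).eval (2 * (t j : ℂ)) - 2 * Real.pi * t j * P.eval (2 * (t j : ℂ))) 0 := by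
    have e1 : HasDerivAt (fun s : ℂ => 2 * ((t j : ℂ) + s)) 2 ((0 : ℝ) : ℂ) := by
      simpa using ((hasDerivAt_id ((0 : ℝ) : ℂ)).const_add (t j : ℂ)).const_mul 2
    have e2 : HasDerivAt (fun s : ℂ => -(Real.pi : ℂ) * (2 * s * t j + s ^ 2))
        (-(Real.pi : ℂ) * (2 * t j)) ((0 : ℝ) : ℂ) := by
      have := ((((hasDerivAt_id ((0 : ℝ) : ℂ)).const_mul 2).mul_const (t j : ℂ)).add
        (hasDerivAt_pow 2 ((0 : ℝ) : ℂ))).const_mul (-(Real.pi : ℂ))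
      simpa using! this
    have e3 : HasDerivAt (fun s : ℂ => P.eval (2 * ((t j : ℂ) + s)))
        ((derivative P).eval (2 * ((t j : ℂ) + ((0 : ℝ) : ℂ))) * 2) ((0 : ℝ) : ℂ) :=
      HasDerivAt.comp (h := fun s : ℂ => 2 * ((t j : ℂ) + s)) ((0 : ℝ) : ℂ) (P.hasDerivAt _) e1
    refine (e3.comp_ofReal.mul e2.cexp.comp_ofReal).congr_deriv ?_
    simp
    ring
  rw [h2] at h1
  have h4 := h1.unique (h3.const_mul (R * gaussWindow d t))
  have h5 : hermiteProd m t = P.eval (2 * (t j : ℂ)) * R := by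
    rw [hermiteProd, ← Finset.mul_prod_erase _ _ (Finset.mem_univ j)]
  have h6 : hermiteProd (m + Pi.single j 1) t = (hermitePoly (m j + 1)).eval (2 * (t j : ℂ)) * R := by
    rw [hermiteProd, ← Finset.mul_prod_erase _ _ (Finset.mem_univ j)]
    congr 1
    · simp
    · refine Finset.prod_congr rfl fun i hi => ?_
      simp [(Finset.mem_erase.1 hi).1]
  rw [raising_apply, h4, h6, hg, h5, hermitePoly]
  simp only [eval_sub, eval_mul, eval_C, eval_X]
  ring

theorem raising_iterate_hermiteProd (j : Fin d) (n : ℕ) {g : 𝓢(RSpace d, ℂ)} {m : Fin d → ℕ}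
    (hg : ∀ t, g t = hermiteProd m t * gaussWindow d t) (t : RSpace d) :
    (raising j)^[n] g t = hermiteProd (m + Pi.single j n) t * gaussWindow d t := by
  induction n generalizing t with
  | zero => simp [hg]
  | succ n ih =>
    rw [Function.iterate_succ_apply', raising_hermiteProd ih, add_assoc, ← Pi.single_add]

theorem raisingPow_gaussWindow (k : Fin d → ℕ) (t : RSpace d) :
    raisingPow k (gaussWindow d) t = hermiteProd k t * gaussWindow d t := by
  have h1 : ∀ (l : List (Fin d)) (t : RSpace d),
      l.foldr (fun j H => (raising j)^[k j] H) (gaussWindow d) t =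
        hermiteProd ((l.map fun j => Pi.single j (k j)).sum) t * gaussWindow d t := by
    intro l
    induction l with
    | nil => intro t; simp [hermiteProd, hermitePoly]
    | cons j l ih =>
      intro t
      rw [List.foldr_cons, raising_iterate_hermiteProd j (k j) ih, List.map_cons, List.sum_cons,
        add_comm]
  rw [raisingPow, h1, ← Fin.sum_univ_def, Finset.univ_sum_single]

/-- The normalising constant of a Hermite function. -/
def hermiteConst (k : Fin d → ℕ) : ℝ :=
  1 / Real.sqrt (∏ j, (Real.pi ^ k j * (k j).factorial))

theorem hermiteFun_apply (k : Fin d → ℕ) (t : RSpace d) :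
    hermiteFun k t = hermiteConst k * (hermiteProd k t * gaussWindow d t) := by
  rw [← raisingPow_gaussWindow]
  rfl

/-- This makes the Gaussian window the case k = 0 of every formula for Hermite functions. -/
theorem hermiteFun_zero : hermiteFun (0 : Fin d → ℕ) = gaussWindow d := by
  ext t
  rw [hermiteFun_apply]
  simp [hermiteConst, hermiteProd, hermitePoly]

theorem conj_hermitePoly_eval (n : ℕ) (x : ℝ) :
    (starRingEnd ℂ) ((hermitePoly n).eval (x : ℂ)) = (hermitePoly n).eval (x : ℂ) := by
  have h : ∀ n, (hermitePoly n).map (starRingEnd ℂ) = hermitePoly n := by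
    intro n
    induction n with
    | zero => simp [hermitePoly]
    | succ n ih => simp [hermitePoly, Polynomial.map_sub, Polynomial.map_mul, ← derivative_map, ih]
  conv_rhs => rw [← h n]
  rw [eval_map, ← Complex.conj_ofReal x, eval₂_hom, Complex.conj_ofReal]

theorem integral_prod_coord (f : Fin d → ℝ → ℂ) :
    ∫ t : RSpace d, ∏ j, f j (t j) = ∏ j, ∫ x, f j x := by
  rw [← integral_fintype_prod_volume_eq_prod]
  exact (EuclideanSpace.volume_preserving_symm_measurableEquiv_toLp (Fin d)).integral_comp
    (MeasurableEquiv.toLp 2 (Fin d → ℝ)).symm.measurableEmbedding (fun t => ∏ j, f j (t j))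

/-- The integrand factors over the coordinates. In each one there is a Gaussian integral of two
Hermite polynomials with c = conj(z_j) and a = re(z_j), so that c - 2a = -z_j. -/
theorem coeff_hermiteFun (k l : Fin d → ℕ) (z : CSpace d) :
    coeff (hermiteFun l) (hermiteFun k) z = hermiteConst k * hermiteConst l *
      (∏ j, hermiteSum ((starRingEnd ℂ) (z j)) (-z j) (k j) (l j)) *
        Complex.exp (-(Real.pi / 2 * sqNorm z : ℝ)) := by
  have h1 : ∀ t : RSpace d, hermiteFun k t * (starRingEnd ℂ) (tfShift z (hermiteFun l) t) =
      hermiteConst k * hermiteConst l * ∏ j,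
        ((((2 : ℝ) ^ (1 / 2 : ℝ) : ℝ) : ℂ) *
            Complex.exp (-Real.pi * (z j).re ^ 2 + Real.pi * (z j).re * (z j).im * Complex.I) *
          ((hermiteLeft (k j) * hermiteRight (z j).re (l j)).eval (t j : ℂ) *
            Complex.exp (-(2 * Real.pi : ℂ) * (t j : ℂ) ^ 2 +
              2 * Real.pi * (starRingEnd ℂ) (z j) * (t j)))) := by
    intro t
    have e1 : (starRingEnd ℂ) (hermiteProd l (t - reVec z)) =
        ∏ j, (hermiteRight (z j).re (l j)).eval (t j : ℂ) := by
      rw [hermiteProd, map_prod]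
      refine Finset.prod_congr rfl fun j _ => ?_
      have : (2 * ((t - reVec z) j : ℂ)) = ((2 * (t j - (z j).re) : ℝ) : ℂ) := by simp
      rw [this, conj_hermitePoly_eval, hermiteRight]
      simp only [eval_comp, eval_sub, eval_mul, eval_C, eval_X]
      congr 1
      push_cast
      ring
    have e2 : hermiteProd k t = ∏ j, (hermiteLeft (k j)).eval (t j : ℂ) := by
      simp [hermiteProd, hermiteLeft, eval_comp]
    have e3 : gaussWindow d t * (starRingEnd ℂ)
        (Complex.exp ((shiftPhase z t : ℝ) * Complex.I) * gaussWindow d (t - reVec z)) =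
        ∏ j, ((((2 : ℝ) ^ (1 / 2 : ℝ) : ℝ) : ℂ) *
            Complex.exp (-Real.pi * (z j).re ^ 2 + Real.pi * (z j).re * (z j).im * Complex.I) *
            Complex.exp (-(2 * Real.pi : ℂ) * (t j : ℂ) ^ 2 +
              2 * Real.pi * (starRingEnd ℂ) (z j) * (t j))) := by
      rw [Finset.prod_mul_distrib, Finset.prod_mul_distrib, ← Complex.exp_sum, ← Complex.exp_sum,
        Finset.prod_const, Finset.card_univ, Fintype.card_fin, mul_assoc _ (Complex.exp _),
        ← Complex.exp_add, gaussWindow_apply, gaussWindow_apply, map_mul, Complex.conj_ofReal,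
        ← Complex.exp_conj]
      have c1 : ((2 : ℝ) ^ ((d : ℝ) / 4)) * (2 : ℝ) ^ ((d : ℝ) / 4) = ((2 : ℝ) ^ (1 / 2 : ℝ)) ^ d := by
        rw [← Real.rpow_natCast, ← Real.rpow_mul (by norm_num), ← Real.rpow_add (by norm_num)]
        congr 1
        ring
      rw [← Complex.ofReal_pow, ← c1]
      push_cast
      have c2 : ∀ A E1 E2 E3 : ℂ, A * E1 * (E2 * (A * E3)) = A * A * (E1 * E2 * E3) := by
        intros; ring
      rw [c2, ← Complex.exp_add, ← Complex.exp_add]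
      congr 2
      rw [← Complex.ofReal_pow, ← Complex.ofReal_pow, sq_norm_eq_sum, sq_norm_eq_sum, shiftPhase,
        inner_eq_sum, inner_eq_sum]
      simp only [map_mul, Complex.conj_I, Complex.conj_ofReal]
      push_cast
      simp only [Finset.mul_sum, Finset.sum_mul, ← Finset.sum_neg_distrib, ← Finset.sum_sub_distrib,
        ← Finset.sum_add_distrib]
      refine Finset.sum_congr rfl fun j _ => ?_
      have : (starRingEnd ℂ) (z j) = (z j).re - (z j).im * Complex.I := by
        apply Complex.ext <;> simp
      rw [this]
      simp
      ring
    have e4 : (starRingEnd ℂ) (hermiteConst l : ℂ) = hermiteConst l := Complex.conj_ofReal _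
    rw [tfShift_apply, hermiteFun_apply, hermiteFun_apply, map_mul, map_mul, map_mul, e1, e4, e2]
    rw [map_mul] at e3
    have c3 : ∀ a b G1 E G2 H1 H2 : ℂ, a * (H1 * G1) * (E * (b * (H2 * G2))) =
        a * b * (H1 * H2 * (G1 * (E * G2))) := by
      intros; ring
    rw [c3, e3, ← Finset.prod_mul_distrib, ← Finset.prod_mul_distrib]
    congr 1
    refine Finset.prod_congr rfl fun j _ => ?_
    rw [eval_mul]
    ring
  rw [coeff]
  simp only [h1]
  rw [integral_const_mul, integral_prod_coord (fun j x => ((((2 : ℝ) ^ (1 / 2 : ℝ) : ℝ) : ℂ) *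
            Complex.exp (-Real.pi * (z j).re ^ 2 + Real.pi * (z j).re * (z j).im * Complex.I) *
          ((hermiteLeft (k j) * hermiteRight (z j).re (l j)).eval (x : ℂ) *
            Complex.exp (-(2 * Real.pi : ℂ) * (x : ℂ) ^ 2 +
              2 * Real.pi * (starRingEnd ℂ) (z j) * x)))), mul_assoc (_ * _)]
  congr 1
  have h2 : Complex.exp (-(Real.pi / 2 * sqNorm z : ℝ)) =
      ∏ j, Complex.exp (-(Real.pi / 2 * ‖z j‖ ^ 2 : ℝ)) := by
    rw [← Complex.exp_sum, sqNorm, Finset.mul_sum, Complex.ofReal_sum, Finset.sum_neg_distrib]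
  rw [h2, ← Finset.prod_mul_distrib]
  refine Finset.prod_congr rfl fun j _ => ?_
  rw [integral_const_mul]
  change _ * gaussIntegral ((starRingEnd ℂ) (z j)) _ = _
  have h3 : (starRingEnd ℂ) (z j) - 2 * (z j).re = -z j := by
    apply Complex.ext <;> simp
    ring
  rw [gaussIntegral_hermite, h3, gaussIntegral_one]
  have h4 : (((2 : ℝ) ^ (1 / 2 : ℝ) : ℝ) : ℂ) * (((2 : ℝ) ^ (-(1 / 2) : ℝ) : ℝ) : ℂ) = 1 := by
    rw [← Complex.ofReal_mul, ← Real.rpow_add (by norm_num)]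
    norm_num
  -- The prefactor from the shifted window and the value of the Gaussian integral combine to a real
  -- Gaussian.
  have h5 : Complex.exp (-Real.pi * (z j).re ^ 2 + Real.pi * (z j).re * (z j).im * Complex.I) *
      Complex.exp (Real.pi / 2 * (starRingEnd ℂ) (z j) ^ 2) =
      Complex.exp (-(Real.pi / 2 * ‖z j‖ ^ 2 : ℝ)) := by
    rw [← Complex.exp_add]
    congr 1
    have : (starRingEnd ℂ) (z j) = (z j).re - (z j).im * Complex.I := by
      apply Complex.ext <;> simp
    rw [this, Complex.sq_norm, Complex.normSq_apply]
    push_cast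
    linear_combination (Real.pi / 2 * (z j).im ^ 2 : ℂ) * Complex.I_sq
  rw [← h5]
  linear_combination (Complex.exp (-Real.pi * (z j).re ^ 2 +
    Real.pi * (z j).re * (z j).im * Complex.I) *
    hermiteSum ((starRingEnd ℂ) (z j)) (-z j) (k j) (l j) *
      Complex.exp (Real.pi / 2 * (starRingEnd ℂ) (z j) ^ 2)) * h4

theorem hermiteConst_mul_self (k : Fin d → ℕ) :
    hermiteConst k * hermiteConst k * ∏ j, (Real.pi ^ k j * (k j).factorial) = 1 := by
  have h : 0 < ∏ j, (Real.pi ^ k j * (k j).factorial) :=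
    Finset.prod_pos fun j _ => by positivity
  rw [hermiteConst, div_mul_div_comm, Real.mul_self_sqrt h.le, one_mul, one_div,
    inv_mul_cancel₀ h.ne']

/-- The diagonal matrix coefficients of the Hermite functions are Laguerre functions. -/
theorem coeff_hermiteFun_self (k : Fin d → ℕ) (z : CSpace d) :
    coeff (hermiteFun k) (hermiteFun k) z =
      (∏ j, ((laguerre (k j) (Real.pi * ‖z j‖ ^ 2) : ℝ) : ℂ)) *
        Complex.exp (-(Real.pi / 2 * sqNorm z : ℝ)) := by
  rw [coeff_hermiteFun]
  simp only [hermiteSum_self]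
  rw [Finset.prod_mul_distrib]
  have := congrArg (fun x : ℝ => (x : ℂ)) (hermiteConst_mul_self k)
  push_cast at this ⊢
  linear_combination (∏ j, ((laguerre (k j) (Real.pi * ‖z j‖ ^ 2) : ℝ) : ℂ)) *
        Complex.exp (-(Real.pi / 2 * sqNorm z)) * this

/-- The matrix coefficients of a Hermite function against the Gaussian are monomials. -/
theorem coeff_gaussWindow_hermiteFun (k : Fin d → ℕ) (z : CSpace d) :
    coeff (gaussWindow d) (hermiteFun k) z =
      (Real.sqrt (∏ j, (Real.pi ^ k j / (k j).factorial)) : ℂ) *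
        (∏ j, (starRingEnd ℂ) (z j) ^ k j) * Complex.exp (-(Real.pi / 2 * sqNorm z : ℝ)) := by
  rw [← hermiteFun_zero, coeff_hermiteFun]
  simp only [Pi.zero_apply, hermiteSum_zero_right, mul_pow]
  rw [Finset.prod_mul_distrib]
  have h1 : hermiteConst (0 : Fin d → ℕ) = 1 := by simp [hermiteConst]
  have h2 : hermiteConst k * ∏ j, Real.pi ^ k j =
      Real.sqrt (∏ j, (Real.pi ^ k j / (k j).factorial)) := by
    have hp : 0 < ∏ j, Real.pi ^ k j := Finset.prod_pos fun j _ => by positivity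
    have hf : (0 : ℝ) < ∏ j, ((k j).factorial : ℝ) := Finset.prod_pos fun j _ => by positivity
    rw [hermiteConst, Finset.prod_mul_distrib, Finset.prod_div_distrib, Real.sqrt_mul hp.le,
      Real.sqrt_div hp.le]
    have := Real.mul_self_sqrt hp.le
    have hp' := Real.sqrt_pos.2 hp
    have hf' := Real.sqrt_pos.2 hf
    field_simp
    nlinarith
  rw [h1, ← h2]
  push_cast
  ring

/-- The diagonal coefficient at z = 0, since every Laguerre polynomial is 1 at 0. This is the
normalisation needed in the inversion formula. -/
theorem integral_sq_norm_hermiteFun (k : Fin d → ℕ) : ∫ s, ‖hermiteFun k s‖ ^ 2 = 1 := by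
  have h := coeff_hermiteFun_self k 0
  have h1 : ∀ n, laguerre n 0 = 1 := by
    intro n
    rw [laguerre, Finset.sum_range_succ', Finset.sum_eq_zero fun j _ => by simp]
    simp
  have h2 : ∀ t, hermiteFun k t * (starRingEnd ℂ) (tfShift 0 (hermiteFun k) t) =
      ((‖hermiteFun k t‖ ^ 2 : ℝ) : ℂ) := by
    intro t
    rw [tfShift_apply]
    simp [shiftPhase, Complex.mul_conj']
  rw [coeff] at h
  simp only [h2, integral_complex_ofReal] at h
  simp only [Pi.zero_apply, norm_zero, ne_eq, OfNat.ofNat_ne_zero, not_false_eq_true, zero_pow,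
    mul_zero, h1, sqNorm, Finset.sum_const_zero, neg_zero, Complex.exp_zero, Complex.ofReal_one,
    Complex.ofReal_zero, Finset.prod_const_one, mul_one] at h
  exact_mod_cast h

end HermiteFun


/-! ### Convolution with an integrable weight -/

section Weight

variable {d : ℕ}

/-- The integrable weight `(1 + |z|)^{-(2d+1)}` on `ℂ^d`. -/
def weight (z : CSpace d) : ℝ := ((1 + ‖z‖) ^ (2 * d + 1))⁻¹

theorem weight_nonneg (z : CSpace d) : 0 ≤ weight z := by
  unfold weight; positivity

theorem weight_le_one (z : CSpace d) : weight z ≤ 1 :=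
  inv_le_one_of_one_le₀ (one_le_pow₀ (by simp))

theorem continuous_weight : Continuous (weight (d := d)) :=
  Continuous.inv₀ (by fun_prop) fun z => by positivity

theorem weight_neg (z : CSpace d) : weight (-z) = weight z := by simp [weight]

theorem weight_sub_comm (z w : CSpace d) : weight (z - w) = weight (w - z) := by
  rw [← neg_sub, weight_neg]

theorem integrable_weight : Integrable (weight (d := d)) :=
  integrable_inv_one_add_norm_pow le_rfl

/-- The integral of `weight`. -/
def weightMass (d : ℕ) : ℝ≥0∞ := ∫⁻ w : CSpace d, ENNReal.ofReal (weight w)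

theorem weightMass_ne_top : weightMass d ≠ ∞ := by
  have := integrable_weight (d := d)
  exact ((hasFiniteIntegral_iff_ofReal (Filter.Eventually.of_forall weight_nonneg)).1
    this.hasFiniteIntegral).ne

theorem lintegral_weight_sub (z : CSpace d) :
    ∫⁻ w, ENNReal.ofReal (weight (z - w)) = weightMass d :=
  lintegral_sub_left_eq_self (fun w => ENNReal.ofReal (weight w)) z

theorem measurable_weight_sub (z : CSpace d) :
    Measurable fun w => ENNReal.ofReal (weight (z - w)) := by
  have := continuous_weight (d := d)
  exact (by fun_prop : Continuous fun w : CSpace d => weight (z - w)).measurable.ennreal_ofReal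

/-- The convolution of `|u|` with `weight`. -/
def weightConv (u : CSpace d → ℂ) (z : CSpace d) : ℝ≥0∞ :=
  ∫⁻ w, ENNReal.ofReal (weight (z - w)) * ‖u w‖ₑ

/-- Read as an L¹ norm for the finite measure weight(z - w) dw, the convolution is bounded by L^p
norms through the nesting of L^p spaces. -/
theorem weightConv_eq (u : CSpace d → ℂ) (z : CSpace d) :
    weightConv u z =
      eLpNorm u 1 (volume.withDensity fun w => ENNReal.ofReal (weight (z - w))) := by
  rw [eLpNorm_one_eq_lintegral_enorm, lintegral_withDensity_eq_lintegral_mul_non_measurable _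
    (measurable_weight_sub z) (Filter.Eventually.of_forall fun _ => ENNReal.ofReal_lt_top)]
  rfl

/-- Hölder's inequality on a finite measure. At p = ∞, `p.toReal` is 0 and division by zero makes
the exponent 1, as it should be. -/
theorem weightConv_le_eLpNorm {p : ℝ≥0∞} (hp : 1 ≤ p) {u : CSpace d → ℂ}
    (hu : AEStronglyMeasurable u) (z : CSpace d) :
    weightConv u z ≤
      eLpNorm u p (volume.withDensity fun w => ENNReal.ofReal (weight (z - w))) *
        weightMass d ^ (1 - 1 / p.toReal) := by
  rw [weightConv_eq]
  refine (eLpNorm_le_eLpNorm_mul_rpow_measure_univ hp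
    (hu.mono_ac (withDensity_absolutelyContinuous _ _))).trans (le_of_eq ?_)
  rw [withDensity_apply _ MeasurableSet.univ, Measure.restrict_univ, lintegral_weight_sub]
  simp

theorem one_sub_inv_toReal_nonneg {p : ℝ≥0∞} (hp : 1 ≤ p) : 0 ≤ 1 - 1 / p.toReal := by
  rcases eq_or_ne p ∞ with rfl | hp'
  · simp
  · have : 1 ≤ p.toReal := by
      rwa [← ENNReal.toReal_one, ENNReal.toReal_le_toReal ENNReal.one_ne_top hp']
    rw [sub_nonneg, one_div]
    exact inv_le_one_of_one_le₀ this

/-- Convolution with `weight` maps `L^p` to bounded functions. -/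
theorem exists_weightConv_le {p : ℝ≥0∞} (hp : 1 ≤ p) : ∃ C : ℝ≥0, ∀ u : CSpace d → ℂ,
    AEStronglyMeasurable u → ∀ z, weightConv u z ≤ C * eLpNorm u p := by
  refine ⟨(weightMass d ^ (1 - 1 / p.toReal)).toNNReal, fun u hu z => ?_⟩
  rw [ENNReal.coe_toNNReal (ENNReal.rpow_ne_top_of_nonneg (one_sub_inv_toReal_nonneg hp)
    weightMass_ne_top), mul_comm]
  refine (weightConv_le_eLpNorm hp hu z).trans (mul_le_mul_left ?_ _)
  refine eLpNorm_mono_measure u ?_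
  refine (withDensity_mono (g := 1) (Filter.Eventually.of_forall fun w => ?_)).trans_eq
    withDensity_one
  exact ENNReal.ofReal_le_one.2 (weight_le_one _)

theorem aemeasurable_weight_mul {u : CSpace d → ℂ} (hu : AEStronglyMeasurable u) (r : ℝ) :
    AEMeasurable (fun x : CSpace d × CSpace d =>
      ENNReal.ofReal (weight (x.1 - x.2)) * ‖u x.2‖ₑ ^ r) (volume.prod volume) := by
  have := continuous_weight (d := d)
  have h1 : Measurable fun x : CSpace d × CSpace d => ENNReal.ofReal (weight (x.1 - x.2)) :=
    (by fun_prop : Continuous fun x : CSpace d × CSpace d => weight (x.1 - x.2)).measurable.ennreal_ofReal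
  exact h1.aemeasurable.mul ((hu.enorm.pow_const r).comp_quasiMeasurePreserving
    Measure.quasiMeasurePreserving_snd)

/-- Young's inequality for convolution with `weight`. -/
theorem exists_eLpNorm_weightConv_le {p : ℝ≥0∞} (hp : 1 ≤ p) : ∃ C : ℝ≥0, ∀ u : CSpace d → ℂ,
    AEStronglyMeasurable u → eLpNorm (weightConv u) p ≤ C * eLpNorm u p := by
  rcases eq_or_ne p ∞ with rfl | hp'
  · obtain ⟨C, hC⟩ := exists_weightConv_le (d := d) hp
    refine ⟨C, fun u hu => ?_⟩
    rw [eLpNorm_exponent_top]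
    exact essSup_le_of_ae_le _ (Filter.Eventually.of_forall fun z => hC u hu z)
  · have hr : 1 ≤ p.toReal := by
      rwa [← ENNReal.toReal_one, ENNReal.toReal_le_toReal ENNReal.one_ne_top hp']
    have hr0 : 0 < p.toReal := by linarith
    have hp0 : p ≠ 0 := fun h => by simp [h] at hp
    set r := p.toReal
    refine ⟨(weightMass d).toNNReal, fun u hu => ?_⟩
    rw [ENNReal.coe_toNNReal weightMass_ne_top]
    -- Hölder contributes `r - 1` powers of the mass; integrating over `z` by Tonelli contributes
    -- the last one.
    have h1 : ∀ z, weightConv u z ^ r ≤ weightMass d ^ (r - 1) *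
        ∫⁻ w, ENNReal.ofReal (weight (z - w)) * ‖u w‖ₑ ^ r := by
      intro z
      refine (ENNReal.rpow_le_rpow (weightConv_le_eLpNorm hp hu z) hr0.le).trans (le_of_eq ?_)
      rw [eLpNorm_eq_lintegral_rpow_enorm_toReal hp0 hp', ENNReal.mul_rpow_of_nonneg _ _ hr0.le,
        ← ENNReal.rpow_mul, ← ENNReal.rpow_mul, one_div_mul_cancel hr0.ne', ENNReal.rpow_one,
        mul_comm, sub_mul, one_mul, one_div_mul_cancel hr0.ne',
        lintegral_withDensity_eq_lintegral_mul_non_measurable _ (measurable_weight_sub z)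
          (Filter.Eventually.of_forall fun _ => ENNReal.ofReal_lt_top)]
      rfl
    have h2 : ∫⁻ z, weightConv u z ^ r ≤ weightMass d ^ r * ∫⁻ w, ‖u w‖ₑ ^ r := by
      refine (lintegral_mono h1).trans ?_
      rw [lintegral_const_mul' _ _ (ENNReal.rpow_ne_top_of_nonneg (by linarith) weightMass_ne_top),
        lintegral_lintegral_swap (aemeasurable_weight_mul hu r)]
      have h3 : ∀ w, ∫⁻ z, ENNReal.ofReal (weight (z - w)) * ‖u w‖ₑ ^ r =
          weightMass d * ‖u w‖ₑ ^ r := by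
        intro w
        simp only [weight_sub_comm _ w]
        rw [lintegral_mul_const _ (measurable_weight_sub w), lintegral_weight_sub]
      simp only [h3]
      rw [lintegral_const_mul' _ _ weightMass_ne_top, ← mul_assoc]
      refine mul_le_mul_left (le_of_eq ?_) _
      -- Adding exponents in `ℝ≥0∞` requires a nonzero finite base, so mass zero is treated apart.
      rcases eq_or_ne (weightMass d) 0 with h0 | h0
      · rw [h0, mul_zero, ENNReal.zero_rpow_of_pos hr0]
      · conv_lhs => rw [← ENNReal.rpow_one (weightMass d), ← ENNReal.rpow_mul]
        rw [← ENNReal.rpow_add _ _ h0 weightMass_ne_top]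
        ring_nf
    rw [eLpNorm_eq_lintegral_rpow_enorm_toReal hp0 hp', eLpNorm_eq_lintegral_rpow_enorm_toReal hp0 hp']
    refine (ENNReal.rpow_le_rpow h2 (by positivity)).trans (le_of_eq ?_)
    rw [ENNReal.mul_rpow_of_nonneg _ _ (by positivity), ← ENNReal.rpow_mul,
      mul_one_div_cancel hr0.ne', ENNReal.rpow_one]

theorem memLp_of_integrable_of_bounded {p : ℝ≥0∞} (hp : 1 ≤ p) {u : CSpace d → ℂ}
    (hu : MemLp u 1) {C : ℝ≥0} (hC : ∀ z, ‖u z‖ₑ ≤ C) : MemLp u p := by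
  refine ⟨hu.1, ?_⟩
  rcases eq_or_ne p ∞ with rfl | hp'
  · rw [eLpNorm_exponent_top]
    exact (essSup_le_of_ae_le _ (Filter.Eventually.of_forall hC)).trans_lt ENNReal.coe_lt_top
  · have hr : 1 ≤ p.toReal := by
      rwa [← ENNReal.toReal_one, ENNReal.toReal_le_toReal ENNReal.one_ne_top hp']
    have hp0 : p ≠ 0 := fun h => by simp [h] at hp
    rw [eLpNorm_lt_top_iff_lintegral_rpow_enorm_lt_top hp0 hp']
    have h1 : ∀ z, ‖u z‖ₑ ^ p.toReal ≤ (C : ℝ≥0∞) ^ (p.toReal - 1) * ‖u z‖ₑ := by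
      intro z
      conv_lhs => rw [show p.toReal = (p.toReal - 1) + 1 by ring]
      rw [ENNReal.rpow_add_of_nonneg _ _ (by linarith) zero_le_one, ENNReal.rpow_one]
      gcongr
      exact hC z
    refine (lintegral_mono h1).trans_lt ?_
    have hfin : (C : ℝ≥0∞) ^ (p.toReal - 1) ≠ ∞ :=
      ENNReal.rpow_ne_top_of_nonneg (by linarith) ENNReal.coe_ne_top
    rw [lintegral_const_mul' _ _ hfin, ← eLpNorm_one_eq_lintegral_enorm]
    exact ENNReal.mul_lt_top hfin.lt_top hu.2

theorem memLp_weight {p : ℝ≥0∞} (hp : 1 ≤ p) : MemLp (fun z : CSpace d => (weight z : ℂ)) p := by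
  refine memLp_of_integrable_of_bounded hp
    (memLp_one_iff_integrable.2 integrable_weight.ofReal) (C := 1) fun z => ?_
  rw [← ofReal_norm, Complex.norm_real, Real.norm_of_nonneg (weight_nonneg z)]
  exact ENNReal.ofReal_le_one.2 (weight_le_one z)

end Weight


/-! ### Modulation spaces -/

section Modulation

variable {d : ℕ}

/-- The short-time Fourier transform `z ↦ f(ρ(z)h)` of a tempered distribution. -/
def distCoeff (h : 𝓢(RSpace d, ℂ)) (f : 𝓢'(RSpace d, ℂ)) (z : CSpace d) : ℂ := f (tfShift z h)

theorem continuous_distCoeff (h : 𝓢(RSpace d, ℂ)) (f : 𝓢'(RSpace d, ℂ)) :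
    Continuous (distCoeff h f) :=
  (map_continuous f).comp (continuous_tfShift h)

theorem distCoeff_add (h : 𝓢(RSpace d, ℂ)) (f g : 𝓢'(RSpace d, ℂ)) :
    distCoeff h (f + g) = distCoeff h f + distCoeff h g := rfl

theorem distCoeff_smul (h : 𝓢(RSpace d, ℂ)) (c : ℂ) (f : 𝓢'(RSpace d, ℂ)) :
    distCoeff h (c • f) = c • distCoeff h f := rfl

/-- Composing two shifts gives a shift up to a phase, the symplectic form of `z` and `w`. In modulus
the coefficient depends only on w - z, which produces convolution kernels. -/
theorem coeff_tfShift (h g : 𝓢(RSpace d, ℂ)) (z w : CSpace d) :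
    coeff h (tfShift z g) w =
      Complex.exp ((Real.pi * (inner ℝ (reVec w) (imVec z) - inner ℝ (reVec z) (imVec w)) : ℝ) *
        Complex.I) * coeff h g (w - z) := by
  rw [coeff, coeff, ← integral_const_mul,
    ← integral_add_right_eq_self (fun t => tfShift z g t * (starRingEnd ℂ) (tfShift w h t)) (reVec z)]
  refine integral_congr_ae (Filter.Eventually.of_forall fun t => ?_)
  have e1 : t + reVec z - reVec w = t - reVec (w - z) := by rw [map_sub]; abel
  simp only [tfShift_apply, add_sub_cancel_right, e1, map_mul, ← Complex.exp_conj, Complex.conj_I,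
    Complex.conj_ofReal]
  have e2 : Complex.exp (((shiftPhase z (t + reVec z) : ℝ) : ℂ) * Complex.I) *
      Complex.exp (((shiftPhase w (t + reVec z) : ℝ) : ℂ) * -Complex.I) =
      Complex.exp ((Real.pi * (inner ℝ (reVec w) (imVec z) - inner ℝ (reVec z) (imVec w)) : ℝ) *
        Complex.I) * Complex.exp (((shiftPhase (w - z) t : ℝ) : ℂ) * -Complex.I) := by
    rw [← Complex.exp_add, ← Complex.exp_add]
    congr 1
    simp only [shiftPhase, map_sub, inner_add_right, inner_sub_left, inner_sub_right]
    rw [real_inner_comm (reVec z) (imVec z), real_inner_comm (reVec z) (imVec w)]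
    push_cast
    ring
  linear_combination (g t * (starRingEnd ℂ) (h (t - reVec (w - z)))) * e2

theorem exists_norm_coeff_le_weight (h : 𝓢(RSpace d, ℂ)) : ∃ (N : ℕ) (C : ℝ≥0),
    ∀ g z, ‖coeff h g z‖ ≤ C * schwartzNorm N g * weight z := by
  obtain ⟨N, C, hC, hb⟩ := exists_coeff_decay h (2 * d + 1)
  refine ⟨N, ⟨C, hC⟩, fun g z => ?_⟩
  have hp : 0 < (1 + ‖z‖) ^ (2 * d + 1) := by positivity
  rw [weight, ← div_eq_mul_inv, le_div_iff₀ hp, mul_comm]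
  exact hb g z

theorem exists_norm_coeff_tfShift_le_weight (h g : 𝓢(RSpace d, ℂ)) : ∃ C : ℝ≥0,
    ∀ z w, ‖coeff h (tfShift z g) w‖ ≤ C * weight (z - w) := by
  obtain ⟨N, C, hb⟩ := exists_norm_coeff_le_weight h
  refine ⟨C * (schwartzNorm N g).toNNReal, fun z w => ?_⟩
  rw [NNReal.coe_mul, Real.coe_toNNReal _ (apply_nonneg _ _), coeff_tfShift, norm_mul, Complex.norm_exp_ofReal_mul_I, one_mul, weight_sub_comm]
  exact hb g _

theorem enorm_integral_mul_le {k u : CSpace d → ℂ} {z : CSpace d} {C : ℝ≥0}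
    (hk : ∀ w, ‖k w‖ ≤ C * weight (z - w)) : ‖∫ w, k w * u w‖ₑ ≤ C * weightConv u z := by
  refine (enorm_integral_le_lintegral_enorm _).trans ?_
  rw [weightConv, ← lintegral_const_mul' _ _ ENNReal.coe_ne_top]
  refine lintegral_mono fun w => ?_
  rw [enorm_mul, ← mul_assoc]
  gcongr
  rw [← ofReal_norm, ← ENNReal.ofReal_coe_nnreal, ← ENNReal.ofReal_mul C.coe_nonneg]
  exact ENNReal.ofReal_le_ofReal (hk w)

/-- Change of window: inserting the inversion formula for `h` into f(ρ(z)g) gives an integral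
operator whose kernel decays in z - w. -/
theorem exists_enorm_distCoeff_le_weightConv {h : 𝓢(RSpace d, ℂ)} (hh : ∫ s, ‖h s‖ ^ 2 = 1)
    (g : 𝓢(RSpace d, ℂ)) : ∃ C : ℝ≥0, ∀ f z,
      ‖distCoeff g f z‖ₑ ≤ C * weightConv (distCoeff h f) z := by
  obtain ⟨C, hC⟩ := exists_norm_coeff_tfShift_le_weight h g
  refine ⟨C, fun f z => ?_⟩
  rw [distCoeff, (distribution_eq_integral hh f (tfShift z g)).2]
  exact enorm_integral_mul_le (u := distCoeff h f) (hC z)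

theorem exists_eLpNorm_distCoeff_le {p : ℝ≥0∞} (hp : 1 ≤ p) {h : 𝓢(RSpace d, ℂ)}
    (hh : ∫ s, ‖h s‖ ^ 2 = 1) (g : 𝓢(RSpace d, ℂ)) : ∃ C : ℝ≥0, ∀ f : 𝓢'(RSpace d, ℂ),
      eLpNorm (distCoeff g f) p ≤ C * eLpNorm (distCoeff h f) p := by
  obtain ⟨C, hC⟩ := exists_enorm_distCoeff_le_weightConv hh g
  obtain ⟨C', hC'⟩ := exists_eLpNorm_weightConv_le (d := d) hp
  refine ⟨C * C', fun f => ?_⟩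
  refine (eLpNorm_le_nnreal_smul_eLpNorm_of_ae_le_mul' (g := weightConv (distCoeff h f))
    (Filter.Eventually.of_forall fun z => hC f z) p).trans ?_
  rw [ENNReal.smul_def, smul_eq_mul, ENNReal.coe_mul, mul_assoc]
  gcongr
  exact hC' _ (continuous_distCoeff h f).aestronglyMeasurable

/-- The continuous embedding of M^p in the tempered distributions: pair the coefficients of `g`,
dominated by `weight`, with those of `f`. -/
theorem exists_enorm_apply_le {p : ℝ≥0∞} (hp : 1 ≤ p) {h : 𝓢(RSpace d, ℂ)}
    (hh : ∫ s, ‖h s‖ ^ 2 = 1) : ∃ (N : ℕ) (C : ℝ≥0), ∀ (f : 𝓢'(RSpace d, ℂ)) (g : 𝓢(RSpace d, ℂ)),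
      ‖f g‖ₑ ≤ C * ENNReal.ofReal (schwartzNorm N g) * eLpNorm (distCoeff h f) p := by
  obtain ⟨N, C, hb⟩ := exists_norm_coeff_le_weight h
  obtain ⟨C', hC'⟩ := exists_weightConv_le (d := d) hp
  refine ⟨N, C * C', fun f g => ?_⟩
  rw [(distribution_eq_integral hh f g).2]
  refine (enorm_integral_mul_le (u := distCoeff h f) (z := 0)
    (C := C * (schwartzNorm N g).toNNReal) fun w => ?_).trans ?_
  · rw [NNReal.coe_mul, Real.coe_toNNReal _ (apply_nonneg _ _), zero_sub, weight_neg]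
    exact hb g w
  · rw [ENNReal.coe_mul, ENNReal.coe_mul, mul_assoc, mul_assoc, mul_assoc,
      mul_left_comm (C' : ℝ≥0∞)]
    change C * (ENNReal.ofReal (schwartzNorm N g) * _) ≤ _
    gcongr
    exact hC' _ (continuous_distCoeff h f).aestronglyMeasurable _

theorem distCoeff_schwartz (h g : 𝓢(RSpace d, ℂ)) (z : CSpace d) :
    distCoeff h (g : 𝓢'(RSpace d, ℂ)) z = (starRingEnd ℂ) (coeff h (conjSchwartz g) z) := by
  rw [distCoeff, schwartz_coe_apply, coeff, ← integral_conj]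
  refine integral_congr_ae (Filter.Eventually.of_forall fun t => ?_)
  simp [conjSchwartz_apply, mul_comm]

theorem distCoeff_conj_tfShift (h g : 𝓢(RSpace d, ℂ)) (z w : CSpace d) :
    distCoeff h (conjSchwartz (tfShift w g) : 𝓢'(RSpace d, ℂ)) z = coeff g (tfShift z h) w := by
  rw [distCoeff, schwartz_coe_apply, coeff]
  rfl

theorem exists_eLpNorm_distCoeff_schwartz_le {p : ℝ≥0∞} (hp : 1 ≤ p) (h : 𝓢(RSpace d, ℂ)) :
    ∃ (N : ℕ) (C : ℝ≥0), ∀ g : 𝓢(RSpace d, ℂ),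
      eLpNorm (distCoeff h (g : 𝓢'(RSpace d, ℂ))) p ≤ C * ENNReal.ofReal (schwartzNorm N g) := by
  obtain ⟨N, C, hb⟩ := exists_norm_coeff_le_weight h
  obtain ⟨N', C', hC', hc⟩ := exists_schwartzNorm_conj_le (d := d) N
  refine ⟨N', C * C'.toNNReal * (eLpNorm (fun z : CSpace d => (weight z : ℂ)) p).toNNReal,
    fun g => ?_⟩
  have h1 : ∀ z, ‖distCoeff h (g : 𝓢'(RSpace d, ℂ)) z‖₊ ≤
      (C * C'.toNNReal * (schwartzNorm N' g).toNNReal) * ‖(weight z : ℂ)‖₊ := by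
    intro z
    rw [← NNReal.coe_le_coe]
    push_cast
    rw [distCoeff_schwartz, RCLike.norm_conj, Complex.norm_real,
      Real.norm_of_nonneg (weight_nonneg z), Real.coe_toNNReal _ hC',
      Real.coe_toNNReal _ (apply_nonneg _ _)]
    refine (hb _ z).trans ?_
    rw [mul_assoc (C : ℝ) C']
    have := weight_nonneg z
    gcongr
    exact hc g
  refine (eLpNorm_le_nnreal_smul_eLpNorm_of_ae_le_mul (Filter.Eventually.of_forall h1) p).trans ?_
  rw [ENNReal.smul_def, smul_eq_mul, ENNReal.coe_mul, ENNReal.coe_mul (_ * _) (ENNReal.toNNReal _),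
    ENNReal.coe_toNNReal (memLp_weight hp).2.ne]
  refine le_of_eq ?_
  change _ * ENNReal.ofReal (schwartzNorm N' g) * _ = _
  ring

/-- The dominating function is a translate of `weight`, whose norm does not depend on `w`. The
uniformity in `w` provides the dominating function in `operator_apply_eq_integral`. -/
theorem exists_eLpNorm_distCoeff_conj_tfShift_le {p : ℝ≥0∞} (hp : 1 ≤ p) (h g : 𝓢(RSpace d, ℂ)) :
    ∃ C : ℝ≥0, ∀ w,
      eLpNorm (distCoeff h (conjSchwartz (tfShift w g) : 𝓢'(RSpace d, ℂ))) p ≤ C := by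
  obtain ⟨C, hb⟩ := exists_norm_coeff_tfShift_le_weight g h
  refine ⟨C * (eLpNorm (fun z : CSpace d => (weight z : ℂ)) p).toNNReal, fun w => ?_⟩
  have h1 : ∀ z, ‖distCoeff h (conjSchwartz (tfShift w g) : 𝓢'(RSpace d, ℂ)) z‖₊ ≤
      C * ‖(weight (z - w) : ℂ)‖₊ := by
    intro z
    rw [← NNReal.coe_le_coe]
    push_cast
    rw [distCoeff_conj_tfShift, Complex.norm_real, Real.norm_of_nonneg (weight_nonneg _)]
    exact hb z w
  refine (eLpNorm_le_nnreal_smul_eLpNorm_of_ae_le_mul (Filter.Eventually.of_forall h1) p).trans ?_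
  have h2 : eLpNorm (fun z : CSpace d => (weight (z - w) : ℂ)) p =
      eLpNorm (fun z : CSpace d => (weight z : ℂ)) p :=
    eLpNorm_comp_measurePreserving (g := fun z : CSpace d => (weight z : ℂ))
      (memLp_weight hp).1 (measurePreserving_sub_right volume w)
  rw [h2, ENNReal.smul_def, smul_eq_mul, ENNReal.coe_mul,
    ENNReal.coe_toNNReal (memLp_weight hp).2.ne]

/-- The point `x + i y` of `ℂ^d`. -/
def ofReIm (x y : RSpace d) : CSpace d := fun j => ⟨x j, y j⟩

@[simp] theorem reVec_ofReIm (x y : RSpace d) : reVec (ofReIm x y) = x := by ext j; rfl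
@[simp] theorem imVec_ofReIm (x y : RSpace d) : imVec (ofReIm x y) = y := by ext j; rfl
@[simp] theorem ofReIm_reVec_imVec (z : CSpace d) : ofReIm (reVec z) (imVec z) = z := rfl

theorem continuous_ofReIm : Continuous fun q : RSpace d × RSpace d => ofReIm q.1 q.2 := by
  have : (fun q : RSpace d × RSpace d => ofReIm q.1 q.2) =
      fun q j => (q.1 j : ℂ) + (q.2 j : ℂ) * Complex.I := by
    funext q j
    exact Complex.mk_eq_add_mul_I _ _
  rw [this]
  fun_prop

/-- The window enters conjugated, hence the sign change in the frequency; the phase is unimodular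
and disappears in norms. -/
theorem stft_eq (f : 𝓢'(RSpace d, ℂ)) (q : RSpace d × RSpace d) :
    stft f q = Complex.exp ((-(Real.pi * inner ℝ q.1 q.2) : ℝ) * Complex.I) *
      distCoeff (gaussWindow d) f (ofReIm q.1 (-q.2)) := by
  rw [stft, distCoeff, ← smul_eq_mul, ← map_smul]
  congr 1
  ext t
  rw [shiftedWindow_apply, smul_apply, smul_eq_mul, tfShift_apply, reVec_ofReIm,
    gaussWindow_apply, ← mul_assoc, ← Complex.exp_add, map_mul, Complex.conj_ofReal,
    ← Complex.exp_conj, map_mul, Complex.conj_ofReal, Complex.conj_I, shiftPhase, reVec_ofReIm,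
    imVec_ofReIm, inner_neg_left, inner_neg_right]
  congr 2
  push_cast
  ring

theorem continuous_stft (f : 𝓢'(RSpace d, ℂ)) : Continuous (stft f) := by
  have h1 := (continuous_distCoeff (gaussWindow d) f).comp
    (continuous_ofReIm.comp (continuous_fst.prodMk continuous_snd.neg) :
      Continuous fun q : RSpace d × RSpace d => ofReIm q.1 (-q.2))
  have h2 : Continuous fun q : RSpace d × RSpace d =>
      Complex.exp ((-(Real.pi * inner ℝ q.1 q.2) : ℝ) * Complex.I) := by fun_prop
  have : stft f = fun q => Complex.exp ((-(Real.pi * inner ℝ q.1 q.2) : ℝ) * Complex.I) *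
      distCoeff (gaussWindow d) f (ofReIm q.1 (-q.2)) := funext (stft_eq f)
  rw [this]
  exact h2.mul h1

theorem modulationNorm_eq (p : ℝ≥0∞) (f : 𝓢'(RSpace d, ℂ)) :
    modulationNorm p f = eLpNorm (distCoeff (gaussWindow d) f) p := by
  have hm : MeasurePreserving (fun z : CSpace d => (reVec z, -imVec z)) volume
      (volume.prod volume) :=
    ((MeasurePreserving.id volume).prod (Measure.measurePreserving_neg volume)).comp
      measurePreserving_reVec_imVec
  have h1 := eLpNorm_comp_measurePreserving (p := p) (g := stft f)
    (continuous_stft f).aestronglyMeasurable hm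
  rw [modulationNorm]
  refine h1.symm.trans (eLpNorm_congr_norm_ae (Filter.Eventually.of_forall fun z => ?_))
  simp only [Function.comp_apply, stft_eq, neg_neg, ofReIm_reVec_imVec, norm_mul,
    Complex.norm_exp_ofReal_mul_I, one_mul]

theorem mem_modulationSpace_iff {p : ℝ≥0∞} {f : 𝓢'(RSpace d, ℂ)} :
    f ∈ modulationSpace d p ↔ modulationNorm p f < ∞ :=
  ⟨fun h => h.2, fun h => ⟨(continuous_stft f).aestronglyMeasurable, h⟩⟩

theorem integral_sq_norm_gaussWindow : ∫ s, ‖gaussWindow d s‖ ^ 2 = 1 := by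
  rw [← hermiteFun_zero]
  exact integral_sq_norm_hermiteFun 0

theorem exists_eLpNorm_distCoeff_le_modulationNorm {p : ℝ≥0∞} (hp : 1 ≤ p) (g : 𝓢(RSpace d, ℂ)) :
    ∃ C : ℝ≥0, ∀ f : 𝓢'(RSpace d, ℂ), eLpNorm (distCoeff g f) p ≤ C * modulationNorm p f := by
  simp only [modulationNorm_eq]
  exact exists_eLpNorm_distCoeff_le hp integral_sq_norm_gaussWindow g

theorem exists_modulationNorm_le {p : ℝ≥0∞} (hp : 1 ≤ p) {h : 𝓢(RSpace d, ℂ)}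
    (hh : ∫ s, ‖h s‖ ^ 2 = 1) : ∃ C : ℝ≥0, ∀ f : 𝓢'(RSpace d, ℂ),
      modulationNorm p f ≤ C * eLpNorm (distCoeff h f) p := by
  simp only [modulationNorm_eq]
  exact exists_eLpNorm_distCoeff_le hp hh _

theorem memLp_distCoeff {p : ℝ≥0∞} (hp : 1 ≤ p) (g : 𝓢(RSpace d, ℂ)) {f : 𝓢'(RSpace d, ℂ)}
    (hf : f ∈ modulationSpace d p) : MemLp (distCoeff g f) p := by
  obtain ⟨C, hC⟩ := exists_eLpNorm_distCoeff_le_modulationNorm hp g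
  exact ⟨(continuous_distCoeff g f).aestronglyMeasurable,
    (hC f).trans_lt (ENNReal.mul_lt_top ENNReal.coe_lt_top (mem_modulationSpace_iff.1 hf))⟩

theorem exists_enorm_apply_le_modulationNorm {p : ℝ≥0∞} (hp : 1 ≤ p) :
    ∃ (N : ℕ) (C : ℝ≥0), ∀ (f : 𝓢'(RSpace d, ℂ)) (g : 𝓢(RSpace d, ℂ)),
      ‖f g‖ₑ ≤ C * ENNReal.ofReal (schwartzNorm N g) * modulationNorm p f := by
  simp only [modulationNorm_eq]
  exact exists_enorm_apply_le hp integral_sq_norm_gaussWindow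

theorem exists_modulationNorm_schwartz_le {p : ℝ≥0∞} (hp : 1 ≤ p) :
    ∃ (N : ℕ) (C : ℝ≥0), ∀ g : 𝓢(RSpace d, ℂ),
      modulationNorm p (g : 𝓢'(RSpace d, ℂ)) ≤ C * ENNReal.ofReal (schwartzNorm N g) := by
  simp only [modulationNorm_eq]
  exact exists_eLpNorm_distCoeff_schwartz_le hp _

theorem exists_modulationNorm_conj_tfShift_le {p : ℝ≥0∞} (hp : 1 ≤ p) (g : 𝓢(RSpace d, ℂ)) :
    ∃ C : ℝ≥0, ∀ w, modulationNorm p (conjSchwartz (tfShift w g) : 𝓢'(RSpace d, ℂ)) ≤ C := by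
  simp only [modulationNorm_eq]
  exact exists_eLpNorm_distCoeff_conj_tfShift_le hp _ g

theorem schwartz_mem_modulationSpace {p : ℝ≥0∞} (hp : 1 ≤ p) (g : 𝓢(RSpace d, ℂ)) :
    (g : 𝓢'(RSpace d, ℂ)) ∈ modulationSpace d p := by
  obtain ⟨N, C, h⟩ := exists_modulationNorm_schwartz_le (d := d) hp
  exact mem_modulationSpace_iff.2 ((h g).trans_lt
    (ENNReal.mul_lt_top ENNReal.coe_lt_top ENNReal.ofReal_lt_top))

theorem smul_mem_modulationSpace {p : ℝ≥0∞} (c : ℂ) {f : 𝓢'(RSpace d, ℂ)}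
    (hf : f ∈ modulationSpace d p) : c • f ∈ modulationSpace d p := hf.const_smul c

theorem sub_mem_modulationSpace {p : ℝ≥0∞} {f g : 𝓢'(RSpace d, ℂ)}
    (hf : f ∈ modulationSpace d p) (hg : g ∈ modulationSpace d p) :
    f - g ∈ modulationSpace d p := hf.sub hg

/-- By change of window with the same Gaussian, an integrable transform is also bounded, hence in
every L^p. -/
theorem modulationSpace_one_subset {p : ℝ≥0∞} (hp : 1 ≤ p) :
    modulationSpace d 1 ⊆ modulationSpace d p := by
  intro f hf
  have h1 := memLp_distCoeff le_rfl (gaussWindow d) hf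
  obtain ⟨C, hC⟩ := exists_enorm_distCoeff_le_weightConv (d := d) integral_sq_norm_gaussWindow
    (gaussWindow d)
  obtain ⟨C', hC'⟩ := exists_weightConv_le (d := d) le_rfl
  rw [mem_modulationSpace_iff, modulationNorm_eq]
  refine (memLp_of_integrable_of_bounded hp h1
    (C := C * (C' * (eLpNorm (distCoeff (gaussWindow d) f) 1).toNNReal)) fun z => ?_).2
  refine (hC f z).trans ?_
  rw [ENNReal.coe_mul, ENNReal.coe_mul, ENNReal.coe_toNNReal h1.2.ne]
  gcongr
  exact hC' _ h1.1 z

theorem modulationSpace_subset_top {p : ℝ≥0∞} (hp : 1 ≤ p) :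
    modulationSpace d p ⊆ modulationSpace d ∞ := by
  intro f hf
  have h1 := memLp_distCoeff hp (gaussWindow d) hf
  obtain ⟨C, hC⟩ := exists_enorm_distCoeff_le_weightConv (d := d) integral_sq_norm_gaussWindow
    (gaussWindow d)
  obtain ⟨C', hC'⟩ := exists_weightConv_le (d := d) hp
  have h2 : ∀ z, ‖distCoeff (gaussWindow d) f z‖ₑ ≤
      C * (C' * eLpNorm (distCoeff (gaussWindow d) f) p) := fun z =>
    (hC f z).trans (by gcongr; exact hC' _ h1.1 z)
  have h3 : C * (C' * eLpNorm (distCoeff (gaussWindow d) f) p) < ∞ :=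
    ENNReal.mul_lt_top ENNReal.coe_lt_top (ENNReal.mul_lt_top ENNReal.coe_lt_top h1.2)
  rw [mem_modulationSpace_iff, modulationNorm_eq, eLpNorm_exponent_top]
  exact (essSup_le_of_ae_le _ (Filter.Eventually.of_forall h2)).trans_lt h3

end Modulation


/-! ### Polyanalytic Bargmann transforms on modulation spaces -/

section Bargmann

variable {d : ℕ}

theorem bargmann_eq_distCoeff (f : 𝓢'(RSpace d, ℂ)) (z : CSpace d) :
    bargmann f z = (Real.exp (Real.pi / 2 * sqNorm z) : ℂ) * distCoeff (gaussWindow d) f z :=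
  bargmann_eq f z

theorem polyBargmann_eq_distCoeff (k : Fin d → ℕ) (f : 𝓢'(RSpace d, ℂ)) (z : CSpace d) :
    polyBargmann k f z = (Real.exp (Real.pi / 2 * sqNorm z) : ℂ) * distCoeff (hermiteFun k) f z :=
  polyBargmann_eq k f z

theorem polyBargmann_add (k : Fin d → ℕ) (f g : 𝓢'(RSpace d, ℂ)) :
    polyBargmann k (f + g) = polyBargmann k f + polyBargmann k g := by
  funext z
  simp only [Pi.add_apply, polyBargmann_eq_distCoeff, distCoeff_add, mul_add]

theorem polyBargmann_smul (k : Fin d → ℕ) (c : ℂ) (f : 𝓢'(RSpace d, ℂ)) :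
    polyBargmann k (c • f) = c • polyBargmann k f := by
  funext z
  simp only [Pi.smul_apply, polyBargmann_eq_distCoeff, distCoeff_smul, smul_eq_mul]
  ring

theorem fockNorm_polyBargmann (p : ℝ≥0∞) (k : Fin d → ℕ) (f : 𝓢'(RSpace d, ℂ)) :
    fockNorm p (polyBargmann k f) = eLpNorm (distCoeff (hermiteFun k) f) p := by
  rw [fockNorm]
  congr 1
  funext z
  have h : (Real.exp (Real.pi / 2 * sqNorm z) : ℂ) * (Real.exp (-(Real.pi * sqNorm z / 2)) : ℂ) = 1 := by
    rw [← Complex.ofReal_mul, ← Real.exp_add]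
    ring_nf
    simp
  rw [polyBargmann_eq_distCoeff]
  linear_combination distCoeff (hermiteFun k) f z * h

/-- This is the inversion formula for the window `hermiteFun k`: the two weights exp(π|z|²/2) cancel
exp(-π|z|²). -/
theorem isPolyBargmannAdjoint_polyBargmann (k : Fin d → ℕ) (f : 𝓢'(RSpace d, ℂ)) :
    IsPolyBargmannAdjoint k (polyBargmann k f) f := by
  intro g
  rw [(distribution_eq_integral (integral_sq_norm_hermiteFun k) f (conjSchwartz g)).2]
  refine integral_congr_ae (Filter.Eventually.of_forall fun z => ?_)
  have h : (Real.exp (Real.pi / 2 * sqNorm z) : ℂ) * (Real.exp (Real.pi / 2 * sqNorm z) : ℂ) *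
      (Real.exp (-(Real.pi * sqNorm z)) : ℂ) = 1 := by
    rw [← Complex.ofReal_mul, ← Complex.ofReal_mul, ← Real.exp_add, ← Real.exp_add]
    ring_nf
    simp
  simp only [polyBargmann_eq_distCoeff, map_mul, Complex.conj_ofReal, distCoeff_schwartz,
    Complex.conj_conj]
  change coeff (hermiteFun k) (conjSchwartz g) z * distCoeff (hermiteFun k) f z = _
  linear_combination -(coeff (hermiteFun k) (conjSchwartz g) z * distCoeff (hermiteFun k) f z) * h

theorem polyBargmannAdjoint_polyBargmann (k : Fin d → ℕ) (f : 𝓢'(RSpace d, ℂ)) :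
    polyBargmannAdjoint k (polyBargmann k f) = f :=
  (isPolyBargmannAdjoint_polyBargmann k f).eq_polyBargmannAdjoint

theorem tildeTransform_polyBargmann (k : Fin d → ℕ) (f : 𝓢'(RSpace d, ℂ)) :
    tildeTransform k (polyBargmann k f) = bargmann f := by
  rw [tildeTransform, polyBargmannAdjoint_polyBargmann]

theorem exists_fockNorm_polyBargmann_le {p : ℝ≥0∞} (hp : 1 ≤ p) (k : Fin d → ℕ) :
    ∃ C : ℝ≥0, ∀ f : 𝓢'(RSpace d, ℂ), fockNorm p (polyBargmann k f) ≤ C * modulationNorm p f := by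
  simp only [fockNorm_polyBargmann]
  exact exists_eLpNorm_distCoeff_le_modulationNorm hp _

/-- Change of window from h_k back to the Gaussian, possible because h_k is normalised. With the
preceding bound, B^k is an isomorphism of M^p onto F^p_k. -/
theorem exists_modulationNorm_le_fockNorm {p : ℝ≥0∞} (hp : 1 ≤ p) (k : Fin d → ℕ) :
    ∃ C : ℝ≥0, ∀ f : 𝓢'(RSpace d, ℂ), modulationNorm p f ≤ C * fockNorm p (polyBargmann k f) := by
  simp only [fockNorm_polyBargmann]
  exact exists_modulationNorm_le hp (integral_sq_norm_hermiteFun k)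

/-- The inclusion of `ℝ^d` in `ℂ^d`. -/
def realVec (y : RSpace d) : CSpace d := fun j => (y j : ℂ)

@[simp] theorem reVec_realVec (y : RSpace d) : reVec (realVec y) = y := by ext j; rfl
@[simp] theorem imVec_realVec (y : RSpace d) : imVec (realVec y) = 0 := by ext j; rfl

theorem compSubConst_tfShift (y : RSpace d) (z : CSpace d) (h : 𝓢(RSpace d, ℂ)) :
    (tfShift z h).compSubConstCLM ℂ y =
      Complex.exp ((-(Real.pi * inner ℝ y (imVec z)) : ℝ) * Complex.I) • tfShift (z + realVec y) h := by
  ext t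
  rw [smul_apply, smul_eq_mul, SchwartzMap.compSubConstCLM_apply, tfShift_apply, tfShift_apply,
    ← mul_assoc, ← Complex.exp_add, map_add, reVec_realVec, sub_sub, add_comm y]
  congr 2
  simp only [shiftPhase, map_add, reVec_realVec, imVec_realVec, add_zero, inner_sub_right,
    inner_add_left]
  rw [real_inner_comm y (imVec z)]
  push_cast
  ring

theorem distCoeff_translate (h : 𝓢(RSpace d, ℂ)) (y : RSpace d) (f : 𝓢'(RSpace d, ℂ))
    (z : CSpace d) : distCoeff h (translate y f) z =
      Complex.exp ((Real.pi * inner ℝ y (imVec z) : ℝ) * Complex.I) *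
        distCoeff h f (z - realVec y) := by
  change f ((tfShift z h).compSubConstCLM ℂ (-y)) = _
  have e : z + realVec (-y) = z - realVec y := by
    funext j
    simp [realVec, sub_eq_add_neg]
  rw [compSubConst_tfShift, map_smul, smul_eq_mul, e, inner_neg_left, mul_neg, neg_neg]
  rfl

/-- The phase of a translated shift is exp(πi y·im z), and the weights at z and z - y differ by
exp(π y·re z - π|y|²/2); the product is the factor in β_y. -/
theorem realShift_polyBargmann (k : Fin d → ℕ) (y : RSpace d) (f : 𝓢'(RSpace d, ℂ)) :
    realShift y (polyBargmann k f) = polyBargmann k (translate y f) := by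
  funext z
  change Complex.exp _ * polyBargmann k f (z - realVec y) = _
  rw [polyBargmann_eq_distCoeff, polyBargmann_eq_distCoeff, distCoeff_translate, ← mul_assoc,
    ← mul_assoc, Complex.ofReal_exp, Complex.ofReal_exp, ← Complex.exp_add, ← Complex.exp_add]
  congr 2
  rw [inner_eq_sum, sq_norm_eq_sum, sqNorm, sqNorm]
  push_cast
  simp only [Finset.mul_sum, Finset.sum_mul, Finset.sum_div, ← Finset.sum_sub_distrib,
    ← Finset.sum_add_distrib]
  refine Finset.sum_congr rfl fun j _ => ?_
  rw [← Complex.ofReal_pow ‖_‖, ← Complex.ofReal_pow ‖_‖, Complex.sq_norm, Complex.sq_norm,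
    Complex.normSq_apply, Complex.normSq_apply]
  simp [realVec]
  linear_combination (-(Real.pi * (y j : ℂ))) * Complex.re_add_im (z j)

end Bargmann


/-! ### Bounded operators on modulation spaces -/

section Operators

open Filter Topology

variable {d : ℕ}

theorem coe_conjSchwartz_tfShift (φ h : 𝓢(RSpace d, ℂ)) (w : CSpace d) :
    (φ : 𝓢'(RSpace d, ℂ)) (conjSchwartz (tfShift w h)) = coeff h φ w :=
  (coeff_eq h φ w).symm

theorem continuous_conj_tfShift (h : 𝓢(RSpace d, ℂ)) :
    Continuous fun w => conjSchwartz (tfShift w h) :=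
  continuous_conjSchwartz.comp (continuous_tfShift h)

/-- Truncations of the expansion of a distribution in time-frequency shifts are Schwartz
functions. -/
theorem exists_truncation (h : 𝓢(RSpace d, ℂ)) (f : 𝓢'(RSpace d, ℂ)) (n : ℕ) :
    ∃ G : 𝓢(RSpace d, ℂ), ∀ τ : 𝓢'(RSpace d, ℂ),
      Integrable (fun w => (Metric.closedBall 0 n).indicator (distCoeff h f) w *
        τ (conjSchwartz (tfShift w h))) ∧
      τ G = ∫ w, (Metric.closedBall 0 n).indicator (distCoeff h f) w *
        τ (conjSchwartz (tfShift w h)) := by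
  obtain ⟨G, -, hG⟩ := exists_schwartz_integral (μ := volume)
    (c := (Metric.closedBall 0 (n : ℝ)).indicator (distCoeff h f))
    ((continuous_distCoeff h f).aestronglyMeasurable.indicator measurableSet_closedBall)
    (continuous_conj_tfShift h) fun N => by
      have h1 : Continuous fun w => ‖distCoeff h f w‖ * schwartzNorm N (conjSchwartz (tfShift w h)) :=
        (continuous_distCoeff h f).norm.mul
          ((continuous_schwartzNorm N).comp (continuous_conj_tfShift h))
      have h2 := (h1.continuousOn.integrableOn_compact (μ := volume)
        (isCompact_closedBall 0 (n : ℝ))).integrable_indicator measurableSet_closedBall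
      refine h2.congr (Eventually.of_forall fun w => ?_)
      by_cases hw : w ∈ Metric.closedBall (0 : CSpace d) n <;> simp [hw]
  exact ⟨G, hG⟩

/-- Dominated convergence for the `p`th powers. The restriction p < ∞ in the theorem originates
here. -/
theorem tendsto_eLpNorm_indicator_compl {p : ℝ≥0∞} (hp : 1 ≤ p) (hp' : p ≠ ∞) {u : CSpace d → ℂ}
    (hu : MemLp u p) : Tendsto (fun n : ℕ => eLpNorm ((Metric.closedBall 0 n)ᶜ.indicator u) p)
      atTop (𝓝 0) := by
  have hp0 : p ≠ 0 := fun h => by simp [h] at hp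
  have hr : 0 < p.toReal := ENNReal.toReal_pos hp0 hp'
  simp only [eLpNorm_eq_lintegral_rpow_enorm_toReal hp0 hp']
  have h1 : Tendsto (fun n : ℕ => ∫⁻ w, ‖(Metric.closedBall 0 (n : ℝ))ᶜ.indicator u w‖ₑ ^ p.toReal)
      atTop (𝓝 (∫⁻ _ : CSpace d, 0)) := by
    refine tendsto_lintegral_of_dominated_convergence' (fun w => ‖u w‖ₑ ^ p.toReal)
      (fun n => ((hu.1.indicator measurableSet_closedBall.compl).enorm.pow_const _))
      (fun n => Eventually.of_forall fun w => ?_)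
      (lintegral_rpow_enorm_lt_top_of_eLpNorm_lt_top hp0 hp' hu.2).ne
      (Eventually.of_forall fun w => ?_)
    · exact ENNReal.rpow_le_rpow (enorm_indicator_le_enorm_self _ _) hr.le
    · refine tendsto_const_nhds.congr' ?_
      obtain ⟨m, hm⟩ := exists_nat_ge ‖w‖
      filter_upwards [eventually_ge_atTop m] with n hn
      have : w ∉ (Metric.closedBall (0 : CSpace d) n)ᶜ := by
        have : (m : ℝ) ≤ n := by exact_mod_cast hn
        simpa using hm.trans this
      rw [Set.indicator_of_notMem this, enorm_zero, ENNReal.zero_rpow_of_pos hr]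
  rw [lintegral_zero] at h1
  have h2 := ENNReal.continuous_rpow_const (y := 1 / p.toReal) |>.tendsto 0 |>.comp h1
  rwa [ENNReal.zero_rpow_of_pos (by positivity)] at h2

/-- Schwartz functions are dense in `M^p`, with explicit approximations. -/
theorem exists_tendsto_modulationNorm {p : ℝ≥0∞} (hp : 1 ≤ p) (hp' : p ≠ ∞)
    {h : 𝓢(RSpace d, ℂ)} (hh : ∫ s, ‖h s‖ ^ 2 = 1) {f : 𝓢'(RSpace d, ℂ)}
    (hf : f ∈ modulationSpace d p) : ∃ G : ℕ → 𝓢(RSpace d, ℂ),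
      (∀ n, ∀ τ : 𝓢'(RSpace d, ℂ), τ (G n) = ∫ w, (Metric.closedBall 0 (n : ℝ)).indicator
        (distCoeff h f) w * τ (conjSchwartz (tfShift w h))) ∧
      Tendsto (fun n => modulationNorm p (f - (G n : 𝓢'(RSpace d, ℂ)))) atTop (𝓝 0) := by
  choose G hG using exists_truncation h f
  refine ⟨G, fun n τ => (hG n τ).2, ?_⟩
  obtain ⟨C, hC⟩ := exists_norm_coeff_tfShift_le_weight h (gaussWindow d)
  obtain ⟨C', hC'⟩ := exists_eLpNorm_weightConv_le (d := d) hp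
  have h1 : ∀ n z, ‖distCoeff (gaussWindow d) (f - (G n : 𝓢'(RSpace d, ℂ))) z‖ₑ ≤
      C * weightConv ((Metric.closedBall 0 n)ᶜ.indicator (distCoeff h f)) z := by
    intro n z
    have e1 := distribution_eq_integral hh f (tfShift z (gaussWindow d))
    -- The truncation identity is tested on the distribution of ρ(z)φ₀; symmetry of the pairing
    -- turns this into the transform of `G n`, and the difference from `f` keeps the coefficients
    -- outside the ball.
    have e2 := hG n (tfShift z (gaussWindow d) : 𝓢(RSpace d, ℂ))
    simp only [coe_conjSchwartz_tfShift] at e2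
    have e3 : (G n : 𝓢'(RSpace d, ℂ)) (tfShift z (gaussWindow d)) =
        (tfShift z (gaussWindow d) : 𝓢'(RSpace d, ℂ)) (G n) := by
      rw [schwartz_coe_apply, schwartz_coe_apply]
      simp only [mul_comm]
    have e4 : distCoeff (gaussWindow d) (f - (G n : 𝓢'(RSpace d, ℂ))) z =
        ∫ w, coeff h (tfShift z (gaussWindow d)) w *
          (Metric.closedBall 0 (n : ℝ))ᶜ.indicator (distCoeff h f) w := by
      change f (tfShift z (gaussWindow d)) - (G n : 𝓢'(RSpace d, ℂ)) (tfShift z (gaussWindow d)) = _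
      rw [e3, e1.2, e2.2, ← integral_sub e1.1 e2.1]
      refine integral_congr_ae (Eventually.of_forall fun w => ?_)
      simp only [Set.indicator_compl, Pi.sub_apply]
      change _ * distCoeff h f w - _ = _
      ring
    rw [e4]
    exact enorm_integral_mul_le (hC z)
  have h2 : ∀ n, modulationNorm p (f - (G n : 𝓢'(RSpace d, ℂ))) ≤
      (C * C' : ℝ≥0) * eLpNorm ((Metric.closedBall 0 (n : ℝ))ᶜ.indicator (distCoeff h f)) p := by
    intro n
    rw [modulationNorm_eq]
    refine (eLpNorm_le_nnreal_smul_eLpNorm_of_ae_le_mul'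
      (g := weightConv ((Metric.closedBall 0 (n : ℝ))ᶜ.indicator (distCoeff h f)))
      (Eventually.of_forall fun z => h1 n z) p).trans ?_
    rw [ENNReal.smul_def, smul_eq_mul, ENNReal.coe_mul, mul_assoc]
    gcongr
    exact hC' _ ((continuous_distCoeff h f).aestronglyMeasurable.indicator
      measurableSet_closedBall.compl)
  have h3 := ENNReal.Tendsto.const_mul (a := ((C * C' : ℝ≥0) : ℝ≥0∞))
    (tendsto_eLpNorm_indicator_compl hp hp' (memLp_distCoeff hp h hf)) (Or.inr ENNReal.coe_ne_top)
  rw [mul_zero] at h3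
  exact tendsto_of_tendsto_of_tendsto_of_le_of_le tendsto_const_nhds h3 (fun n => bot_le) h2

variable {p : ℝ≥0∞} {A : 𝓢'(RSpace d, ℂ) → 𝓢'(RSpace d, ℂ)}

theorem IsBoundedOperatorOn.map_sub {V : Type*} [AddCommGroup V] [Module ℂ V] {X : Set V}
    {N : V → ℝ≥0∞} {T : V → V} (hT : IsBoundedOperatorOn X N T)
    (hX : ∀ (c : ℂ), ∀ f ∈ X, c • f ∈ X) {f g : V} (hf : f ∈ X) (hg : g ∈ X) :
    T (f - g) = T f - T g := by
  have : f - g = f + (-1 : ℂ) • g := by simp [sub_eq_add_neg]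
  rw [this, hT.map_add f hf _ (hX _ g hg), hT.map_smul _ g hg]
  simp [sub_eq_add_neg]

theorem exists_enorm_operator_apply_le (hp : 1 ≤ p)
    (hA : IsBoundedOperatorOn (modulationSpace d p) (modulationNorm p) A) :
    ∃ (N : ℕ) (C : ℝ≥0), ∀ f ∈ modulationSpace d p, ∀ g : 𝓢(RSpace d, ℂ),
      ‖A f g‖ₑ ≤ C * ENNReal.ofReal (schwartzNorm N g) * modulationNorm p f := by
  obtain ⟨N, C, h⟩ := exists_enorm_apply_le_modulationNorm (d := d) hp
  obtain ⟨C', h'⟩ := hA.bound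
  refine ⟨N, C * C', fun f hf g => (h (A f) g).trans ?_⟩
  calc _ ≤ C * ENNReal.ofReal (schwartzNorm N g) * (C' * modulationNorm p f) := by
        gcongr
        exact h' f hf
    _ = _ := by rw [ENNReal.coe_mul]; ring

/-- On Schwartz functions `A` is a continuous bilinear form. This is what allows it to be applied
under Schwartz-valued integrals in either argument. -/
theorem exists_norm_operator_schwartz_le (hp : 1 ≤ p)
    (hA : IsBoundedOperatorOn (modulationSpace d p) (modulationNorm p) A) :
    ∃ (N : ℕ) (C : ℝ), 0 ≤ C ∧ ∀ f g : 𝓢(RSpace d, ℂ),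
      ‖A (f : 𝓢'(RSpace d, ℂ)) g‖ ≤ C * schwartzNorm N f * schwartzNorm N g := by
  obtain ⟨N₁, C₁, h₁⟩ := exists_enorm_operator_apply_le hp hA
  obtain ⟨N₂, C₂, h₂⟩ := exists_modulationNorm_schwartz_le (d := d) hp
  refine ⟨max N₁ N₂, C₁ * C₂, by positivity, fun f g => ?_⟩
  have h3 : ‖A (f : 𝓢'(RSpace d, ℂ)) g‖ₑ ≤
      ENNReal.ofReal (C₁ * C₂ * schwartzNorm (max N₁ N₂) f * schwartzNorm (max N₁ N₂) g) := by
    calc _ ≤ C₁ * ENNReal.ofReal (schwartzNorm N₁ g) * modulationNorm p (f : 𝓢'(RSpace d, ℂ)) :=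
          h₁ _ (schwartz_mem_modulationSpace hp f) g
      _ ≤ C₁ * ENNReal.ofReal (schwartzNorm (max N₁ N₂) g) *
          (C₂ * ENNReal.ofReal (schwartzNorm (max N₁ N₂) f)) := by
          gcongr
          · exact schwartzNorm_mono (le_max_left _ _) g
          · exact (h₂ f).trans (by gcongr; exact schwartzNorm_mono (le_max_right _ _) f)
      _ = _ := by
          have hf : 0 ≤ schwartzNorm (max N₁ N₂) f := apply_nonneg _ _
          rw [ENNReal.ofReal_mul (by positivity), ENNReal.ofReal_mul (by positivity),
            ENNReal.ofReal_mul (by positivity), ENNReal.ofReal_coe_nnreal,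
            ENNReal.ofReal_coe_nnreal]
          ring
  rw [← ofReal_norm] at h3
  exact (ENNReal.ofReal_le_ofReal_iff (mul_nonneg (mul_nonneg (by positivity) (apply_nonneg _ _))
    (apply_nonneg _ _))).1 h3

/-- The distribution `f ↦ ⟨A f, g⟩`. -/
theorem exists_distribution_operator (hp : 1 ≤ p)
    (hA : IsBoundedOperatorOn (modulationSpace d p) (modulationNorm p) A) (g : 𝓢(RSpace d, ℂ)) :
    ∃ τ : 𝓢'(RSpace d, ℂ), ∀ f : 𝓢(RSpace d, ℂ), τ f = A (f : 𝓢'(RSpace d, ℂ)) g := by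
  obtain ⟨N, C, hC, h⟩ := exists_norm_operator_schwartz_le hp hA
  refine exists_distribution (L := fun f => A (f : 𝓢'(RSpace d, ℂ)) g) (fun f₁ f₂ => ?_)
    (fun c f => ?_) (N := N) (C := C * schwartzNorm N g) (mul_nonneg hC (apply_nonneg _ _))
    fun f => (h f g).trans (le_of_eq (by ring))
  · rw [map_add, hA.map_add _ (schwartz_mem_modulationSpace hp f₁) _
      (schwartz_mem_modulationSpace hp f₂)]
    rfl
  · rw [map_smul, hA.map_smul _ _ (schwartz_mem_modulationSpace hp f)]
    rfl

theorem tendsto_operator_apply (hp : 1 ≤ p)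
    (hA : IsBoundedOperatorOn (modulationSpace d p) (modulationNorm p) A)
    {f : 𝓢'(RSpace d, ℂ)} (hf : f ∈ modulationSpace d p) {G : ℕ → 𝓢(RSpace d, ℂ)}
    (hG : Tendsto (fun n => modulationNorm p (f - (G n : 𝓢'(RSpace d, ℂ)))) atTop (𝓝 0))
    (g : 𝓢(RSpace d, ℂ)) : Tendsto (fun n => A (G n : 𝓢'(RSpace d, ℂ)) g) atTop (𝓝 (A f g)) := by
  obtain ⟨N, C, h⟩ := exists_enorm_operator_apply_le hp hA
  rw [tendsto_iff_edist_tendsto_0]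
  have h1 := ENNReal.Tendsto.const_mul (a := C * ENNReal.ofReal (schwartzNorm N g)) hG
    (Or.inr (ENNReal.mul_ne_top ENNReal.coe_ne_top ENNReal.ofReal_ne_top))
  rw [mul_zero] at h1
  refine tendsto_of_tendsto_of_tendsto_of_le_of_le tendsto_const_nhds h1 (fun n => bot_le)
    fun n => ?_
  have hn := schwartz_mem_modulationSpace hp (G n)
  rw [edist_comm, edist_eq_enorm_sub]
  refine le_trans (le_of_eq ?_) (h _ (sub_mem_modulationSpace hf hn) g)
  rw [hA.map_sub (fun c f hf => smul_mem_modulationSpace c hf) hf hn]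
  rfl

/-- A bounded operator may be applied under the integral in the inversion formula. -/
theorem operator_apply_eq_integral (hp : 1 ≤ p) (hp' : p ≠ ∞)
    (hA : IsBoundedOperatorOn (modulationSpace d p) (modulationNorm p) A)
    {h : 𝓢(RSpace d, ℂ)} (hh : ∫ s, ‖h s‖ ^ 2 = 1) {f : 𝓢'(RSpace d, ℂ)}
    (hf : f ∈ modulationSpace d 1) (g : 𝓢(RSpace d, ℂ)) :
    Integrable (fun w => distCoeff h f w *
      A (conjSchwartz (tfShift w h) : 𝓢'(RSpace d, ℂ)) g) ∧
    A f g = ∫ w, distCoeff h f w * A (conjSchwartz (tfShift w h) : 𝓢'(RSpace d, ℂ)) g := by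
  have hfp := modulationSpace_one_subset hp hf
  obtain ⟨τ, hτ⟩ := exists_distribution_operator hp hA g
  obtain ⟨G, hG, hlim⟩ := exists_tendsto_modulationNorm hp hp' hh hfp
  obtain ⟨N, C, hC⟩ := exists_enorm_operator_apply_le hp hA
  obtain ⟨C', hC'⟩ := exists_modulationNorm_conj_tfShift_le (d := d) hp h
  simp only [← hτ]
  have hcont : Continuous fun w => τ (conjSchwartz (tfShift w h)) :=
    (map_continuous τ).comp (continuous_conj_tfShift h)
  -- The shifted windows are bounded in M^p uniformly in `w`, so `f` in M¹ makes the integrand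
  -- absolutely integrable.
  have hb : ∀ w, ‖τ (conjSchwartz (tfShift w h))‖ ≤ C * schwartzNorm N g * C' := by
    intro w
    have hs : 0 ≤ schwartzNorm N g := apply_nonneg _ _
    rw [hτ, ← ENNReal.ofReal_le_ofReal_iff (by positivity), ofReal_norm,
      ENNReal.ofReal_mul (by positivity), ENNReal.ofReal_mul (by positivity),
      ENNReal.ofReal_coe_nnreal, ENNReal.ofReal_coe_nnreal]
    refine (hC _ (schwartz_mem_modulationSpace hp _) g).trans ?_
    gcongr
    exact hC' w
  have hint : Integrable (fun w => ‖distCoeff h f w‖ * (C * schwartzNorm N g * C')) :=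
    (memLp_one_iff_integrable.1 (memLp_distCoeff le_rfl h hf)).norm.mul_const _
  have hm : AEStronglyMeasurable (fun w => distCoeff h f w * τ (conjSchwartz (tfShift w h))) volume :=
    ((continuous_distCoeff h f).mul hcont).aestronglyMeasurable
  refine ⟨hint.mono' hm (Eventually.of_forall fun w => ?_), ?_⟩
  · rw [norm_mul]
    exact mul_le_mul_of_nonneg_left (hb w) (norm_nonneg _)
  -- The truncations converge to `f` in M^p, so their images converge by boundedness of `A`; their
  -- integrals converge to the full integral by domination.
  refine tendsto_nhds_unique (tendsto_operator_apply hp hA hfp hlim g) ?_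
  simp only [← hτ, hG]
  refine tendsto_integral_of_dominated_convergence _ (fun n =>
    ((continuous_distCoeff h f).aestronglyMeasurable.indicator measurableSet_closedBall).mul
      hcont.aestronglyMeasurable) hint (fun n => Eventually.of_forall fun w => ?_)
    (Eventually.of_forall fun w => ?_)
  · rw [norm_mul]
    gcongr
    · exact norm_indicator_le_norm_self _ _
    · exact hb w
  · refine tendsto_const_nhds.congr' ?_
    obtain ⟨m, hm⟩ := exists_nat_ge ‖w‖
    filter_upwards [eventually_ge_atTop m] with n hn
    have : w ∈ Metric.closedBall (0 : CSpace d) n := by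
      have : (m : ℝ) ≤ n := by exact_mod_cast hn
      simpa using hm.trans this
    rw [Set.indicator_of_mem this]

end Operators


/-! ### The kernel of a convolution operator -/

section Kernel

variable {d : ℕ}

theorem integrable_one_add_norm_pow_mul (N : ℕ) (g : 𝓢(RSpace d, ℂ)) :
    Integrable fun x => (1 + ‖x‖) ^ N * ‖g x‖ := by
  simp only [add_pow, one_pow, one_mul, Finset.sum_mul]
  refine integrable_finsetSum _ fun i _ => ?_
  refine ((g.integrable_pow_mul volume (N - i)).const_mul (N.choose i : ℝ)).congr
    (Filter.Eventually.of_forall fun x => ?_)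
  ring

theorem continuous_reflectShift (f : 𝓢(RSpace d, ℂ)) : Continuous (reflectShift f) :=
  continuous_compSubConst _

theorem exists_schwartzNorm_reflectShift_le (N : ℕ) (f : 𝓢(RSpace d, ℂ)) :
    ∃ C : ℝ, 0 ≤ C ∧ ∀ x, schwartzNorm N (reflectShift f x) ≤ C * (1 + ‖x‖) ^ N := by
  refine ⟨2 ^ N * schwartzNorm N
    (f.compCLMOfContinuousLinearEquiv ℂ (ContinuousLinearEquiv.neg ℝ)),
    mul_nonneg (by positivity) (apply_nonneg _ _), fun x => ?_⟩
  refine (schwartzNorm_compSubConst_le N _ x).trans (le_of_eq ?_)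
  ring

theorem integrable_mul_schwartzNorm {b : RSpace d → ℝ} {N : ℕ} {C : ℝ}
    (hb : Continuous b) (hC : ∀ x, |b x| ≤ C * (1 + ‖x‖) ^ N) (g : 𝓢(RSpace d, ℂ)) :
    Integrable fun x => ‖g x‖ * b x := by
  refine ((integrable_one_add_norm_pow_mul N g).const_mul C).mono'
    (g.continuous.norm.mul hb).aestronglyMeasurable (Filter.Eventually.of_forall fun x => ?_)
  rw [norm_mul, norm_norm, Real.norm_eq_abs]
  calc _ ≤ ‖g x‖ * (C * (1 + ‖x‖) ^ N) := by gcongr; exact hC x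
    _ = _ := by ring

/-- Integrating u * f against `g` is applying `u` to the correlation of `g` and `f`, which is again
Schwartz. -/
theorem exists_integral_mul_reflectShift (f g : 𝓢(RSpace d, ℂ)) :
    ∃ G : 𝓢(RSpace d, ℂ), (∀ t, G t = ∫ x, g x * f (x - t)) ∧
      ∀ u : 𝓢'(RSpace d, ℂ), u G = ∫ x, g x * u (reflectShift f x) := by
  obtain ⟨G, h1, h2⟩ := exists_schwartz_integral (μ := volume) (c := g)
    g.continuous.aestronglyMeasurable (continuous_reflectShift f) fun N => by
      obtain ⟨C, hC, h⟩ := exists_schwartzNorm_reflectShift_le N f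
      refine integrable_mul_schwartzNorm
        ((continuous_schwartzNorm N).comp (continuous_reflectShift f)) (N := N) (C := C) (fun x => ?_) g
      simpa [abs_of_nonneg (apply_nonneg (schwartzNorm N) (reflectShift f x))] using h x
  refine ⟨G, fun t => ?_, fun u => (h2 u).2⟩
  simp only [h1, reflectShift_apply]

theorem IsConvolution.exists_apply_eq {u v : 𝓢'(RSpace d, ℂ)} {f : 𝓢(RSpace d, ℂ)}
    (h : IsConvolution u f v) (g : 𝓢(RSpace d, ℂ)) :
    ∃ G : 𝓢(RSpace d, ℂ), (∀ t, G t = ∫ x, g x * f (x - t)) ∧ v g = u G := by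
  obtain ⟨G, h1, h2⟩ := exists_integral_mul_reflectShift f g
  refine ⟨G, h1, ?_⟩
  rw [h g, h2 u]
  simp only [mul_comm]

/-- Translating ρ(w)h by `t` gives ρ(w + t)h up to a phase, so the correlation is a matrix
coefficient at w + t - z. -/
theorem integral_tfShift_mul_conj (h g : 𝓢(RSpace d, ℂ)) (z w : CSpace d) (t : RSpace d) :
    ∫ x, tfShift z g x * conjSchwartz (tfShift w h) (x - t) =
      Complex.exp ((Real.pi * (inner ℝ t (imVec w) + inner ℝ (reVec w + t) (imVec z) -
        inner ℝ (reVec z) (imVec w)) : ℝ) * Complex.I) * coeff h g (w + realVec t - z) := by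
  have h1 : ∀ x, tfShift z g x * conjSchwartz (tfShift w h) (x - t) =
      Complex.exp ((Real.pi * inner ℝ t (imVec w) : ℝ) * Complex.I) *
        (tfShift z g x * (starRingEnd ℂ) (tfShift (w + realVec t) h x)) := by
    intro x
    have := congrArg (fun φ : 𝓢(RSpace d, ℂ) => φ x) (compSubConst_tfShift t w h)
    simp only [SchwartzMap.compSubConstCLM_apply, smul_apply, smul_eq_mul] at this
    rw [conjSchwartz_apply, this, map_mul, ← Complex.exp_conj, map_mul, Complex.conj_I,
      Complex.conj_ofReal, Complex.ofReal_neg, neg_mul_neg]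
    ring
  simp only [h1]
  rw [integral_const_mul]
  change _ * coeff h (tfShift z g) (w + realVec t) = _
  rw [coeff_tfShift, ← mul_assoc, ← Complex.exp_add]
  congr 2
  simp only [map_add, reVec_realVec, imVec_realVec, add_zero]
  push_cast
  ring

/-- The weight at z, the phase and the Gaussian of the matrix coefficient assemble into the factors
of the kernel. The second kernel argument z - conj(w) arises as the coefficient of `t`. -/
theorem sqNorm_kernel_exponent (z w : CSpace d) (t : RSpace d) :
    ((Real.pi / 2 * sqNorm z : ℝ) : ℂ) + (Real.pi * (inner ℝ t (imVec w) +
      inner ℝ (reVec w + t) (imVec z) - inner ℝ (reVec z) (imVec w)) : ℝ) * Complex.I +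
      (-(Real.pi / 2 * sqNorm (w + realVec t - z) : ℝ) : ℂ) =
    (-(Real.pi / 2 * sqNorm w : ℝ) : ℂ) + Real.pi * ∑ j, (starRingEnd ℂ) (w j) * z j +
      (-((Real.pi / 2 * ‖t‖ ^ 2 : ℝ) : ℂ) +
        ∑ j, (t j : ℂ) * (Real.pi * (z j - (starRingEnd ℂ) (w j)))) := by
  rw [inner_eq_sum, inner_eq_sum, inner_eq_sum, sq_norm_eq_sum, sqNorm, sqNorm, sqNorm]
  push_cast
  simp only [Finset.mul_sum, Finset.sum_mul, ← Finset.sum_neg_distrib, ← Finset.sum_sub_distrib,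
    ← Finset.sum_add_distrib]
  refine Finset.sum_congr rfl fun j _ => ?_
  have e1 : ∀ c : ℂ, (‖c‖ : ℂ) ^ 2 = (c.re : ℂ) * c.re + c.im * c.im := by
    intro c
    rw [← Complex.ofReal_pow, Complex.sq_norm, Complex.normSq_apply]
    push_cast
    rfl
  have e2 : (starRingEnd ℂ) (w j) = (w j).re - (w j).im * Complex.I := by
    apply Complex.ext <;> simp
  rw [e1, e1, e1, e2]
  simp [realVec]
  linear_combination (Real.pi * (w j).im * (z j).im : ℂ) * Complex.I_sq +
    (Real.pi * ((t j : ℂ) + (w j).re - (w j).im * Complex.I)) * Complex.re_add_im (z j)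

/-- The kernel of a convolution operator with respect to time-frequency shifts. -/
theorem exp_mul_convolution_tfShift {u v : 𝓢'(RSpace d, ℂ)} {h : 𝓢(RSpace d, ℂ)} {k : Fin d → ℕ}
    {Λ : CSpace d → ℂ} {z w : CSpace d} {T : 𝓢(RSpace d, ℂ)}
    (hΛ : ∀ s, coeff h (hermiteFun k) s = Λ s * Complex.exp (-(Real.pi / 2 * sqNorm s : ℝ)))
    (hT : ∀ t, T t = Λ (w + realVec t - z) * Complex.exp (-((Real.pi / 2 * ‖t‖ ^ 2 : ℝ) : ℂ) +
        ∑ j, (t j : ℂ) * (Real.pi * (z j - (starRingEnd ℂ) (w j)))))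
    (hv : IsConvolution u (conjSchwartz (tfShift w h)) v) :
    (Real.exp (Real.pi / 2 * sqNorm z) : ℂ) * v (tfShift z (hermiteFun k)) =
      (Real.exp (Real.pi / 2 * sqNorm w) : ℂ) *
        Complex.exp (Real.pi * ∑ j, (starRingEnd ℂ) (w j) * z j) * u T *
        (Real.exp (-(Real.pi * sqNorm w)) : ℂ) := by
  obtain ⟨G, hG, hGu⟩ := hv.exists_apply_eq (tfShift z (hermiteFun k))
  have h1 : (Real.exp (Real.pi / 2 * sqNorm z) : ℂ) • G =
      ((Real.exp (Real.pi / 2 * sqNorm w) : ℂ) *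
        Complex.exp (Real.pi * ∑ j, (starRingEnd ℂ) (w j) * z j) *
        (Real.exp (-(Real.pi * sqNorm w)) : ℂ)) • T := by
    ext t
    rw [smul_apply, smul_apply, smul_eq_mul, smul_eq_mul, hG, hT, integral_tfShift_mul_conj, hΛ]
    have e1 := congrArg Complex.exp (sqNorm_kernel_exponent z w t)
    rw [Complex.exp_add, Complex.exp_add, Complex.exp_add, Complex.exp_add] at e1
    have e2 : (Real.exp (Real.pi / 2 * sqNorm w) : ℂ) * (Real.exp (-(Real.pi * sqNorm w)) : ℂ) =
        Complex.exp (-(Real.pi / 2 * sqNorm w : ℝ) : ℂ) := by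
      rw [← Complex.ofReal_mul, ← Real.exp_add, Complex.ofReal_exp]
      congr 1
      push_cast
      ring
    rw [Complex.ofReal_exp (Real.pi / 2 * sqNorm z)]
    linear_combination Λ (w + realVec t - z) * e1 -
      Λ (w + realVec t - z) * Complex.exp (Real.pi * ∑ j, (starRingEnd ℂ) (w j) * z j) *
        Complex.exp (-((Real.pi / 2 * ‖t‖ ^ 2 : ℝ) : ℂ) +
          ∑ j, (t j : ℂ) * (Real.pi * (z j - (starRingEnd ℂ) (w j)))) * e2
  have h2 := congrArg u h1
  rw [map_smul, map_smul, smul_eq_mul, smul_eq_mul, ← hGu] at h2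
  rw [h2]
  ring

/-- Here Λ is the Laguerre product, which depends only on the moduli; the sign between z - w - t and
w + t - z is therefore immaterial. -/
theorem psiKernel_eq {u v : 𝓢'(RSpace d, ℂ)} {k : Fin d → ℕ} {z w : CSpace d}
    (hv : IsConvolution u (conjSchwartz (tfShift w (hermiteFun k))) v) :
    (Real.exp (Real.pi / 2 * sqNorm z) : ℂ) * v (tfShift z (hermiteFun k)) =
      (Real.exp (Real.pi / 2 * sqNorm w) : ℂ) *
        Complex.exp (Real.pi * ∑ j, (starRingEnd ℂ) (w j) * z j) *
        psiKernel k u (fun j => z j - w j) (fun j => z j - (starRingEnd ℂ) (w j)) *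
        (Real.exp (-(Real.pi * sqNorm w)) : ℂ) := by
  refine exp_mul_convolution_tfShift (coeff_hermiteFun_self k) (fun t => ?_) hv
  rw [psiKernel_testFunction_apply]
  congr 2
  funext j
  have : z j - w j - (t j : ℂ) = -((w + realVec t - z) j) := by
    simp [realVec]
    ring
  rw [this, norm_neg]

/-- Here Λ is a multiple of the conjugate monomial, and for real `t` the conjugate of w + t - z is t
- conj(z - w). -/
theorem phiKernel_eq {u v : 𝓢'(RSpace d, ℂ)} {k : Fin d → ℕ} {z w : CSpace d}
    (hv : IsConvolution u (conjSchwartz (tfShift w (gaussWindow d))) v) :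
    (Real.exp (Real.pi / 2 * sqNorm z) : ℂ) * v (tfShift z (hermiteFun k)) =
      (Real.exp (Real.pi / 2 * sqNorm w) : ℂ) *
        Complex.exp (Real.pi * ∑ j, (starRingEnd ℂ) (w j) * z j) *
        phiKernel k u (fun j => z j - w j) (fun j => z j - (starRingEnd ℂ) (w j)) *
        (Real.exp (-(Real.pi * sqNorm w)) : ℂ) := by
  rw [phiKernel, ← smul_eq_mul (Real.sqrt _ : ℂ), ← map_smul]
  refine exp_mul_convolution_tfShift (coeff_gaussWindow_hermiteFun k) (fun t => ?_) hv
  rw [smul_apply, smul_eq_mul, phiKernel_testFunction_apply, mul_assoc]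
  congr 3
  funext j
  congr 1
  simp [realVec]
  ring

end Kernel

/-! ### The two integral formulas -/

section Formula

variable {d : ℕ} {p : ℝ≥0∞} {A : 𝓢'(RSpace d, ℂ) → 𝓢'(RSpace d, ℂ)} {u : 𝓢'(RSpace d, ℂ)}

/-- Expand `f` in the ρ(w)h, apply `A` under the integral, pair with ρ(z)h_k. The window h = h_k
produces ψ and B^k f, the window h = φ₀ produces φ and Bf. -/
theorem polyBargmann_operator_eq_kernelOperator (hp : 1 ≤ p) (hp' : p ≠ ∞)
    (hA : IsBoundedOperatorOn (modulationSpace d p) (modulationNorm p) A)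
    (hu : ∀ f : 𝓢(RSpace d, ℂ), IsConvolution u f (A (f : 𝓢'(RSpace d, ℂ)))) (k : Fin d → ℕ)
    {f : 𝓢'(RSpace d, ℂ)} (hf : f ∈ modulationSpace d 1) (z : CSpace d) :
    (Integrable (kernelIntegrand (psiKernel k u) (polyBargmann k f) z) ∧
      polyBargmann k (A f) z = kernelOperator (psiKernel k u) (polyBargmann k f) z) ∧
    (Integrable (kernelIntegrand (phiKernel k u) (bargmann f) z) ∧
      polyBargmann k (A f) z = kernelOperator (phiKernel k u) (bargmann f) z) := by
  constructor
  · have h1 := operator_apply_eq_integral hp hp' hA (integral_sq_norm_hermiteFun k) hf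
      (tfShift z (hermiteFun k))
    have h2 : kernelIntegrand (psiKernel k u) (polyBargmann k f) z =
        fun w => (Real.exp (Real.pi / 2 * sqNorm z) : ℂ) * (distCoeff (hermiteFun k) f w *
          A (conjSchwartz (tfShift w (hermiteFun k)) : 𝓢'(RSpace d, ℂ))
            (tfShift z (hermiteFun k))) := by
      funext w
      rw [kernelIntegrand, mul_left_comm, psiKernel_eq (hu _), polyBargmann_eq_distCoeff]
      ring
    rw [kernelOperator, h2, integral_const_mul, ← h1.2]
    exact ⟨h1.1.const_mul _, polyBargmann_eq_distCoeff k (A f) z⟩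
  · have h1 := operator_apply_eq_integral hp hp' hA integral_sq_norm_gaussWindow hf
      (tfShift z (hermiteFun k))
    have h2 : kernelIntegrand (phiKernel k u) (bargmann f) z =
        fun w => (Real.exp (Real.pi / 2 * sqNorm z) : ℂ) * (distCoeff (gaussWindow d) f w *
          A (conjSchwartz (tfShift w (gaussWindow d)) : 𝓢'(RSpace d, ℂ))
            (tfShift z (hermiteFun k))) := by
      funext w
      rw [kernelIntegrand, mul_left_comm, phiKernel_eq (hu _), bargmann_eq_distCoeff]
      ring
    rw [kernelOperator, h2, integral_const_mul, ← h1.2]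
    exact ⟨h1.1.const_mul _, polyBargmann_eq_distCoeff k (A f) z⟩

end Formula


/-! ### Translation invariant operators are convolution operators -/

section Convolutor

open Filter Topology

variable {d : ℕ}

/-- The Gaussian window is a convolution of two Schwartz functions. -/
theorem exists_gaussWindow_eq_integral (d : ℕ) : ∃ φ₁ φ₂ : 𝓢(RSpace d, ℂ),
    ∀ t, gaussWindow d t = ∫ y, φ₂ y * φ₁ (t - y) := by
  set φ : 𝓢(RSpace d, ℂ) := gaussExp (2 * Real.pi) (by positivity) 0 with hφ
  have hφt : ∀ t, φ t = (Real.exp (-(2 * Real.pi * ‖t‖ ^ 2)) : ℂ) := by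
    intro t
    rw [hφ, gaussExp_apply]
    simp
  set I : ℝ := ∫ y : RSpace d, Real.exp (-(4 * Real.pi) * ‖y‖ ^ 2) with hI
  have hI0 : I ≠ 0 := by
    rw [hI, GaussianFourier.integral_rexp_neg_mul_sq_norm (by positivity)]
    positivity
  have h1 : ∀ t, ∫ y, φ y * φ (t - y) = ((Real.exp (-(Real.pi * ‖t‖ ^ 2)) * I : ℝ) : ℂ) := by
    intro t
    -- Completing the square: 2|y|² + 2|t - y|² = |t|² + 4|y - t/2|², which explains the width 2π of
    -- `φ`.
    have h2 : ∀ y, φ y * φ (t - y) = ((Real.exp (-(Real.pi * ‖t‖ ^ 2)) *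
        Real.exp (-(4 * Real.pi) * ‖y - (1 / 2 : ℝ) • t‖ ^ 2) : ℝ) : ℂ) := by
      intro y
      rw [hφt, hφt, ← Complex.ofReal_mul, ← Real.exp_add, ← Real.exp_add]
      congr 2
      rw [norm_sub_sq_real, norm_sub_sq_real, inner_smul_right, norm_smul, real_inner_comm,
        Real.norm_of_nonneg (by norm_num : (0 : ℝ) ≤ 1 / 2)]
      ring
    simp only [h2]
    rw [integral_complex_ofReal, integral_const_mul,
      integral_sub_right_eq_self (fun y : RSpace d => Real.exp (-(4 * Real.pi) * ‖y‖ ^ 2))]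
  refine ⟨φ, (((2 : ℝ) ^ ((d : ℝ) / 4) * I⁻¹ : ℝ) : ℂ) • φ, fun t => ?_⟩
  simp only [smul_apply, smul_eq_mul, mul_assoc]
  rw [integral_const_mul, h1, gaussWindow_apply, ← Complex.ofReal_mul]
  congr 1
  field_simp

/-- The reflection `f ↦ f(-·)`. -/
def reflect : 𝓢(RSpace d, ℂ) →L[ℂ] 𝓢(RSpace d, ℂ) :=
  SchwartzMap.compCLMOfContinuousLinearEquiv ℂ (ContinuousLinearEquiv.neg ℝ)

theorem reflect_apply (f : 𝓢(RSpace d, ℂ)) (t : RSpace d) : reflect f t = f (-t) := rfl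

theorem reflectShift_eq (f : 𝓢(RSpace d, ℂ)) (x : RSpace d) :
    reflectShift f x = (reflect f).compSubConstCLM ℂ x := rfl

theorem reflect_reflectShift (f : 𝓢(RSpace d, ℂ)) (x : RSpace d) :
    reflect (reflectShift f x) = f.compSubConstCLM ℂ (-x) := by
  ext t
  rw [reflect_apply, reflectShift_apply, SchwartzMap.compSubConstCLM_apply]
  congr 1
  abel

/-- Needed for `a` the identity and `a` the negation: translations by y on one argument of the
operator become translations by -y on the other. -/
theorem exists_integral_mul_compSubConst (c g : 𝓢(RSpace d, ℂ)) {a : RSpace d → RSpace d}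
    (ha : Continuous a) (ha' : ∀ y, ‖a y‖ = ‖y‖) :
    ∃ G : 𝓢(RSpace d, ℂ), (∀ t, G t = ∫ y, c y * g (t - a y)) ∧
      ∀ u : 𝓢'(RSpace d, ℂ), u G = ∫ y, c y * u (g.compSubConstCLM ℂ (a y)) := by
  have hcont : Continuous fun y => g.compSubConstCLM ℂ (a y) := (continuous_compSubConst g).comp ha
  obtain ⟨G, h1, h2⟩ := exists_schwartz_integral (μ := volume) (c := c)
    c.continuous.aestronglyMeasurable hcont fun N => by
      refine integrable_mul_schwartzNorm ((continuous_schwartzNorm N).comp hcont) (N := N)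
        (C := 2 ^ N * schwartzNorm N g) (fun x => ?_) c
      rw [Function.comp_apply, abs_of_nonneg (apply_nonneg _ _)]
      refine (schwartzNorm_compSubConst_le N g (a x)).trans (le_of_eq ?_)
      rw [ha']
      ring
  exact ⟨G, h1, fun u => (h2 u).2⟩

theorem translate_schwartz (y : RSpace d) (f : 𝓢(RSpace d, ℂ)) :
    translate y (f : 𝓢'(RSpace d, ℂ)) = (f.compSubConstCLM ℂ y : 𝓢(RSpace d, ℂ)) := by
  ext g
  change (f : 𝓢'(RSpace d, ℂ)) (g.compSubConstCLM ℂ (-y)) = _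
  rw [schwartz_coe_apply, schwartz_coe_apply,
    ← integral_add_right_eq_self (fun t => g t * f.compSubConstCLM ℂ y t) y]
  simp

theorem coeff_add (h f g : 𝓢(RSpace d, ℂ)) (z : CSpace d) :
    coeff h (f + g) z = coeff h f z + coeff h g z := by
  simp only [coeff_eq, map_add]
  rfl

theorem coeff_smul (h f : 𝓢(RSpace d, ℂ)) (c : ℂ) (z : CSpace d) :
    coeff h (c • f) z = c * coeff h f z := by
  simp only [coeff_eq, map_smul]
  rfl

theorem coeff_compSubConst (h f : 𝓢(RSpace d, ℂ)) (x : RSpace d) (z : CSpace d) :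
    coeff h (f.compSubConstCLM ℂ (-x)) z =
      Complex.exp ((Real.pi * inner ℝ x (imVec z) : ℝ) * Complex.I) * coeff h f (z + realVec x) := by
  rw [coeff, coeff, ← integral_const_mul, ← integral_sub_right_eq_self _ x]
  refine integral_congr_ae (Eventually.of_forall fun t => ?_)
  have h1 := congrArg (fun φ : 𝓢(RSpace d, ℂ) => φ t) (compSubConst_tfShift x z h)
  simp only [SchwartzMap.compSubConstCLM_apply, smul_apply, smul_eq_mul] at h1
  simp only [SchwartzMap.compSubConstCLM_apply]
  rw [h1, sub_neg_eq_add, sub_add_cancel, map_mul, ← Complex.exp_conj, map_mul, Complex.conj_I,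
    Complex.conj_ofReal, Complex.ofReal_neg, neg_mul_neg]
  ring

variable {p : ℝ≥0∞} {A : 𝓢'(RSpace d, ℂ) → 𝓢'(RSpace d, ℂ)}

theorem continuous_operator_apply (hp : 1 ≤ p)
    (hA : IsBoundedOperatorOn (modulationSpace d p) (modulationNorm p) A)
    {X : Type*} [TopologicalSpace X] {F G : X → 𝓢(RSpace d, ℂ)} (hF : Continuous F)
    (hG : Continuous G) : Continuous fun x => A (F x : 𝓢'(RSpace d, ℂ)) (G x) := by
  obtain ⟨N, C, hC, h⟩ := exists_norm_operator_schwartz_le hp hA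
  rw [continuous_iff_continuousAt]
  intro x₀
  have h1 : Tendsto (fun x => C * schwartzNorm N (F x - F x₀) * schwartzNorm N (G x) +
      C * schwartzNorm N (F x₀) * schwartzNorm N (G x - G x₀)) (𝓝 x₀) (𝓝 0) := by
    have hc := continuous_schwartzNorm (E := RSpace d) N
    have h2 : Continuous fun x => C * schwartzNorm N (F x - F x₀) * schwartzNorm N (G x) +
        C * schwartzNorm N (F x₀) * schwartzNorm N (G x - G x₀) := by fun_prop
    have h3 := h2.tendsto x₀
    simpa using h3
  rw [ContinuousAt, tendsto_iff_norm_sub_tendsto_zero]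
  refine squeeze_zero (fun x => norm_nonneg _) (fun x => ?_) h1
  have e1 : A (F x : 𝓢'(RSpace d, ℂ)) (G x) - A (F x₀ : 𝓢'(RSpace d, ℂ)) (G x₀) =
      A ((F x - F x₀ : 𝓢(RSpace d, ℂ)) : 𝓢'(RSpace d, ℂ)) (G x) +
        A (F x₀ : 𝓢'(RSpace d, ℂ)) (G x - G x₀) := by
    rw [_root_.map_sub, hA.map_sub (fun c f hf => smul_mem_modulationSpace c hf)
      (schwartz_mem_modulationSpace hp _) (schwartz_mem_modulationSpace hp _), _root_.map_sub]
    change _ = A (F x : 𝓢'(RSpace d, ℂ)) (G x) - A (F x₀ : 𝓢'(RSpace d, ℂ)) (G x) + _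
    ring
  rw [e1]
  exact (norm_add_le _ _).trans (add_le_add (h _ _) (h _ _))

theorem operator_compSubConst (hp : 1 ≤ p)
    (hAT : ∀ y : RSpace d, ∀ f ∈ modulationSpace d p, A (translate y f) = translate y (A f))
    (f g : 𝓢(RSpace d, ℂ)) (y : RSpace d) :
    A (f.compSubConstCLM ℂ y : 𝓢(RSpace d, ℂ)) g =
      A (f : 𝓢'(RSpace d, ℂ)) (g.compSubConstCLM ℂ (-y)) := by
  rw [← translate_schwartz, hAT y _ (schwartz_mem_modulationSpace hp f)]
  rfl

/-- On a time-frequency shifted convolution, a translation invariant operator takes values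
in functions. -/
theorem operator_tfShift_apply (hp : 1 ≤ p)
    (hA : IsBoundedOperatorOn (modulationSpace d p) (modulationNorm p) A)
    (hAT : ∀ y : RSpace d, ∀ f ∈ modulationSpace d p, A (translate y f) = translate y (A f))
    {φ₀ φ₁ φ₂ : 𝓢(RSpace d, ℂ)} (hφ : ∀ t, φ₀ t = ∫ y, φ₂ y * φ₁ (t - y))
    (z : CSpace d) (g : 𝓢(RSpace d, ℂ)) :
    A (tfShift z φ₀ : 𝓢'(RSpace d, ℂ)) g = ∫ x, g x *
      A (tfShift z φ₁ : 𝓢'(RSpace d, ℂ)) (reflectShift (modulate (imVec z) φ₂) x) := by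
  set χ := modulate (imVec z) φ₂ with hχ
  obtain ⟨τ, hτ⟩ := exists_distribution_operator hp hA g
  obtain ⟨G, hG, hGu⟩ := exists_integral_mul_compSubConst χ (tfShift z φ₁) continuous_id fun _ => rfl
  -- Characters are multiplicative, so ρ(z)(φ₂ * φ₁) is the convolution of the modulated φ₂ with
  -- ρ(z)φ₁.
  have h1 : G = tfShift z φ₀ := by
    ext t
    rw [hG, tfShift_apply, hφ, ← integral_const_mul]
    have : ∀ y, χ y * tfShift z φ₁ (t - id y) = Complex.exp ((shiftPhase z t : ℝ) * Complex.I) *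
        (φ₂ y * φ₁ (t - reVec z - y)) := by
      intro y
      rw [hχ, modulate_apply, tfShift_apply, id, sub_right_comm]
      have : Complex.exp ((2 * Real.pi * inner ℝ (imVec z) y : ℝ) * Complex.I) *
          Complex.exp ((shiftPhase z (t - y) : ℝ) * Complex.I) =
          Complex.exp ((shiftPhase z t : ℝ) * Complex.I) := by
        rw [← Complex.exp_add]
        congr 1
        simp only [shiftPhase, inner_sub_right]
        push_cast
        ring
      rw [← this]
      ring
    simp only [this]
  obtain ⟨H, hH, hHu⟩ := exists_integral_mul_compSubConst χ g continuous_neg norm_neg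
  obtain ⟨H', hH', hHu'⟩ := exists_integral_mul_reflectShift χ g
  have h2 : H = H' := by
    ext t
    rw [hH, hH', ← integral_sub_right_eq_self _ t]
    refine integral_congr_ae (Eventually.of_forall fun x => ?_)
    simp only [sub_neg_eq_add, add_sub_cancel, mul_comm]
  -- `A` is applied under the integral defining `G`, and translation invariance moves each
  -- translation to `g`; both sides then are A(ρ(z)φ₁) applied to the same Schwartz function.
  rw [← hHu', ← h2, hHu, ← hτ, ← h1, hGu]
  simp only [hτ, id, operator_compSubConst hp hAT]

/-- As a time-frequency shift, the test function inherits the growth bound and the continuity of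
`tfShift`. -/
theorem reflectShift_modulate (b x : RSpace d) (g : 𝓢(RSpace d, ℂ)) :
    reflectShift (modulate b g) x =
      Complex.exp ((Real.pi * inner ℝ x b : ℝ) * Complex.I) •
        tfShift (ofReIm x (-b)) (reflect g) := by
  ext t
  rw [reflectShift_apply, modulate_apply, smul_apply, smul_eq_mul, tfShift_apply, reflect_apply,
    ← mul_assoc, ← Complex.exp_add, reVec_ofReIm, neg_sub]
  congr 2
  simp only [shiftPhase, reVec_ofReIm, imVec_ofReIm, inner_sub_right, inner_neg_left,
    inner_neg_right]
  rw [real_inner_comm x b]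
  push_cast
  ring

theorem norm_ofReIm_le (x y : RSpace d) : ‖ofReIm x y‖ ≤ ‖x‖ + ‖y‖ := by
  simpa using norm_le_reVec_add_imVec (ofReIm x y)

theorem exists_norm_operator_tfShift_le (hp : 1 ≤ p)
    (hA : IsBoundedOperatorOn (modulationSpace d p) (modulationNorm p) A) (φ₁ φ₂ : 𝓢(RSpace d, ℂ)) :
    ∃ (L L' : ℕ) (C : ℝ), 0 ≤ C ∧ ∀ (z : CSpace d) (x : RSpace d),
      ‖A (tfShift z φ₁ : 𝓢'(RSpace d, ℂ)) (reflectShift (modulate (imVec z) φ₂) x)‖ ≤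
        C * (1 + ‖z‖) ^ L * (1 + ‖x‖) ^ L' := by
  obtain ⟨N, C, hC, hb⟩ := exists_norm_operator_schwartz_le hp hA
  obtain ⟨N', L, C', hC', h⟩ := exists_schwartzNorm_tfShift_le (d := d) N
  set K := ‖(imVec : CSpace d →L[ℝ] RSpace d)‖ with hK
  have hs₁ : 0 ≤ schwartzNorm N' φ₁ := apply_nonneg _ _
  have hs₂ : 0 ≤ schwartzNorm N' (reflect φ₂) := apply_nonneg _ _
  have hK0 : 0 ≤ K := norm_nonneg _
  refine ⟨L + L, L, C * (C' * schwartzNorm N' φ₁) * (C' * (1 + K) ^ L * schwartzNorm N' (reflect φ₂)),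
    by positivity, fun z x => ?_⟩
  rw [reflectShift_modulate, map_smul, smul_eq_mul, norm_mul, Complex.norm_exp_ofReal_mul_I, one_mul]
  have h1 : 1 + ‖ofReIm x (-imVec z)‖ ≤ (1 + K) * (1 + ‖z‖) * (1 + ‖x‖) := by
    have e1 := norm_ofReIm_le x (-imVec z)
    have e2 := (imVec (d := d)).le_opNorm z
    rw [norm_neg] at e1
    have e3 : 0 ≤ K * ‖z‖ := by positivity
    have e4 : 0 ≤ ‖z‖ := norm_nonneg z
    have e5 : 1 + K * ‖z‖ ≤ (1 + K) * (1 + ‖z‖) := by nlinarith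
    nlinarith [norm_nonneg x]
  calc _ ≤ C * schwartzNorm N (tfShift z φ₁) *
        schwartzNorm N (tfShift (ofReIm x (-imVec z)) (reflect φ₂)) := hb _ _
    _ ≤ C * (C' * (1 + ‖z‖) ^ L * schwartzNorm N' φ₁) *
        (C' * (1 + ‖ofReIm x (-imVec z)‖) ^ L * schwartzNorm N' (reflect φ₂)) := by
        have := apply_nonneg (schwartzNorm N) (tfShift (ofReIm x (-imVec z)) (reflect φ₂))
        gcongr
        · exact h _ _
        · exact h _ _
    _ ≤ C * (C' * (1 + ‖z‖) ^ L * schwartzNorm N' φ₁) *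
        (C' * ((1 + K) * (1 + ‖z‖) * (1 + ‖x‖)) ^ L * schwartzNorm N' (reflect φ₂)) := by
        gcongr
    _ = _ := by
        rw [mul_pow, mul_pow, pow_add]
        ring

theorem continuous_operator_tfShift (hp : 1 ≤ p)
    (hA : IsBoundedOperatorOn (modulationSpace d p) (modulationNorm p) A) (φ₁ φ₂ : 𝓢(RSpace d, ℂ)) :
    Continuous fun q : CSpace d × RSpace d => A (tfShift q.1 φ₁ : 𝓢'(RSpace d, ℂ))
      (reflectShift (modulate (imVec q.1) φ₂) q.2) := by
  refine continuous_operator_apply hp hA ((continuous_tfShift φ₁).comp continuous_fst) ?_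
  simp only [reflectShift_modulate]
  have h1 : Continuous fun q : CSpace d × RSpace d => imVec q.1 :=
    imVec.continuous.comp continuous_fst
  have h2 : Continuous fun q : CSpace d × RSpace d => ofReIm q.2 (-imVec q.1) :=
    continuous_ofReIm.comp (continuous_snd.prodMk h1.neg)
  have h3 : Continuous fun q : CSpace d × RSpace d =>
      Complex.exp ((Real.pi * inner ℝ q.2 (imVec q.1) : ℝ) * Complex.I) := by fun_prop
  exact h3.smul (continuous_tfShift_comp h2 _)

/-- Translation invariance recovers the value at `x` from the value at the origin; hence a
functional built from values at 0 determines the whole operator. -/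
theorem operator_tfShift_sub_realVec (hp : 1 ≤ p)
    (hA : IsBoundedOperatorOn (modulationSpace d p) (modulationNorm p) A)
    (hAT : ∀ y : RSpace d, ∀ f ∈ modulationSpace d p, A (translate y f) = translate y (A f))
    (φ₁ g : 𝓢(RSpace d, ℂ)) (z : CSpace d) (x : RSpace d) :
    Complex.exp ((Real.pi * inner ℝ x (imVec z) : ℝ) * Complex.I) *
      A (tfShift (z - realVec x) φ₁ : 𝓢'(RSpace d, ℂ)) (reflectShift g 0) =
    A (tfShift z φ₁ : 𝓢'(RSpace d, ℂ)) (reflectShift g x) := by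
  have e : z + realVec (-x) = z - realVec x := by
    funext j
    simp [realVec, sub_eq_add_neg]
  have h1 := compSubConst_tfShift (-x) z φ₁
  rw [e, inner_neg_left, mul_neg, neg_neg] at h1
  have h2 := operator_compSubConst hp hAT (tfShift z φ₁) (reflectShift g 0) (-x)
  rw [h1, map_smul, hA.map_smul _ _ (schwartz_mem_modulationSpace hp _), neg_neg,
    reflectShift_eq, SchwartzMap.compSubConstCLM_comp, zero_add] at h2
  exact h2

/-- Bounded translation invariant operators on `M^p` are convolution operators. -/
theorem exists_isConvolution (hp : 1 ≤ p)
    (hA : IsBoundedOperatorOn (modulationSpace d p) (modulationNorm p) A)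
    (hAT : ∀ y : RSpace d, ∀ f ∈ modulationSpace d p, A (translate y f) = translate y (A f)) :
    ∃ u : 𝓢'(RSpace d, ℂ), ∀ f : 𝓢(RSpace d, ℂ), IsConvolution u f (A (f : 𝓢'(RSpace d, ℂ))) := by
  obtain ⟨φ₁, φ₂, hφ⟩ := exists_gaussWindow_eq_integral d
  have hBcont := continuous_operator_tfShift hp hA φ₁ φ₂
  obtain ⟨L, L', C, hC, hBb⟩ := exists_norm_operator_tfShift_le hp hA φ₁ φ₂
  have hBT : ∀ z x, Complex.exp ((Real.pi * inner ℝ x (imVec z) : ℝ) * Complex.I) *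
      A (tfShift (z - realVec x) φ₁ : 𝓢'(RSpace d, ℂ))
        (reflectShift (modulate (imVec (z - realVec x)) φ₂) 0) =
      A (tfShift z φ₁ : 𝓢'(RSpace d, ℂ)) (reflectShift (modulate (imVec z) φ₂) x) := by
    intro z x
    rw [map_sub, imVec_realVec, sub_zero]
    exact operator_tfShift_sub_realVec hp hA hAT φ₁ _ z x
  have hBg := operator_tfShift_apply hp hA hAT hφ
  -- B z x is the value at `x` of the function A(ρ(z)φ₀). Only its continuity, growth, translation
  -- covariance and representing property `hBg` are used below.
  generalize hB : (fun (z : CSpace d) (x : RSpace d) =>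
    A (tfShift z φ₁ : 𝓢'(RSpace d, ℂ)) (reflectShift (modulate (imVec z) φ₂) x)) = B at *
  have hB' : ∀ z x, A (tfShift z φ₁ : 𝓢'(RSpace d, ℂ)) (reflectShift (modulate (imVec z) φ₂) x) =
    B z x := fun z x => congrFun (congrFun hB z) x
  simp only [hB'] at hBcont hBb hBT hBg
  have hB0c : Continuous fun z => B z 0 := hBcont.comp (continuous_id.prodMk continuous_const)
  have hB0 : ∀ z, ‖B z 0‖ ≤ C * (1 + ‖z‖) ^ L := fun z => by simpa using hBb z 0
  have hint : ∀ g, Integrable fun z => coeff (gaussWindow d) g z * B z 0 := fun g =>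
    integrable_coeff_mul _ g hB0c.aestronglyMeasurable hB0
  obtain ⟨N₁, C₁, hC₁, h₁⟩ := exists_coeff_decay (gaussWindow d) (L + (2 * d + 1))
  have hdecay : ∀ g z, ‖coeff (gaussWindow d) g z‖ * (1 + ‖z‖) ^ L ≤
      C₁ * schwartzNorm N₁ g * weight z := by
    intro g z
    have hpos : 0 < (1 + ‖z‖) ^ (2 * d + 1) := by positivity
    rw [weight, ← div_eq_mul_inv, le_div_iff₀ hpos]
    refine le_trans (le_of_eq ?_) (h₁ g z)
    rw [pow_add]
    ring
  obtain ⟨N₂, C₂, hC₂, h₂⟩ := exists_schwartzNorm_map_le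
    ((reflect (d := d)).restrictScalars ℝ) N₁
  -- Formally u(g) is the value at 0 of `A` on the reflection of `g`, expanded in the ρ(z)φ₀.
  obtain ⟨u, hu⟩ : ∃ u : 𝓢'(RSpace d, ℂ), ∀ g,
      u g = ∫ z, coeff (gaussWindow d) (reflect g) z * B z 0 := by
    refine exists_distribution (L := fun g => ∫ z, coeff (gaussWindow d) (reflect g) z * B z 0)
      (fun f g => ?_) (fun c f => ?_) (N := N₂)
      (C := C₁ * C₂ * C * ∫ z : CSpace d, weight z)
      (mul_nonneg (by positivity) (integral_nonneg weight_nonneg)) (fun g => ?_)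
    · rw [← integral_add (hint _) (hint _)]
      simp only [map_add, coeff_add, add_mul]
    · rw [← integral_const_mul]
      simp only [map_smul, coeff_smul, mul_assoc]
    · refine (norm_integral_le_of_norm_le
        (integrable_weight.const_mul (C₁ * C₂ * C * schwartzNorm N₂ g))
        (Eventually.of_forall fun z => ?_)).trans (le_of_eq ?_)
      · rw [norm_mul]
        have hw := weight_nonneg z
        calc _ ≤ ‖coeff (gaussWindow d) (reflect g) z‖ * (C * (1 + ‖z‖) ^ L) := by
              gcongr
              exact hB0 z
          _ = C * (‖coeff (gaussWindow d) (reflect g) z‖ * (1 + ‖z‖) ^ L) := by ring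
          _ ≤ C * (C₁ * (C₂ * schwartzNorm N₂ g) * weight z) := by
              refine mul_le_mul_of_nonneg_left ((hdecay _ z).trans ?_) hC
              exact mul_le_mul_of_nonneg_right (mul_le_mul_of_nonneg_left (h₂ g) hC₁) hw
          _ = _ := by ring
      · rw [integral_const_mul]
        ring
  refine ⟨u, fun f g => ?_⟩
  -- Shifting the variable `z` by `x` and using the covariance `hBT` turns values at 0 into values
  -- at `x`.
  have hux : ∀ x, u (reflectShift f x) = ∫ z, coeff (gaussWindow d) f z * B z x := by
    intro x
    rw [hu, reflect_reflectShift, ← integral_sub_right_eq_self _ (realVec x)]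
    refine integral_congr_ae (Eventually.of_forall fun z => ?_)
    simp only [coeff_compSubConst]
    rw [sub_add_cancel, map_sub, imVec_realVec, sub_zero, ← hBT z x]
    ring
  obtain ⟨τ, hτ⟩ := exists_distribution_operator hp hA g
  rw [← hτ, (distribution_eq_integral integral_sq_norm_gaussWindow τ f).2]
  simp only [hτ, hBg, hux]
  -- Fubini exchanges the expansion of `f` with the integration against `g`: coefficients and `g`
  -- beat the polynomial growth of `B`.
  have hprod : Integrable (Function.uncurry fun (z : CSpace d) (x : RSpace d) =>
      coeff (gaussWindow d) f z * (g x * B z x)) (volume.prod volume) := by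
    have e1 : Integrable fun x : RSpace d => (1 + ‖x‖) ^ L' * ‖g x‖ :=
      integrable_one_add_norm_pow_mul L' g
    have e2 : Integrable fun z : CSpace d => C * (C₁ * schwartzNorm N₁ f * weight z) :=
      (integrable_weight.const_mul _).const_mul _
    have hc1 := continuous_coeff (gaussWindow d) f
    refine (e2.mul_prod e1).mono' (Continuous.aestronglyMeasurable ?_)
      (Eventually.of_forall fun q => ?_)
    · exact (hc1.comp continuous_fst).mul ((g.continuous.comp continuous_snd).mul hBcont)
    · rw [Function.uncurry, norm_mul, norm_mul]
      calc _ ≤ ‖coeff (gaussWindow d) f q.1‖ *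
            (‖g q.2‖ * (C * (1 + ‖q.1‖) ^ L * (1 + ‖q.2‖) ^ L')) := by
            gcongr
            exact hBb _ _
        _ = C * (‖coeff (gaussWindow d) f q.1‖ * (1 + ‖q.1‖) ^ L) *
            ((1 + ‖q.2‖) ^ L' * ‖g q.2‖) := by ring
        _ ≤ _ := mul_le_mul_of_nonneg_right (mul_le_mul_of_nonneg_left (hdecay f q.1) hC)
            (by positivity)
  have e3 := integral_integral_swap hprod
  simp only [integral_const_mul] at e3
  rw [e3]
  refine integral_congr_ae (Eventually.of_forall fun x => ?_)
  simp only
  rw [← integral_mul_const]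
  refine integral_congr_ae (Eventually.of_forall fun z => ?_)
  simp only
  ring

end Convolutor


/-! ### Operators on polyanalytic Sobolev-Fock spaces -/

section Transfer

open Filter Topology

variable {d : ℕ} {p : ℝ≥0∞}

/-- Conjugation by the isomorphism B^k, whose inverse on its range is the adjoint. -/
theorem isBoundedOperatorOn_fockSpace (hp : 1 ≤ p) (k : Fin d → ℕ)
    {A : 𝓢'(RSpace d, ℂ) → 𝓢'(RSpace d, ℂ)}
    (hA : IsBoundedOperatorOn (modulationSpace d p) (modulationNorm p) A) :
    IsBoundedOperatorOn (fockSpace k p) (fockNorm p)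
      (fun F => polyBargmann k (A (polyBargmannAdjoint k F))) where
  mapsTo := by
    rintro _ ⟨f, hf, rfl⟩
    rw [polyBargmannAdjoint_polyBargmann]
    exact ⟨_, hA.mapsTo f hf, rfl⟩
  map_add := by
    rintro _ ⟨f, hf, rfl⟩ _ ⟨g, hg, rfl⟩
    rw [← polyBargmann_add]
    simp only [polyBargmannAdjoint_polyBargmann]
    rw [hA.map_add f hf g hg, polyBargmann_add]
  map_smul := by
    rintro c _ ⟨f, hf, rfl⟩
    rw [← polyBargmann_smul]
    simp only [polyBargmannAdjoint_polyBargmann]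
    rw [hA.map_smul c f hf, polyBargmann_smul]
  bound := by
    obtain ⟨C, h⟩ := hA.bound
    obtain ⟨C₁, h₁⟩ := exists_fockNorm_polyBargmann_le (d := d) hp k
    obtain ⟨C₂, h₂⟩ := exists_modulationNorm_le_fockNorm (d := d) hp k
    refine ⟨C₁ * (C * C₂), ?_⟩
    rintro _ ⟨f, hf, rfl⟩
    simp only [polyBargmannAdjoint_polyBargmann]
    calc _ ≤ C₁ * modulationNorm p (A f) := h₁ _
      _ ≤ C₁ * (C * (C₂ * fockNorm p (polyBargmann k f))) := by
          gcongr
          refine (h f hf).trans ?_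
          gcongr
          exact h₂ f
      _ = _ := by push_cast; ring

theorem isTranslationInvariant_fockSpace (k : Fin d → ℕ)
    {A : 𝓢'(RSpace d, ℂ) → 𝓢'(RSpace d, ℂ)}
    (hAT : ∀ y : RSpace d, ∀ f ∈ modulationSpace d p, A (translate y f) = translate y (A f)) :
    IsTranslationInvariant k p (fun F => polyBargmann k (A (polyBargmannAdjoint k F))) := by
  rintro y _ ⟨f, hf, rfl⟩
  rw [realShift_polyBargmann]
  simp only [polyBargmannAdjoint_polyBargmann]
  rw [hAT y f hf, realShift_polyBargmann]

theorem isBoundedOperatorOn_modulationSpace (hp : 1 ≤ p) (k : Fin d → ℕ)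
    {S : (CSpace d → ℂ) → (CSpace d → ℂ)}
    (hS : IsBoundedOperatorOn (fockSpace k p) (fockNorm p) S) :
    IsBoundedOperatorOn (modulationSpace d p) (modulationNorm p)
      (fun f => polyBargmannAdjoint k (S (polyBargmann k f))) where
  mapsTo := by
    intro f hf
    obtain ⟨g, hg, h⟩ := hS.mapsTo _ ⟨f, hf, rfl⟩
    rw [← h, polyBargmannAdjoint_polyBargmann]
    exact hg
  map_add := by
    intro f hf g hg
    obtain ⟨f', hf', h⟩ := hS.mapsTo _ ⟨f, hf, rfl⟩
    obtain ⟨g', hg', h'⟩ := hS.mapsTo _ ⟨g, hg, rfl⟩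
    rw [polyBargmann_add, hS.map_add _ ⟨f, hf, rfl⟩ _ ⟨g, hg, rfl⟩, ← h, ← h', ← polyBargmann_add]
    simp only [polyBargmannAdjoint_polyBargmann]
  map_smul := by
    intro c f hf
    obtain ⟨f', hf', h⟩ := hS.mapsTo _ ⟨f, hf, rfl⟩
    rw [polyBargmann_smul, hS.map_smul c _ ⟨f, hf, rfl⟩, ← h, ← polyBargmann_smul]
    simp only [polyBargmannAdjoint_polyBargmann]
  bound := by
    obtain ⟨C, h⟩ := hS.bound
    obtain ⟨C₁, h₁⟩ := exists_fockNorm_polyBargmann_le (d := d) hp k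
    obtain ⟨C₂, h₂⟩ := exists_modulationNorm_le_fockNorm (d := d) hp k
    refine ⟨C₂ * (C * C₁), fun f hf => ?_⟩
    obtain ⟨f', hf', h'⟩ := hS.mapsTo _ ⟨f, hf, rfl⟩
    have h3 := h _ ⟨f, hf, rfl⟩
    rw [← h'] at h3
    rw [← h', polyBargmannAdjoint_polyBargmann]
    calc _ ≤ C₂ * fockNorm p (polyBargmann k f') := h₂ _
      _ ≤ C₂ * (C * (C₁ * modulationNorm p f)) := by
          gcongr
          refine h3.trans ?_
          gcongr
          exact h₁ f
      _ = _ := by push_cast; ring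

theorem commute_translate_modulationSpace (k : Fin d → ℕ)
    {S : (CSpace d → ℂ) → (CSpace d → ℂ)}
    (hS : IsBoundedOperatorOn (fockSpace k p) (fockNorm p) S)
    (hST : IsTranslationInvariant k p S) (y : RSpace d) (f : 𝓢'(RSpace d, ℂ))
    (hf : f ∈ modulationSpace d p) :
    polyBargmannAdjoint k (S (polyBargmann k (translate y f))) =
      translate y (polyBargmannAdjoint k (S (polyBargmann k f))) := by
  obtain ⟨f', hf', h⟩ := hS.mapsTo _ ⟨f, hf, rfl⟩
  rw [← realShift_polyBargmann, hST y _ ⟨f, hf, rfl⟩, ← h, realShift_polyBargmann]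
  simp only [polyBargmannAdjoint_polyBargmann]

/-- A bounded operator on `F^p_k` is determined by its restriction to `F^1_k`. -/
theorem eqOn_fockSpace_of_eqOn_one (hp : 1 ≤ p) (hp' : p ≠ ∞) (k : Fin d → ℕ)
    {S T : (CSpace d → ℂ) → (CSpace d → ℂ)}
    (hS : IsBoundedOperatorOn (fockSpace k p) (fockNorm p) S)
    (hT : IsBoundedOperatorOn (fockSpace k p) (fockNorm p) T)
    (h : Set.EqOn S T (fockSpace k 1)) : Set.EqOn S T (fockSpace k p) := by
  rintro _ ⟨f, hf, rfl⟩
  have hS' := isBoundedOperatorOn_modulationSpace hp k hS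
  have hT' := isBoundedOperatorOn_modulationSpace hp k hT
  obtain ⟨G, -, hG⟩ := exists_tendsto_modulationNorm hp hp' integral_sq_norm_gaussWindow hf
  have h1 : polyBargmannAdjoint k (S (polyBargmann k f)) =
      polyBargmannAdjoint k (T (polyBargmann k f)) := by
    ext g
    refine tendsto_nhds_unique (tendsto_operator_apply hp hS' hf hG g) ?_
    refine (tendsto_operator_apply hp hT' hf hG g).congr fun n => ?_
    -- The approximants are Schwartz functions, which lie in M¹, where the operators agree.
    rw [h ⟨_, schwartz_mem_modulationSpace le_rfl (G n), rfl⟩]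
  obtain ⟨f₁, -, e₁⟩ := hS.mapsTo _ ⟨f, hf, rfl⟩
  obtain ⟨f₂, -, e₂⟩ := hT.mapsTo _ ⟨f, hf, rfl⟩
  rw [← e₁, ← e₂, polyBargmannAdjoint_polyBargmann, polyBargmannAdjoint_polyBargmann] at h1
  rw [← e₁, ← e₂, h1]

end Transfer

end PolyFock

end

/-! ### The main theorem -/

theorem mainTheorem2 (d : ℕ) (k : Fin d → ℕ) (p : ℝ≥0∞) (hp : 1 ≤ p) (hp' : p ≠ ∞) :
    (∀ u ∈ PolyFock.convolutors d p,
      (∀ F ∈ PolyFock.fockSpace k 1,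
        (∀ z : PolyFock.CSpace d,
          Integrable (PolyFock.kernelIntegrand (PolyFock.phiKernel k u)
            (PolyFock.tildeTransform k F) z) ∧
          Integrable (PolyFock.kernelIntegrand (PolyFock.psiKernel k u) F z)) ∧
        PolyFock.kernelOperator (PolyFock.phiKernel k u) (PolyFock.tildeTransform k F) =
          PolyFock.kernelOperator (PolyFock.psiKernel k u) F ∧
        PolyFock.kernelOperator (PolyFock.psiKernel k u) F ∈ PolyFock.fockSpace k ∞) ∧
      ∃ S : (PolyFock.CSpace d → ℂ) → (PolyFock.CSpace d → ℂ),
        (PolyFock.IsBoundedOperatorOn (PolyFock.fockSpace k p) (PolyFock.fockNorm p) S ∧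
          PolyFock.IsTranslationInvariant k p S ∧
          ∀ F ∈ PolyFock.fockSpace k 1,
            S F = PolyFock.kernelOperator (PolyFock.psiKernel k u) F) ∧
        ∀ S' : (PolyFock.CSpace d → ℂ) → (PolyFock.CSpace d → ℂ),
          PolyFock.IsBoundedOperatorOn (PolyFock.fockSpace k p) (PolyFock.fockNorm p) S' →
          (∀ F ∈ PolyFock.fockSpace k 1,
            S' F = PolyFock.kernelOperator (PolyFock.psiKernel k u) F) →
          Set.EqOn S' S (PolyFock.fockSpace k p)) ∧
    (∀ S : (PolyFock.CSpace d → ℂ) → (PolyFock.CSpace d → ℂ),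
      PolyFock.IsBoundedOperatorOn (PolyFock.fockSpace k p) (PolyFock.fockNorm p) S →
      PolyFock.IsTranslationInvariant k p S →
      ∃ u ∈ PolyFock.convolutors d p, ∀ F ∈ PolyFock.fockSpace k 1,
        S F = PolyFock.kernelOperator (PolyFock.phiKernel k u) (PolyFock.tildeTransform k F) ∧
        S F = PolyFock.kernelOperator (PolyFock.psiKernel k u) F) := by
  constructor
  · rintro u ⟨A, hA, hAT, hu⟩
    have hform := fun {f} (hf : f ∈ PolyFock.modulationSpace d 1) =>
      PolyFock.polyBargmann_operator_eq_kernelOperator hp hp' hA hu k hf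
    have hpsi : ∀ f ∈ PolyFock.modulationSpace d 1,
        PolyFock.kernelOperator (PolyFock.psiKernel k u) (PolyFock.polyBargmann k f) =
          PolyFock.polyBargmann k (A f) :=
      fun f hf => funext fun z => (hform hf z).1.2.symm
    refine ⟨?_, fun F => PolyFock.polyBargmann k (A (PolyFock.polyBargmannAdjoint k F)),
      ⟨PolyFock.isBoundedOperatorOn_fockSpace hp k hA,
        PolyFock.isTranslationInvariant_fockSpace k hAT, ?_⟩, fun S' hS' h => ?_⟩
    · rintro _ ⟨f, hf, rfl⟩
      rw [PolyFock.tildeTransform_polyBargmann]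
      refine ⟨fun z => ⟨(hform hf z).2.1, (hform hf z).1.1⟩,
        funext fun z => (hform hf z).2.2.symm.trans (hform hf z).1.2, ?_⟩
      rw [hpsi f hf]
      -- The chain is f ∈ M¹ ⊆ M^p, then Af ∈ M^p ⊆ M^∞.
      exact ⟨A f, PolyFock.modulationSpace_subset_top hp
        (hA.mapsTo f (PolyFock.modulationSpace_one_subset hp hf)), rfl⟩
    · rintro _ ⟨f, hf, rfl⟩
      simp only [hpsi f hf, PolyFock.polyBargmannAdjoint_polyBargmann]
    · refine PolyFock.eqOn_fockSpace_of_eqOn_one hp hp' k hS'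
        (PolyFock.isBoundedOperatorOn_fockSpace hp k hA) ?_
      rintro _ ⟨f, hf, rfl⟩
      simp only [h _ ⟨f, hf, rfl⟩, hpsi f hf, PolyFock.polyBargmannAdjoint_polyBargmann]
  · intro S hS hST
    have hA := PolyFock.isBoundedOperatorOn_modulationSpace hp k hS
    have hAT := PolyFock.commute_translate_modulationSpace k hS hST
    obtain ⟨u, hu⟩ := PolyFock.exists_isConvolution hp hA hAT
    refine ⟨u, ⟨_, hA, hAT, hu⟩, ?_⟩
    rintro _ ⟨f, hf, rfl⟩
    have hform := PolyFock.polyBargmann_operator_eq_kernelOperator hp hp' hA hu k hf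
    -- `f'` is the image of `f` under the operator transported to M^p, so its transform is the value
    -- of `S`.
    obtain ⟨f', -, e⟩ := hS.mapsTo _ ⟨f, PolyFock.modulationSpace_one_subset hp hf, rfl⟩
    simp only [← e, PolyFock.polyBargmannAdjoint_polyBargmann] at hform
    rw [PolyFock.tildeTransform_polyBargmann, ← e]
    exact ⟨funext fun z => (hform z).2.2, funext fun z => (hform z).1.2⟩
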